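/- Let $d\in\mathbb N$, $T>0$, and let $\Omega=C([0,T];\mathbb R^d)$ carry the uniform topology, its Borel $\sigma$-algebra and the canonical process $(X_t)_{t\in[0,T]}$. For a probability measure $\mathrm P$ on $\Omega$ write $\mathrm P_t$ for the law of $X_t$ under $\mathrm P$; $\mathcal P_1(\Omega)$ is the set of Borel probability measures on $\Omega$ for which $\sup_{t\le T}|X_t|$ is integrable, and $\mathcal P_2(\mathbb R^d)$ the set of Borel probability measures on $\mathbb R^d$ with finite second moment. $\mathcal H(\mathrm P|\mathrm Q)=\mathbb E_{\mathrm P}[\log\frac{d\mathrm P}{d\mathrm Q}]\in[0,+\infty]$ if $\mathrm P\ll\mathrm Q$, and $+\infty$ otherwise, is the relative entropy. Assume: (H1) $W:\mathbb R^d\to\mathbb R$ is of class $C^2$, symmetric ($W(-z)=W(z)$), and has bounded Hessian: $\sup_{z,v\in\mathbb R^d,\,|v|=1}|v\cdot\nabla^2W(z)\,v|<+\infty$. (H2) $\mu^{\mathrm{in}},\mu^{\mathrm{fin}}\in\mathcal P_2(\mathbb R^d)$ and $\tilde{\mathcal F}(\mu^{\mathrm{in}}),\tilde{\mathcal F}(\mu^{\mathrm{fin}})<+\infty$,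 where $\tilde{\mathcal F}(\mu)=\int\log\frac{d\mu}{d\lambda}\,d\mu+\int\!\!\int W(x-y)\,\mu(dy)\,\mu(dx)$ if $\mu$ is absolutely continuous with respect to Lebesgue measure $\lambda$, and $\tilde{\mathcal F}(\mu)=+\infty$ otherwise. Then for every $\mathrm P\in\mathcal P_1(\Omega)$ the stochastic differential equation $$dZ_t=-(\nabla W*\mathrm P_t)(Z_t)\,dt+dB_t,\quad t\in[0,T],\qquad Z_0\sim\mu^{\mathrm{in}},$$ with $B$ a standard $d$-dimensional Brownian motion independent of $Z_0$ and $(\nabla W*\mathrm P_t)(z)=\int\nabla W(z-y)\,\mathrm P_t(dy)$, has a strong solution, whose law $\Gamma(\mathrm P)$ on $\Omega$ is uniquely determined; and the mean field Schrödinger problem $$\inf\{\mathcal H(\mathrm P|\Gamma(\mathrm P)):\ \mathrm P\in\mathcal P_1(\Omega),\ \mathrm P_0=\mu^{\mathrm{in}},\ \mathrm P_T=\mu^{\mathrm{fin}}\}$$ admits at least one optimizer, i.e. there is an admissible $\mathrm P$ with $\mathcal H(\mathrm P|\Gamma(\mathrm P))\le\mathcal H(\mathrm P'|\Gamma(\mathrm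 P'))$ for every admissible $\mathrm P'$. -/

import Mathlib

open MeasureTheory ProbabilityTheory Set Filter
open scoped NNReal ENNReal

noncomputable section

namespace MeanFieldSchrodinger

/-- `ℝᵈ` with its Euclidean norm. -/
abbrev E (d : ℕ) : Type := EuclideanSpace ℝ (Fin d)

/-- The space `Ω` of continuous paths `[0,T] → ℝᵈ`, with the uniform topology
(its norm is `ω ↦ sup_{t ≤ T} |ω t|`). -/
abbrev PathSpace (d : ℕ) (T : ℝ≥0) : Type := C(Set.Icc (0 : ℝ) (T : ℝ), E d)

instance instMeasurableSpacePathSpace (d : ℕ) (T : ℝ≥0) : MeasurableSpace (PathSpace d T) :=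
  borel _

instance instBorelSpacePathSpace (d : ℕ) (T : ℝ≥0) : BorelSpace (PathSpace d T) := ⟨rfl⟩

/-- The canonical process `X_t(ω) = ω(t)`. It is only used for `t ∈ [0,T]`; a real `t` outside
`[0,T]` is replaced by the nearest endpoint. -/
def X {d : ℕ} {T : ℝ≥0} (t : ℝ) (ω : PathSpace d T) : E d :=
  ω (Set.projIcc (0 : ℝ) T T.2 t)

/-- The time marginal `P_t`. -/
def marginal {d : ℕ} {T : ℝ≥0} (P : Measure (PathSpace d T)) (t : ℝ) : Measure (E d) :=
  P.map (X t)

/-- `P ∈ 𝒫₁(Ω)`. -/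
def MemP1 {d : ℕ} {T : ℝ≥0} (P : Measure (PathSpace d T)) : Prop :=
  IsProbabilityMeasure P ∧ Integrable (fun ω => ‖ω‖) P

/-- `μ ∈ 𝒫₂(ℝᵈ)`. -/
def MemP2 {d : ℕ} (μ : Measure (E d)) : Prop :=
  IsProbabilityMeasure μ ∧ Integrable (fun x => ‖x‖ ^ 2) μ

/-- The potential `W` is `C²`, even, with bounded Hessian. -/
structure H1 {d : ℕ} (W : E d → ℝ) : Prop where
  contDiff : ContDiff ℝ 2 W
  even : ∀ z, W (-z) = W z
  bounded_hessian : ∃ C : ℝ, ∀ z v : E d, ‖v‖ = 1 → |iteratedFDeriv ℝ 2 W z ![v, v]| ≤ C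

/-- The integral `∫ f dμ = ∫ f⁺ dμ - ∫ f⁻ dμ` with values in `[-∞, +∞]`. -/
def extIntegral {α : Type*} [MeasurableSpace α] (f : α → ℝ) (μ : Measure α) : EReal :=
  ((∫⁻ x, ENNReal.ofReal (f x) ∂μ : ℝ≥0∞) : EReal) -
    ((∫⁻ x, ENNReal.ofReal (-f x) ∂μ : ℝ≥0∞) : EReal)

open Classical in
/-- The free energy `∫ log μ dμ + ∫ W ∗ μ dμ` if `μ ≪ λ` and `+∞` otherwise. -/
def freeEnergy {d : ℕ} (W : E d → ℝ) (μ : Measure (E d)) : EReal :=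
  if μ ≪ volume then
    extIntegral (fun x => Real.log (μ.rnDeriv volume x).toReal) μ +
      extIntegral (fun x => ∫ y, W (x - y) ∂μ) μ
  else ⊤

/-- The marginals are in `𝒫₂(ℝᵈ)` and have free energy `< +∞`. -/
structure H2 {d : ℕ} (W : E d → ℝ) (μin μfin : Measure (E d)) : Prop where
  memP2_in : MemP2 μin
  memP2_fin : MemP2 μfin
  freeEnergy_in : freeEnergy W μin < ⊤
  freeEnergy_fin : freeEnergy W μfin < ⊤

/-- A standard Brownian motion in `ℝᵈ`: the coordinates are independent real Brownian motions. -/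
structure IsBrownianMotion {d : ℕ} {Ω' : Type*} [MeasurableSpace Ω'] (Pr : Measure Ω')
    (B : ℝ≥0 → Ω' → E d) : Prop where
  measurable : ∀ t, Measurable (B t)
  isBrownianReal : ∀ i, IsBrownianReal (fun t ω => B t ω i) Pr
  iIndepFun : iIndepFun (fun (i : Fin d) ω (t : ℝ≥0) => B t ω i) Pr

/-- The σ-algebra `σ(Z₀, B_s : s ≤ t)`. -/
abbrev noiseSigma {d : ℕ} {Ω' : Type*} (Z₀ : Ω' → E d) (B : ℝ≥0 → Ω' → E d) (t : ℝ≥0) :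
    MeasurableSpace Ω' :=
  MeasurableSpace.comap Z₀ inferInstance ⊔
    ⨆ s : {s : ℝ≥0 // s ≤ t}, MeasurableSpace.comap (B s) inferInstance

/-- `Z` is a strong solution on `[0,T]` of `dZ_t = b(t, Z_t) dt + dB_t`, `Z_0 ∼ μ₀`, driven by the
Brownian motion `B`, which is independent of `Z_0`. In `adapted`, being almost everywhere equal to
a `σ(Z₀, B_s : s ≤ t)`-measurable map is measurability for the completed σ-algebra. -/
structure IsStrongSolution {d : ℕ} {T : ℝ≥0} (b : ℝ → E d → E d) (μ₀ : Measure (E d))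
    {Ω' : Type*} [MeasurableSpace Ω'] (Pr : Measure Ω') (B : ℝ≥0 → Ω' → E d)
    (Z : Ω' → PathSpace d T) : Prop where
  isBrownianMotion : IsBrownianMotion Pr B
  measurable : Measurable Z
  law_initial : Pr.map (fun ω => X 0 (Z ω)) = μ₀
  indep : IndepFun (fun ω => X 0 (Z ω)) (fun ω (t : ℝ≥0) => B t ω) Pr
  adapted : ∀ t : ℝ≥0, t ≤ T →
    AEStronglyMeasurable[noiseSigma (fun ω => X 0 (Z ω)) B t] (fun ω => X (t : ℝ) (Z ω)) Pr
  equation : ∀ᵐ ω ∂Pr, ∀ t : ℝ≥0, t ≤ T →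
    X (t : ℝ) (Z ω) = X 0 (Z ω) + (∫ s in (0 : ℝ)..t, b s (X s (Z ω))) + B t ω

/-- `Q` is the law on `Ω` of a strong solution of `dZ_t = b(t, Z_t) dt + dB_t`, `Z_0 ∼ μ₀`. -/
def IsLawOfStrongSolution {d : ℕ} {T : ℝ≥0} (b : ℝ → E d → E d) (μ₀ : Measure (E d))
    (Q : Measure (PathSpace d T)) : Prop :=
  ∃ (Ω' : Type) (_ : MeasurableSpace Ω') (Pr : Measure Ω') (B : ℝ≥0 → Ω' → E d)
    (Z : Ω' → PathSpace d T),
    IsProbabilityMeasure Pr ∧ IsStrongSolution b μ₀ Pr B Z ∧ Q = Pr.map Z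

/-- The drift `(t, z) ↦ -(∇W ∗ P_t)(z)`. -/
def drift {d : ℕ} {T : ℝ≥0} (W : E d → ℝ) (P : Measure (PathSpace d T)) (t : ℝ) (z : E d) : E d :=
  -∫ y, gradient W (z - y) ∂(marginal P t)

/-- `Γ(P)`: the law of the strong solution of `dZ_t = -(∇W ∗ P_t)(Z_t) dt + dB_t`, `Z_0 ∼ μ₀`. -/
def Gamma {d : ℕ} {T : ℝ≥0} (W : E d → ℝ) (μ₀ : Measure (E d)) (P : Measure (PathSpace d T)) :
    Measure (PathSpace d T) :=
  Classical.epsilon fun Q => IsLawOfStrongSolution (drift W P) μ₀ Q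

/-- The admissible set: `P ∈ 𝒫₁(Ω)` with `P_0 = μ^in` and `P_T = μ^fin`. -/
def admissible {d : ℕ} (T : ℝ≥0) (μin μfin : Measure (E d)) : Set (Measure (PathSpace d T)) :=
  {P | MemP1 P ∧ marginal P 0 = μin ∧ marginal P T = μfin}

/-- The cost `ℋ(P | Γ(P)) ∈ [0, +∞]`. -/
def cost {d : ℕ} {T : ℝ≥0} (W : E d → ℝ) (μin : Measure (E d)) (P : Measure (PathSpace d T)) :
    ℝ≥0∞ :=
  InformationTheory.klDiv P (Gamma W μin P)

end MeanFieldSchrodinger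

end

/-! For a drift b that is Lipschitz in space, the map `Drift.noise`, z ↦ z - ∫₀ᵗ b(s, z_s) ds, is a
homeomorphism of path space with inverse `Drift.solve`: injective by Grönwall, surjective by Picard
iteration. A process solves the equation exactly when its noise is Z₀ + B. Hence, with R the law of
Z₀ + B, the image of R under `Drift.solve` is the law of a strong solution, and the only one
(`exists_noiseLaw`). The bounded Hessian makes ∇W Lipschitz and evenness gives ∇W(0) = 0, so -∇W ∗
P_t is such a drift for every P in 𝒫₁(Ω), with a Lipschitz constant that does not depend on P. This
gives the well-posedness of the equation.

Relative entropy is invariant under bimeasurable bijections, so the cost of P is the entropy,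
relative to the fixed measure R, of the image of P under its own noise map (`cost_eq`). The direct
method then applies. Away from the initial value R has Gaussian tails, so a bounded cost bounds the
second moments of the noise and, by a mean field Grönwall argument, those of P
(`exists_uniform_bounds`). Bounded entropy also makes the noise laws uniformly absolutely continuous
with respect to R, and compact sets of noises pull back into compact sets of paths uniformly in the
drift, which gives tightness (`isTightMeasureSet_of_klDiv_noise_le`). Along a weakly convergent
minimizing subsequence the drifts converge pointwise, so the noise maps, which are equi-Lipschitz,
converge pointwise and the noise laws converge weakly (`tendsto_map_of_lipschitz`). Lower
semicontinuity of the entropy (`klDiv_le_of_tendsto`) concludes. If the infimum is +∞, any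
admissible law is optimal, and there is one (`admissible_nonempty`).

The measure R is constructed by hand: an isonormal Gaussian process gives Brownian marginals, a
fourth-moment estimate on dyadic increments gives continuous paths, and Fernique's theorem gives the
tails. -/

noncomputable section

namespace MeanFieldSchrodinger

open scoped Topology BoundedContinuousFunction
open InformationTheory

/-! ### Gaussian Hilbert spaces. -/

section Isonormal

variable {Ω : Type*} {mΩ : MeasurableSpace Ω} {P : Measure Ω}

lemma integral_norm_le_norm_Lp_two [IsProbabilityMeasure P] (Y : Lp ℝ 2 P) :
    ∫ ω, ‖Y ω‖ ∂P ≤ ‖Y‖ := by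
  have h1 : MemLp Y 1 P := (Lp.memLp Y).mono_exponent (by norm_num)
  rw [Lp.norm_def, integral_norm_eq_lintegral_enorm h1.1, ← eLpNorm_one_eq_lintegral_enorm]
  exact ENNReal.toReal_mono (Lp.memLp Y).eLpNorm_ne_top
    (eLpNorm_le_eLpNorm_of_exponent_le (by norm_num) (Lp.aestronglyMeasurable Y))

lemma norm_cexp_mul_I_sub_le (a b : ℝ) :
    ‖Complex.exp (a * Complex.I) - Complex.exp (b * Complex.I)‖ ≤ |a - b| := by
  have h : Complex.exp (a * Complex.I) - Complex.exp (b * Complex.I) =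
      Complex.exp (b * Complex.I) * (Complex.exp (Complex.I * ((a - b : ℝ) : ℂ)) - 1) := by
    rw [mul_sub, ← Complex.exp_add, mul_one]
    congr 2
    push_cast
    ring
  rw [h, norm_mul, Complex.norm_exp_ofReal_mul_I, one_mul]
  exact Real.norm_exp_I_mul_ofReal_sub_one_le

lemma norm_charFun_map_sub_le [IsProbabilityMeasure P] (Y Z : Lp ℝ 2 P) (t : ℝ) :
    ‖charFun (P.map Y) t - charFun (P.map Z) t‖ ≤ |t| * ‖Y - Z‖ := by
  have hm (Y : Lp ℝ 2 P) : AEMeasurable Y P := (Lp.aestronglyMeasurable Y).aemeasurable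
  have hi (Y : Lp ℝ 2 P) : Integrable (fun ω => Complex.exp (t * Y ω * Complex.I)) P := by
    refine Integrable.of_bound (C := 1) ?_ (ae_of_all _ fun ω => ?_)
    · have := hm Y
      exact (by fun_prop : AEMeasurable (fun ω => Complex.exp (t * Y ω * Complex.I)) P).aestronglyMeasurable
    · exact_mod_cast (Complex.norm_exp_ofReal_mul_I (t * Y ω)).le
  rw [charFun_apply_real, charFun_apply_real, integral_map (hm Y) (by fun_prop),
    integral_map (hm Z) (by fun_prop), ← integral_sub (hi Y) (hi Z)]
  have hYZ : Integrable (fun ω => ‖(Y - Z) ω‖) P :=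
    (((Lp.memLp (Y - Z)).mono_exponent (q := 2) (p := 1) (by norm_num)).integrable le_rfl).norm
  calc _ ≤ ∫ ω, |t| * ‖(Y - Z) ω‖ ∂P := by
        refine norm_integral_le_of_norm_le (hYZ.const_mul _) ?_
        filter_upwards [Lp.coeFn_sub Y Z] with ω hω
        have := norm_cexp_mul_I_sub_le (t * Y ω) (t * Z ω)
        push_cast at this
        refine this.trans_eq ?_
        rw [← mul_sub, abs_mul, hω, Pi.sub_apply, Real.norm_eq_abs]
    _ ≤ _ := by
        rw [integral_const_mul]
        exact mul_le_mul_of_nonneg_left (integral_norm_le_norm_Lp_two _) (abs_nonneg _)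

/-- Allows the law of an L² limit to be read off from the characteristic functions of the
approximations. -/
lemma continuous_charFun_map_Lp [IsProbabilityMeasure P] (t : ℝ) :
    Continuous fun Y : Lp ℝ 2 P => charFun (P.map Y) t :=
  (LipschitzWith.of_dist_le_mul (K := ⟨|t|, abs_nonneg t⟩) fun Y Z => by
    rw [dist_eq_norm, dist_eq_norm]
    exact norm_charFun_map_sub_le Y Z t).continuous

/-- An isonormal Gaussian process indexed by a real Hilbert space. -/
theorem exists_isonormal (H : Type) [NormedAddCommGroup H] [InnerProductSpace ℝ H]
    [CompleteSpace H] :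
    ∃ (Ω : Type) (_ : MeasurableSpace Ω) (P : Measure Ω) (_ : IsProbabilityMeasure P)
      (J : H →ₗᵢ[ℝ] Lp ℝ 2 P), ∀ h, P.map (J h) = gaussianReal 0 (‖h‖₊ ^ 2) := by
  classical
  obtain ⟨ι, b, -⟩ := exists_hilbertBasis ℝ H
  let P : Measure (ι → ℝ) := Measure.infinitePi fun _ => gaussianReal 0 1
  have hmp (i : ι) : MeasurePreserving (fun ω : ι → ℝ => ω i) P (gaussianReal 0 1) :=
    measurePreserving_eval_infinitePi _ i
  have hm (i : ι) : AEMeasurable (fun ω : ι → ℝ => ω i) P := (measurable_pi_apply i).aemeasurable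
  have hξ (i : ι) : MemLp (fun ω : ι → ℝ => ω i) 2 P :=
    (memLp_id_gaussianReal (μ := 0) (v := 1) 2).comp_measurePreserving (hmp i)
  have hind : iIndepFun (fun (i : ι) (ω : ι → ℝ) => ω i) P :=
    iIndepFun_infinitePi (X := fun _ x => x) fun _ => measurable_id
  have hlaw (i : ι) : HasLaw (fun ω : ι → ℝ => ω i) (gaussianReal 0 1) P :=
    (hmp i).hasLaw
  have hmean (i : ι) : ∫ ω, ω i ∂P = 0 := by
    rw [(hlaw i).integral_eq, integral_id_gaussianReal]
  let ξ (i : ι) : Lp ℝ 2 P := (hξ i).toLp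
  have hinner (i j : ι) : inner ℝ (ξ i) (ξ j) = ∫ ω, ω j * ω i ∂P := by
    rw [L2.inner_def]
    refine integral_congr_ae ?_
    filter_upwards [(hξ i).coeFn_toLp, (hξ j).coeFn_toLp] with ω h1 h2
    simp [ξ, h1, h2]
  have hon : Orthonormal ℝ ξ := by
    rw [orthonormal_iff_ite]
    intro i j
    rw [hinner]
    split_ifs with hij
    · subst hij
      have hv := (hlaw i).variance_eq
      rw [variance_of_integral_eq_zero (hm i) (hmean i), variance_id_gaussianReal] at hv
      simpa [pow_two] using hv
    · have := (hind.indepFun (Ne.symm hij)).integral_mul_eq_mul_integral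
        (hm j).aestronglyMeasurable (hm i).aestronglyMeasurable
      simpa [hmean] using this
  -- Sends the Hilbert basis to independent standard Gaussians. The image of h is then an L² limit
  -- of finite sums ∑ aᵢ ξᵢ, whose laws are centred Gaussian with variance ∑ aᵢ², and these
  -- variances tend to ‖h‖².
  let J : H →ₗᵢ[ℝ] Lp ℝ 2 P :=
    hon.orthogonalFamily.linearIsometry.comp b.repr.toLinearIsometry
  have hJ (i : ι) : J (b i) = ξ i := by
    change hon.orthogonalFamily.linearIsometry (b.repr (b i)) = ξ i
    rw [b.repr_self, OrthogonalFamily.linearIsometry_apply_single]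
    simp
  refine ⟨ι → ℝ, inferInstance, P, inferInstance, J, fun h => ?_⟩
  have := Measure.isProbabilityMeasure_map (Lp.aestronglyMeasurable (J h)).aemeasurable
  refine Measure.ext_of_charFun (funext fun t => ?_)
  obtain ⟨a, ha⟩ : ∃ a : ι → ℝ, ∀ i, a i = inner ℝ (b i) h := ⟨_, fun i => rfl⟩
  have hs1 : HasSum (fun i => a i • ξ i) (J h) := by
    have := J.toContinuousLinearMap.hasSum (b.hasSum_repr h)
    simpa [hJ, ha, b.repr_apply_apply] using this
  have hs2 : HasSum (fun i => a i ^ 2) (‖h‖ ^ 2) := by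
    have := b.hasSum_inner_mul_inner h h
    rw [real_inner_self_eq_norm_sq] at this
    convert! this using 2 with i
    rw [ha, pow_two, real_inner_comm h]
  have hfin (s : Finset ι) : charFun (P.map (∑ i ∈ s, a i • ξ i : Lp ℝ 2 P)) t =
      Complex.exp (-((∑ i ∈ s, a i ^ 2 : ℝ) * t ^ 2 / 2)) := by
    have hae : (∑ i ∈ s, a i • ξ i : Lp ℝ 2 P) =ᵐ[P] fun ω => ∑ i ∈ s, a i * ω i := by
      induction s using Finset.induction_on with
      | empty => simp only [Finset.sum_empty]; exact Lp.coeFn_zero ℝ 2 P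
      | insert i s hi ih =>
        rw [Finset.sum_insert hi]
        filter_upwards [Lp.coeFn_add (a i • ξ i) (∑ i ∈ s, a i • ξ i), Lp.coeFn_smul (a i) (ξ i),
          (hξ i).coeFn_toLp, ih] with ω h1 h2 h3 h4
        rw [h1, Pi.add_apply, h2, h4, Pi.smul_apply, h3, Finset.sum_insert hi, smul_eq_mul]
    rw [Measure.map_congr hae, iIndepFun.charFun_map_fun_finsetSum_eq_prod
      (X := fun i (ω : ι → ℝ) => a i * ω i) (fun i _ => (hm i).const_mul _), Finset.prod_apply]
    · simp_rw [charFun_map_mul_comp (hm _), (hlaw _).map_eq, charFun_gaussianReal,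
        ← Complex.exp_sum]
      congr 1
      push_cast
      rw [Finset.sum_mul, Finset.sum_div, ← Finset.sum_neg_distrib]
      refine Finset.sum_congr rfl fun i _ => ?_
      ring
    · exact (hind.comp (fun i x => a i * x) (fun i => by fun_prop)).precomp
        (g := ((↑) : s → ι)) Subtype.val_injective
  have hl1 := ((continuous_charFun_map_Lp (P := P) t).tendsto _).comp hs1
  have hl2 : Tendsto (fun s : Finset ι =>
      Complex.exp (-((∑ i ∈ s, a i ^ 2 : ℝ) * t ^ 2 / 2))) atTop
      (𝓝 (Complex.exp (-((‖h‖ ^ 2 : ℝ) * t ^ 2 / 2)))) := by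
    have hc : Continuous fun x : ℝ => Complex.exp (-((x : ℂ) * t ^ 2 / 2)) := by fun_prop
    exact (hc.tendsto _).comp hs2
  have hl3 := tendsto_nhds_unique (hl1.congr hfin) hl2
  rw [hl3, charFun_gaussianReal]
  congr 1
  push_cast
  simp

end Isonormal

/-! ### Construction of a real Brownian motion. -/

section Brownian

theorem exists_isPreBrownianReal :
    ∃ (Ω : Type) (_ : MeasurableSpace Ω) (P : Measure Ω) (_ : IsProbabilityMeasure P)
      (B : ℝ≥0 → Ω → ℝ), (∀ t, Measurable (B t)) ∧ IsPreBrownianReal B P := by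
  obtain ⟨Ω, _, P, _, J, hJ⟩ := exists_isonormal (Lp ℝ 2 (volume : Measure ℝ))
  let h (t : ℝ≥0) : Lp ℝ 2 (volume : Measure ℝ) :=
    indicatorConstLp 2 (measurableSet_Icc (a := (0 : ℝ)) (b := t)) (by simp) 1
  have hm (g) : AEMeasurable (J g) P := (Lp.aestronglyMeasurable _).aemeasurable
  have hlaw (g) : HasLaw (J g) (gaussianReal 0 (‖g‖₊ ^ 2)) P := ⟨hm g, hJ g⟩
  have hmean (g) : ∫ ω, J g ω ∂P = 0 := by
    rw [(hlaw g).integral_eq, integral_id_gaussianReal]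
  refine ⟨Ω, inferInstance, P, inferInstance, fun t => J (h t),
    fun t => (Lp.stronglyMeasurable _).measurable,
    IsGaussianProcess.isPreBrownianReal_of_covariance ⟨fun I => ⟨?_⟩⟩ (fun t => hmean _)
      fun s t hst => ?_⟩
  -- A linear functional of finitely many J (h t) is J of a single vector, hence Gaussian.
  · refine isGaussian_of_map_eq_gaussianReal fun L => ⟨0, ‖∑ i : I, L (Pi.single i 1) • h i‖₊ ^ 2, ?_⟩
    have hmI : AEMeasurable (fun ω => I.restrict fun t => J (h t) ω) P :=
      aemeasurable_pi_lambda _ fun i => hm _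
    rw [AEMeasurable.map_map_of_aemeasurable (by fun_prop) hmI, ← hJ]
    refine Measure.map_congr ?_
    rw [map_sum]
    simp_rw [map_smul]
    have hsum (s : Finset I) : (∑ i ∈ s, L (Pi.single i 1) • J (h i) : Lp ℝ 2 P) =ᵐ[P]
        fun ω => ∑ i ∈ s, L (Pi.single i 1) * J (h i) ω := by
      classical
      induction s using Finset.induction_on with
      | empty => simp only [Finset.sum_empty]; exact Lp.coeFn_zero ℝ 2 P
      | insert i s hi ih =>
        rw [Finset.sum_insert hi]
        filter_upwards [Lp.coeFn_add (L (Pi.single i 1) • J (h i))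
          (∑ i ∈ s, L (Pi.single i 1) • J (h i)), Lp.coeFn_smul (L (Pi.single i 1)) (J (h i)), ih]
          with ω h1 h2 h4
        rw [h1, Pi.add_apply, h2, h4, Pi.smul_apply, Finset.sum_insert hi, smul_eq_mul]
    filter_upwards [hsum Finset.univ] with ω hω
    rw [hω]
    simp only [Function.comp_apply]
    conv_lhs => rw [← Finset.univ_sum_single (I.restrict fun x => J (h x) ω)]
    rw [map_sum]
    refine Finset.sum_congr rfl fun i _ => ?_
    rw [mul_comm, ← smul_eq_mul, ← map_smul]
    congr 1
    ext j
    simp [Pi.single_apply]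
  -- J is an isometry, so the covariance is the Lebesgue measure of [0,s] ∩ [0,t].
  · rw [covariance_eq_sub (Lp.memLp _) (Lp.memLp _)]
    have h1 : inner ℝ (J (h t)) (J (h s)) = ∫ ω, (J (h s) * J (h t) : Ω → ℝ) ω ∂P := by
      rw [L2.inner_def]
      simp
    rw [hmean, ← h1, LinearIsometry.inner_map_map,
      L2.real_inner_indicatorConstLp_one_indicatorConstLp_one _ _ (by simp) (by simp)]
    simp [Icc_inter_Icc, hst]

variable {Ω : Type*} {mΩ : MeasurableSpace Ω} {P : Measure Ω} {B : ℝ≥0 → Ω → ℝ}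

lemma lintegral_pow_four_gaussianReal (v : ℝ≥0) :
    ∫⁻ x, ENNReal.ofReal (x ^ 4) ∂(gaussianReal 0 v) =
      ENNReal.ofReal (v ^ 2) * ∫⁻ x, ENNReal.ofReal (x ^ 4) ∂(gaussianReal 0 1) := by
  have h : gaussianReal 0 v = (gaussianReal 0 1).map (fun x => √v * x) := by
    rw [gaussianReal_map_const_mul]
    congr 1
    · simp
    · ext; simp
  rw [h, lintegral_map (by fun_prop) (by fun_prop), ← lintegral_const_mul _ (by fun_prop)]
  refine lintegral_congr fun x => ?_
  rw [← ENNReal.ofReal_mul (by positivity), mul_pow]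
  congr 2
  rw [show 4 = 2 * 2 from rfl, pow_mul, Real.sq_sqrt v.coe_nonneg]

lemma lintegral_pow_four_gaussianReal_lt_top :
    ∫⁻ x, ENNReal.ofReal (x ^ 4) ∂(gaussianReal 0 1) < ∞ := by
  have h := (memLp_id_gaussianReal (μ := 0) (v := 1) 4).integrable_norm_pow (p := 4) (by norm_num)
  have := h.lintegral_lt_top
  simpa [Even.pow_abs (show Even 4 by decide)] using this

lemma IsPreBrownianReal.lintegral_sub_pow_four (hB : IsPreBrownianReal B P) (s t : ℝ≥0) :
    ∫⁻ ω, ENNReal.ofReal ((B s ω - B t ω) ^ 4) ∂P = ENNReal.ofReal ((s - t : ℝ) ^ 2) *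
      ∫⁻ x, ENNReal.ofReal (x ^ 4) ∂(gaussianReal 0 1) := by
  have h := (hB.hasLaw_sub s t).lintegral_comp (f := fun x => ENNReal.ofReal (x ^ 4)) (by fun_prop)
  simp only [Pi.sub_apply] at h
  rw [h, lintegral_pow_four_gaussianReal]
  congr 2
  rw [coe_nndist, Real.dist_eq, sq_abs]
  rfl

/-- The dyadic approximation of level `n` of `t` from below. -/
def dyadicFloor (n : ℕ) (t : ℝ≥0) : ℝ≥0 := (⌊2 ^ n * t⌋₊ : ℝ≥0) / 2 ^ n

lemma dyadicFloor_zero (n : ℕ) : dyadicFloor n 0 = 0 := by simp [dyadicFloor]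

lemma abs_dyadicFloor_sub_le (n : ℕ) (t : ℝ≥0) : |(dyadicFloor n t : ℝ) - t| ≤ (1 / 2) ^ n := by
  have h1 : ((⌊2 ^ n * t⌋₊ : ℝ≥0) : ℝ) ≤ 2 ^ n * t := by
    exact_mod_cast Nat.floor_le (zero_le (a := 2 ^ n * t))
  have h2 : (2 ^ n * t : ℝ) < (⌊2 ^ n * t⌋₊ : ℝ≥0) + 1 := by
    exact_mod_cast Nat.lt_floor_add_one (2 ^ n * t)
  have h3 : (0 : ℝ) < 2 ^ n := by positivity
  rw [dyadicFloor, NNReal.coe_div, one_div, inv_pow, ← one_div]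
  push_cast at h1 h2 ⊢
  rw [div_sub' h3.ne', abs_div, abs_of_pos h3]
  gcongr
  rw [abs_le]
  constructor <;> linarith

/-- The control of the dyadic increments which makes a function on the dyadic numbers extend to a
continuous function. -/
def HasDyadicModulus (f : ℝ≥0 → ℝ) : Prop :=
  ∀ N : ℕ, ∃ K : ℝ, ∀ n k : ℕ, k < N * 2 ^ n →
    |f (((k + 1 : ℕ) : ℝ≥0) / 2 ^ n) - f ((k : ℝ≥0) / 2 ^ n)| ≤ K * (9 / 10) ^ n

lemma floor_two_pow_mul_lt {N n : ℕ} {t : ℝ≥0} (ht : t < N) : ⌊2 ^ n * t⌋₊ < N * 2 ^ n := by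
  rw [Nat.floor_lt zero_le]
  push_cast
  rw [mul_comm]
  gcongr

/-- The floors of t at levels n and n + 1 are equal or adjacent on the finer grid, so the values of
f along them form a Cauchy sequence with geometric rate. Points closer than 2⁻ⁿ have equal or
adjacent floors at level n, which makes the limit continuous. -/
lemma HasDyadicModulus.exists_tendsto {f : ℝ≥0 → ℝ} (hf : HasDyadicModulus f) :
    ∃ g : ℝ≥0 → ℝ, Continuous g ∧
      ∀ t, Tendsto (fun n => f (dyadicFloor n t)) atTop (𝓝 (g t)) := by
  choose K hK using hf
  -- For N = 0 the modulus condition is vacuous and says nothing about the sign of K 0, hence the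
  -- shift.
  have hK0 (N : ℕ) : 0 ≤ K (N + 1) := by
    have := (abs_nonneg _).trans (hK (N + 1) 0 0 (by simp))
    simpa using this
  have hstep (N : ℕ) (t : ℝ≥0) (ht : t < (N + 1 : ℕ)) (n : ℕ) :
      dist (f (dyadicFloor n t)) (f (dyadicFloor (n + 1) t)) ≤ K (N + 1) * (9 / 10) ^ n := by
    set m := ⌊2 ^ n * t⌋₊ with hm
    have h1 : (m : ℝ≥0) ≤ 2 ^ n * t := Nat.floor_le zero_le
    have h2 : 2 ^ n * t < m + 1 := Nat.lt_floor_add_one _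
    have hq : dyadicFloor n t = ((2 * m : ℕ) : ℝ≥0) / 2 ^ (n + 1) := by
      rw [dyadicFloor, ← hm, pow_succ]
      push_cast
      rw [mul_comm (2 : ℝ≥0) (m : ℝ≥0), mul_div_mul_right _ _ two_ne_zero]
    have h3 : 2 * m ≤ ⌊2 ^ (n + 1) * t⌋₊ := by
      refine Nat.le_floor ?_
      push_cast
      calc (2 : ℝ≥0) * m ≤ 2 * (2 ^ n * t) := by gcongr
        _ = _ := by ring
    have h4 : ⌊2 ^ (n + 1) * t⌋₊ < 2 * m + 2 := by
      rw [Nat.floor_lt zero_le]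
      push_cast
      calc 2 ^ (n + 1) * t = 2 * (2 ^ n * t) := by ring
        _ < 2 * (m + 1) := by gcongr
        _ = _ := by ring
    obtain h5 | h5 : ⌊2 ^ (n + 1) * t⌋₊ = 2 * m ∨ ⌊2 ^ (n + 1) * t⌋₊ = 2 * m + 1 := by omega
    · rw [hq, dyadicFloor, h5, dist_self]
      have := hK0 N
      positivity
    · have h6 := hK (N + 1) (n + 1) (2 * m) (by
        have := floor_two_pow_mul_lt (n := n + 1) ht
        omega)
      rw [hq, dyadicFloor, h5, dist_comm, Real.dist_eq]
      refine h6.trans ?_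
      have := hK0 N
      rw [pow_succ]
      nlinarith [show (0 : ℝ) ≤ K (N + 1) * (9 / 10) ^ n by positivity]
  have hlim (t : ℝ≥0) : ∃ l, Tendsto (fun n => f (dyadicFloor n t)) atTop (𝓝 l) := by
    obtain ⟨N, hN⟩ := exists_nat_gt t
    refine cauchySeq_tendsto_of_complete (cauchySeq_of_le_geometric (9 / 10) (K (N + 1))
      (by norm_num) (hstep N t (hN.trans (by simp))))
  choose g hg using hlim
  refine ⟨g, ?_, hg⟩
  have hdist (N : ℕ) (t : ℝ≥0) (ht : t < (N + 1 : ℕ)) (n : ℕ) :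
      dist (f (dyadicFloor n t)) (g t) ≤ K (N + 1) * (9 / 10) ^ n / (1 - 9 / 10) :=
    dist_le_of_le_geometric_of_tendsto (9 / 10) (K (N + 1)) (by norm_num) (hstep N t ht) (hg t) n
  -- 21 = 10 + 1 + 10: two geometric tails with factor 1 / (1 - 9/10), and one increment between
  -- adjacent grid points.
  have hclose (N : ℕ) (s t : ℝ≥0) (hs : s < (N + 1 : ℕ)) (ht : t < (N + 1 : ℕ)) (hst : s ≤ t)
      (n : ℕ) (hn : 2 ^ n * t < 2 ^ n * s + 1) :
      dist (g s) (g t) ≤ K (N + 1) * 21 * (9 / 10) ^ n := by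
    have h1 := hdist N s hs n
    have h2 := hdist N t ht n
    have h3 : dist (f (dyadicFloor n s)) (f (dyadicFloor n t)) ≤ K (N + 1) * (9 / 10) ^ n := by
      have h4 : ⌊2 ^ n * s⌋₊ ≤ ⌊2 ^ n * t⌋₊ := by gcongr
      have h5 : ⌊2 ^ n * t⌋₊ < ⌊2 ^ n * s⌋₊ + 2 := by
        rw [Nat.floor_lt zero_le]
        push_cast
        calc 2 ^ n * t < 2 ^ n * s + 1 := hn
          _ ≤ (⌊2 ^ n * s⌋₊ + 1) + 1 := by gcongr; exact (Nat.lt_floor_add_one _).le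
          _ = _ := by ring
      obtain h6 | h6 : ⌊2 ^ n * t⌋₊ = ⌊2 ^ n * s⌋₊ ∨ ⌊2 ^ n * t⌋₊ = ⌊2 ^ n * s⌋₊ + 1 := by omega
      · rw [dyadicFloor, dyadicFloor, h6, dist_self]
        have := hK0 N
        positivity
      · rw [dyadicFloor, dyadicFloor, h6, dist_comm, Real.dist_eq]
        exact hK _ _ _ (floor_two_pow_mul_lt hs)
    have h7 := dist_triangle4 (g s) (f (dyadicFloor n s)) (f (dyadicFloor n t)) (g t)
    rw [dist_comm (g s) (f _)] at h7
    have h8 : K (N + 1) * (9 / 10) ^ n / (1 - 9 / 10) = 10 * (K (N + 1) * (9 / 10) ^ n) := by ring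
    rw [h8] at h1 h2
    linarith
  rw [continuous_iff_continuousAt]
  intro t
  obtain ⟨N, hN⟩ := exists_nat_gt t
  have htN : t < (N + 1 : ℕ) := hN.trans (by simp)
  rw [Metric.continuousAt_iff']
  intro ε hε
  obtain ⟨n, hn⟩ : ∃ n : ℕ, K (N + 1) * 21 * (9 / 10) ^ n < ε := by
    have : Tendsto (fun n : ℕ => K (N + 1) * 21 * (9 / 10 : ℝ) ^ n) atTop
        (𝓝 (K (N + 1) * 21 * 0)) :=
      (tendsto_pow_atTop_nhds_zero_of_lt_one (by norm_num) (by norm_num)).const_mul _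
    rw [mul_zero] at this
    exact (this.eventually_lt_const hε).exists
  have e1 : ∀ᶠ s : ℝ≥0 in 𝓝 t, s < (N + 1 : ℕ) := eventually_lt_nhds htN
  have e2 : ∀ᶠ s in 𝓝 t, 2 ^ n * t < 2 ^ n * s + 1 := by
    have hc : Continuous fun s : ℝ≥0 => 2 ^ n * s + 1 := by fun_prop
    exact (hc.tendsto t).eventually_const_lt (by simp)
  have e3 : ∀ᶠ s in 𝓝 t, 2 ^ n * s < 2 ^ n * t + 1 := by
    have hc : Continuous fun s : ℝ≥0 => 2 ^ n * s := by fun_prop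
    exact (hc.tendsto t).eventually_lt_const (by simp)
  filter_upwards [e1, e2, e3] with s h1 h2 h3
  rcases le_total s t with h | h
  · exact (hclose N s t h1 htN h n h2).trans_lt hn
  · rw [dist_comm]
    exact (hclose N t s htN h1 h n h3).trans_lt hn

/-- Kolmogorov's argument: the weighted sum F of the fourth powers of all dyadic increments has
finite expectation, so it is almost surely finite and bounds each of its terms. -/
lemma IsPreBrownianReal.ae_hasDyadicModulus (hB : IsPreBrownianReal B P)
    (hm : ∀ t, Measurable (B t)) : ∀ᵐ ω ∂P, HasDyadicModulus (B · ω) := by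
  set M := ∫⁻ x, ENNReal.ofReal (x ^ 4) ∂(gaussianReal 0 1) with hM
  refine ae_all_iff.2 fun N => ?_
  let F (ω : Ω) : ℝ≥0∞ := ∑' n : ℕ, ∑ k ∈ Finset.range (N * 2 ^ n), ENNReal.ofReal
    ((B (((k + 1 : ℕ) : ℝ≥0) / 2 ^ n) ω - B ((k : ℝ≥0) / 2 ^ n) ω) ^ 4) *
      ENNReal.ofReal (((10 / 9) ^ n) ^ 4)
  have hFm : Measurable F := by
    refine Measurable.tsum fun n => Finset.measurable_sum _ fun k _ => ?_
    have := hm (((k + 1 : ℕ) : ℝ≥0) / 2 ^ n)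
    have := hm ((k : ℝ≥0) / 2 ^ n)
    fun_prop
  have hF : ∫⁻ ω, F ω ∂P ≠ ∞ := by
    have hterm (n k : ℕ) : Measurable fun ω => ENNReal.ofReal
        ((B (((k + 1 : ℕ) : ℝ≥0) / 2 ^ n) ω - B ((k : ℝ≥0) / 2 ^ n) ω) ^ 4) *
        ENNReal.ofReal (((10 / 9) ^ n) ^ 4) := by
      have := hm (((k + 1 : ℕ) : ℝ≥0) / 2 ^ n)
      have := hm ((k : ℝ≥0) / 2 ^ n)
      fun_prop
    rw [lintegral_tsum fun n => (Finset.measurable_sum _ fun k _ => hterm n k).aemeasurable]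
    -- There are N 2ⁿ increments, each with fourth moment 4⁻ⁿ M and weight (10/9)⁴ⁿ. The resulting
    -- ratio 2 · (1/4) · (10/9)⁴ = 5000/6561 is below 1, which is what the rate 9/10 is chosen for.
    have heq (n : ℕ) : ∫⁻ ω, ∑ k ∈ Finset.range (N * 2 ^ n), ENNReal.ofReal
        ((B (((k + 1 : ℕ) : ℝ≥0) / 2 ^ n) ω - B ((k : ℝ≥0) / 2 ^ n) ω) ^ 4) *
        ENNReal.ofReal (((10 / 9) ^ n) ^ 4) ∂P = ENNReal.ofReal (N * (5000 / 6561) ^ n) * M := by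
      rw [lintegral_finsetSum _ fun k _ => hterm n k]
      have (k : ℕ) : ∫⁻ ω, ENNReal.ofReal
          ((B (((k + 1 : ℕ) : ℝ≥0) / 2 ^ n) ω - B ((k : ℝ≥0) / 2 ^ n) ω) ^ 4) *
          ENNReal.ofReal (((10 / 9) ^ n) ^ 4) ∂P =
          ENNReal.ofReal (((1 / 2) ^ n) ^ 2 * ((10 / 9) ^ n) ^ 4) * M := by
        rw [lintegral_mul_const', IsPreBrownianReal.lintegral_sub_pow_four hB,
          ENNReal.ofReal_mul (by positivity), mul_right_comm]
        · congr 4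
          push_cast
          rw [← sub_div, add_sub_cancel_left, one_div, one_div, inv_pow]
        · exact ENNReal.ofReal_ne_top
      simp_rw [this]
      rw [Finset.sum_const, Finset.card_range, nsmul_eq_mul, ← mul_assoc,
        ← ENNReal.ofReal_natCast, ← ENNReal.ofReal_mul (by positivity)]
      congr 2
      push_cast
      rw [mul_assoc]
      congr 1
      rw [← pow_mul, ← pow_mul, mul_comm n 2, mul_comm n 4, pow_mul, pow_mul, ← mul_pow, ← mul_pow]
      norm_num
    simp_rw [heq]
    rw [ENNReal.tsum_mul_right]
    refine ENNReal.mul_ne_top ?_ lintegral_pow_four_gaussianReal_lt_top.ne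
    exact ((summable_geometric_of_lt_one (by norm_num) (by norm_num)).mul_left _).tsum_ofReal_ne_top
  filter_upwards [ae_lt_top hFm hF] with ω hω
  -- The maximum with 1 gives K ≤ K⁴, so that fourth roots can be compared.
  set K := max 1 (F ω).toReal with hK
  have hK1 : 1 ≤ K := le_max_left _ _
  refine ⟨K, fun n k hk => ?_⟩
  set x := B (((k + 1 : ℕ) : ℝ≥0) / 2 ^ n) ω - B ((k : ℝ≥0) / 2 ^ n) ω with hx
  have h1 : ENNReal.ofReal (x ^ 4 * ((10 / 9) ^ n) ^ 4) ≤ F ω := by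
    rw [ENNReal.ofReal_mul (by positivity)]
    refine le_trans ?_ (ENNReal.le_tsum n)
    exact Finset.single_le_sum (f := fun k : ℕ => ENNReal.ofReal
      ((B (((k + 1 : ℕ) : ℝ≥0) / 2 ^ n) ω - B ((k : ℝ≥0) / 2 ^ n) ω) ^ 4) *
      ENNReal.ofReal (((10 / 9) ^ n) ^ 4)) (fun _ _ => zero_le) (Finset.mem_range.2 hk)
  have h2 : x ^ 4 * ((10 / 9) ^ n) ^ 4 ≤ K :=
    ((ENNReal.ofReal_le_iff_le_toReal hω.ne).1 h1).trans (le_max_right _ _)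
  have h3 : K ≤ K ^ 4 := le_self_pow₀ hK1 (by norm_num)
  have h4 : (|x| * (10 / 9) ^ n) ^ 4 ≤ K ^ 4 := by
    rw [mul_pow, Even.pow_abs (by decide)]
    exact h2.trans h3
  have h5 := (pow_le_pow_iff_left₀ (by positivity) (by positivity) (by norm_num)).1 h4
  calc |x| = |x| * (10 / 9) ^ n * (9 / 10) ^ n := by
        rw [mul_assoc, ← mul_pow]; norm_num
    _ ≤ _ := by gcongr

/-- Shows that the continuous limit along dyadic floors is a modification of B: the fourth moments
of the errors are summable, being of order 4⁻ⁿ. -/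
lemma IsPreBrownianReal.ae_tendsto_dyadicFloor (hB : IsPreBrownianReal B P)
    (hm : ∀ t, Measurable (B t)) (t : ℝ≥0) :
    ∀ᵐ ω ∂P, Tendsto (fun n => B (dyadicFloor n t) ω) atTop (𝓝 (B t ω)) := by
  let F (ω : Ω) : ℝ≥0∞ := ∑' n : ℕ, ENNReal.ofReal ((B (dyadicFloor n t) ω - B t ω) ^ 4)
  have hterm (n : ℕ) : Measurable fun ω => ENNReal.ofReal ((B (dyadicFloor n t) ω - B t ω) ^ 4) := by
    have := hm (dyadicFloor n t)
    have := hm t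
    fun_prop
  have hF : ∫⁻ ω, F ω ∂P ≠ ∞ := by
    rw [lintegral_tsum fun n => (hterm n).aemeasurable]
    simp_rw [IsPreBrownianReal.lintegral_sub_pow_four hB]
    rw [ENNReal.tsum_mul_right]
    refine ENNReal.mul_ne_top ?_ lintegral_pow_four_gaussianReal_lt_top.ne
    refine Summable.tsum_ofReal_ne_top (Summable.of_nonneg_of_le (fun n => sq_nonneg _) (fun n => ?_)
      (summable_geometric_of_lt_one (r := (1 / 4 : ℝ)) (by norm_num) (by norm_num)))
    rw [← sq_abs]
    calc _ ≤ (((1 : ℝ) / 2) ^ n) ^ 2 := by gcongr; exact abs_dyadicFloor_sub_le n t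
      _ = _ := by rw [← pow_mul, mul_comm, pow_mul]; norm_num
  filter_upwards [ae_lt_top (Measurable.tsum hterm) hF] with ω hω
  have h1 := ENNReal.tendsto_atTop_zero_of_tsum_ne_top hω.ne
  have h2 := (ENNReal.tendsto_toReal ENNReal.zero_ne_top).comp h1
  have h3 : Tendsto (fun n => (B (dyadicFloor n t) ω - B t ω) ^ 4) atTop (𝓝 0) := by
    refine h2.congr fun n => ?_
    exact ENNReal.toReal_ofReal (by positivity)
  have h4 : Tendsto (fun n => B (dyadicFloor n t) ω - B t ω) atTop (𝓝 0) := by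
    rw [tendsto_zero_iff_abs_tendsto_zero]
    have := (Real.continuous_sqrt.comp Real.continuous_sqrt).tendsto 0 |>.comp h3
    simp only [Function.comp_apply, Real.sqrt_zero] at this
    refine this.congr fun n => ?_
    simp only [Function.comp_apply]
    rw [show 4 = 2 * 2 from rfl, pow_mul, Real.sqrt_sq (by positivity), Real.sqrt_sq_eq_abs]
  simpa using h4.add_const (B t ω)

/-- Existence of a real Brownian motion, all of whose paths are continuous and start at zero. -/
theorem exists_isBrownianReal :
    ∃ (Ω : Type) (_ : MeasurableSpace Ω) (P : Measure Ω) (_ : IsProbabilityMeasure P)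
      (B : ℝ≥0 → Ω → ℝ), (∀ t, Measurable (B t)) ∧ (∀ ω, Continuous (B · ω)) ∧
        (∀ ω, B 0 ω = 0) ∧ IsBrownianReal B P := by
  obtain ⟨Ω, _, P, _, B, hm, hB⟩ := exists_isPreBrownianReal
  -- Off the measurable full-measure set G the path is replaced by zero, so that every path is
  -- continuous and starts at zero, while measurability is kept.
  obtain ⟨G, hG, hGm, hGp⟩ := ((IsPreBrownianReal.ae_hasDyadicModulus hB hm).and
    hB.eval_zero_ae_eq_zero).exists_measurable_mem
  have hex (ω : Ω) : ∃ g : ℝ≥0 → ℝ, Continuous g ∧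
      ∀ t, Tendsto (fun n => G.indicator (B (dyadicFloor n t)) ω) atTop (𝓝 (g t)) := by
    by_cases hω : ω ∈ G
    · simpa [indicator_of_mem hω] using (hGp ω hω).1.exists_tendsto
    · exact ⟨0, continuous_zero, by simp [indicator_of_notMem hω]⟩
  choose g hgc hg using hex
  have hmeas (t : ℝ≥0) : Measurable fun ω => g ω t :=
    measurable_of_tendsto_metrizable (fun n => (hm (dyadicFloor n t)).indicator hGm)
      (tendsto_pi_nhds.2 fun ω => hg ω t)
  refine ⟨Ω, inferInstance, P, inferInstance, fun t ω => g ω t, hmeas, hgc, fun ω => ?_, ?_, ?_⟩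
  · refine tendsto_nhds_unique (hg ω 0) ?_
    by_cases hω : ω ∈ G
    · simp [indicator_of_mem hω, dyadicFloor_zero, (hGp ω hω).2]
    · simp [indicator_of_notMem hω]
  · refine hB.congr fun t => ?_
    filter_upwards [IsPreBrownianReal.ae_tendsto_dyadicFloor hB hm t, hG] with ω h1 h2
    refine tendsto_nhds_unique h1 ?_
    simpa [indicator_of_mem h2] using hg ω t
  · exact ae_of_all _ hgc

end Brownian

/-! ### Laws on path space and uniqueness in law of the noise. -/

section PathLaw

variable {K F : Type*} [MetricSpace K] [CompactSpace K] [Nonempty K]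
  [NormedAddCommGroup F] [CompleteSpace F] [SecondCountableTopology F] [MeasurableSpace F]
  [BorelSpace F] [MeasurableSpace C(K, F)] [BorelSpace C(K, F)]

variable (K F) in
/-- A continuous path is determined, in a measurable way, by its values at a dense sequence. -/
lemma measurableEmbedding_eval_denseSeq :
    MeasurableEmbedding fun (f : C(K, F)) (n : ℕ) => f (TopologicalSpace.denseSeq K n) := by
  refine Continuous.measurableEmbedding
    (continuous_pi fun n => continuous_eval_const _) fun f g h => ?_
  refine DFunLike.coe_injective
    ((TopologicalSpace.denseRange_denseSeq K).equalizer f.continuous g.continuous ?_)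
  exact h

lemma measurable_continuousMap_iff {Ω : Type*} {mΩ : MeasurableSpace Ω} {Y : Ω → C(K, F)} :
    Measurable Y ↔ ∀ t, Measurable fun ω => Y ω t := by
  refine ⟨fun h t => (continuous_eval_const t).measurable.comp h, fun h => ?_⟩
  rw [← (measurableEmbedding_eval_denseSeq K F).measurable_comp_iff]
  exact measurable_pi_lambda _ fun n => h _

lemma continuousMap_measure_ext {μ ν : Measure C(K, F)}
    (h : μ.map (fun f (n : ℕ) => f (TopologicalSpace.denseSeq K n)) =
      ν.map (fun f (n : ℕ) => f (TopologicalSpace.denseSeq K n))) : μ = ν := by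
  rw [← (measurableEmbedding_eval_denseSeq K F).comap_map μ, h,
    (measurableEmbedding_eval_denseSeq K F).comap_map]

end PathLaw

section Laws

variable {Ω Ω' : Type*} {mΩ : MeasurableSpace Ω} {mΩ' : MeasurableSpace Ω'} {P : Measure Ω}
  {P' : Measure Ω'}

lemma IsPreBrownianReal.map_eq {B : ℝ≥0 → Ω → ℝ} {B' : ℝ≥0 → Ω' → ℝ}
    (hB : IsPreBrownianReal B P) (hB' : IsPreBrownianReal B' P') (hm : ∀ t, Measurable (B t))
    (hm' : ∀ t, Measurable (B' t)) :
    P.map (fun ω t => B t ω) = P'.map (fun ω t => B' t ω) := by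
  refine IsProjectiveLimit.unique (P := BrownianReal.projectiveFamily) (fun I => ?_) fun I => ?_
  · rw [Measure.map_map (by fun_prop) (measurable_pi_lambda _ hm)]
    exact (hB.hasLaw I).map_eq
  · rw [Measure.map_map (by fun_prop) (measurable_pi_lambda _ hm')]
    exact (hB'.hasLaw I).map_eq

lemma IsBrownianMotion.map_eq {d : ℕ} {B : ℝ≥0 → Ω → E d} {B' : ℝ≥0 → Ω' → E d}
    [IsProbabilityMeasure P] [IsProbabilityMeasure P']
    (hB : IsBrownianMotion P B) (hB' : IsBrownianMotion P' B') :
    P.map (fun ω t => B t ω) = P'.map (fun ω t => B' t ω) := by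
  have hm (i : Fin d) : Measurable fun ω (t : ℝ≥0) => B t ω i :=
    measurable_pi_lambda _ fun t => by have := hB.measurable t; fun_prop
  have hm' (i : Fin d) : Measurable fun ω (t : ℝ≥0) => B' t ω i :=
    measurable_pi_lambda _ fun t => by have := hB'.measurable t; fun_prop
  have h1 := (iIndepFun_iff_map_fun_eq_pi_map fun i => (hm i).aemeasurable).1 hB.iIndepFun
  have h2 := (iIndepFun_iff_map_fun_eq_pi_map fun i => (hm' i).aemeasurable).1 hB'.iIndepFun
  have h3 (i : Fin d) : P.map (fun ω (t : ℝ≥0) => B t ω i) = P'.map (fun ω t => B' t ω i) :=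
    IsPreBrownianReal.map_eq (hB.isBrownianReal i).toIsPreBrownianReal
      (hB'.isBrownianReal i).toIsPreBrownianReal
      (fun t => by have := hB.measurable t; fun_prop)
      (fun t => by have := hB'.measurable t; fun_prop)
  simp_rw [h3] at h1
  rw [← h2] at h1
  have hg : Measurable fun (x : Fin d → ℝ≥0 → ℝ) (t : ℝ≥0) => (WithLp.toLp 2 fun i => x i t : E d) := by
    refine measurable_pi_lambda _ fun t => ?_
    fun_prop
  have h4 := congrArg (Measure.map fun (x : Fin d → ℝ≥0 → ℝ) (t : ℝ≥0) =>
    (WithLp.toLp 2 fun i => x i t : E d)) h1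
  rw [Measure.map_map hg (measurable_pi_lambda _ hm),
    Measure.map_map hg (measurable_pi_lambda _ hm')] at h4
  exact h4

/-- Uniqueness in law of the data of the equation, across different probability spaces; uniqueness
of the law of the solution rests on it. -/
lemma IsBrownianMotion.map_prod_eq {d : ℕ} {B : ℝ≥0 → Ω → E d} {B' : ℝ≥0 → Ω' → E d}
    [IsProbabilityMeasure P] [IsProbabilityMeasure P']
    (hB : IsBrownianMotion P B) (hB' : IsBrownianMotion P' B') {ξ : Ω → E d} {ξ' : Ω' → E d}
    (hξ : Measurable ξ) (hξ' : Measurable ξ') (h : P.map ξ = P'.map ξ')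
    (hind : IndepFun ξ (fun ω t => B t ω) P) (hind' : IndepFun ξ' (fun ω t => B' t ω) P') :
    P.map (fun ω => (ξ ω, fun t => B t ω)) = P'.map (fun ω => (ξ' ω, fun t => B' t ω)) := by
  have hm : Measurable fun ω (t : ℝ≥0) => B t ω := measurable_pi_lambda _ hB.measurable
  have hm' : Measurable fun ω (t : ℝ≥0) => B' t ω := measurable_pi_lambda _ hB'.measurable
  rw [(indepFun_iff_map_prod_eq_prod_map_map hξ.aemeasurable hm.aemeasurable).1 hind,
    (indepFun_iff_map_prod_eq_prod_map_map hξ'.aemeasurable hm'.aemeasurable).1 hind', h,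
    hB.map_eq hB']

end Laws

/-! ### Gaussian tails of the supremum norm. -/

section Fernique

variable {Ω : Type*} {mΩ : MeasurableSpace Ω} {P : Measure Ω}

/-- Exponential square integrability of the supremum norm of a real Brownian motion. -/
lemma exists_integrable_exp_sq_brownianReal {T : ℝ≥0} {B : ℝ≥0 → Ω → ℝ}
    (hB : IsPreBrownianReal B P) (hm : ∀ t, Measurable (B t))
    {β : Ω → C(Icc (0 : ℝ) T, ℝ)} (hβ : ∀ ω t, β ω t = B ⟨t, t.2.1⟩ ω) :
    ∃ c > 0, Integrable (fun ω => Real.exp (c * ‖β ω‖ ^ 2)) P := by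
  have : IsProbabilityMeasure P := hB.isGaussianProcess.isProbabilityMeasure
  have : Nonempty (Icc (0 : ℝ) T) := ⟨⟨0, le_rfl, T.2⟩⟩
  let _ : MeasurableSpace C(Icc (0 : ℝ) T, ℝ) := borel _
  have : BorelSpace C(Icc (0 : ℝ) T, ℝ) := ⟨rfl⟩
  have hβm : Measurable β := measurable_continuousMap_iff.2 fun t => by
    simp_rw [hβ]
    exact hm _
  set ν := P.map β with hν
  have hνp : IsProbabilityMeasure ν := Measure.isProbabilityMeasure_map hβm.aemeasurable
  -- Fernique's theorem only needs invariance of ν ⊗ ν under this rotation. The invariance can be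
  -- tested on the values at finitely many points of a dense sequence, where ν becomes a centred
  -- Gaussian measure on a finite-dimensional space.
  suffices h : (ν.prod ν).map (ContinuousLinearMap.rotation (-(Real.pi / 4))) = ν.prod ν by
    obtain ⟨c, hc, hi⟩ := exists_integrable_exp_sq_of_map_rotation_eq_self h
    exact ⟨c, hc, (integrable_map_measure (by fun_prop) hβm.aemeasurable).1 hi⟩
  set R : C(Icc (0 : ℝ) T, ℝ) × C(Icc (0 : ℝ) T, ℝ) →L[ℝ] _ :=
    ContinuousLinearMap.rotation (-(Real.pi / 4)) with hR
  let D : ℕ → Icc (0 : ℝ) T := TopologicalSpace.denseSeq _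
  let e (x : C(Icc (0 : ℝ) T, ℝ) × C(Icc (0 : ℝ) T, ℝ)) (n : ℕ) : ℝ × ℝ := (x.1 (D n), x.2 (D n))
  have he : MeasurableEmbedding e := by
    refine Continuous.measurableEmbedding ?_ fun x y hxy => ?_
    · refine continuous_pi fun n => ?_
      exact ((continuous_eval_const _).comp continuous_fst).prodMk
        ((continuous_eval_const _).comp continuous_snd)
    · refine Prod.ext ((measurableEmbedding_eval_denseSeq _ ℝ).injective ?_)
        ((measurableEmbedding_eval_denseSeq _ ℝ).injective ?_) <;> funext n
      · exact congrArg Prod.fst (congrFun hxy n)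
      · exact congrArg Prod.snd (congrFun hxy n)
  suffices h : ((ν.prod ν).map R).map e = (ν.prod ν).map e by
    rw [← he.comap_map ((ν.prod ν).map R), h, he.comap_map]
  refine IsProjectiveLimit.unique (P := fun I => ((ν.prod ν).map e).map I.restrict)
    (fun I => ?_) fun I => rfl
  let π : C(Icc (0 : ℝ) T, ℝ) →L[ℝ] (I → ℝ) :=
    ContinuousLinearMap.pi fun n => ContinuousMap.evalCLM ℝ (D n)
  have hg : IsGaussian (ν.map π) := by
    rw [hν, Measure.map_map (by fun_prop) hβm]
    have := (hB.isGaussianProcess.comp_right (fun n : ℕ => (⟨D n, (D n).2.1⟩ : ℝ≥0))).hasGaussianLaw I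
    convert! this.isGaussian_map using 2
    ext ω n
    simp only [Function.comp_apply, Finset.restrict, π, ContinuousLinearMap.coe_pi']
    exact hβ ω _
  have hg0 : (ν.map π)[id] = 0 := by
    ext n
    rw [eval_integral (fun i => ?_)]
    · simp only [id_eq]
      have hev : Measurable fun x : I → ℝ => x n := measurable_pi_apply n
      rw [integral_map (by fun_prop) hev.aestronglyMeasurable, hν, integral_map hβm.aemeasurable]
      · simpa [π, hβ] using hB.integral_eval _
      · exact (by fun_prop : Measurable fun x => π x n).aestronglyMeasurable
    · exact (IsGaussian.hasGaussianLaw_id.eval i).integrable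
  have hrot := IsGaussian.map_rotation_eq_self hg0 (-(Real.pi / 4))
  let z (p : (I → ℝ) × (I → ℝ)) (n : I) : ℝ × ℝ := (p.1 n, p.2 n)
  have hz : Measurable z := by fun_prop
  have hcomp : (I.restrict ∘ e : _ → I → ℝ × ℝ) = z ∘ Prod.map π π := rfl
  have hπ : Measurable (Prod.map π π) := by fun_prop
  beta_reduce
  rw [Measure.map_map (by fun_prop) he.measurable, Measure.map_map (by fun_prop) he.measurable,
    hcomp, Measure.map_map (by fun_prop) (by fun_prop)]
  have hcomm : (z ∘ Prod.map π π) ∘ R =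
      z ∘ (ContinuousLinearMap.rotation (-(Real.pi / 4)) : _ →L[ℝ] (I → ℝ) × (I → ℝ)) ∘ Prod.map π π := by
    funext x
    simp [hR, ContinuousLinearMap.rotation_apply]
  rw [hcomm, ← Measure.map_map hz (by fun_prop), ← Measure.map_map (by fun_prop) hπ,
    ← Measure.map_prod_map _ _ (by fun_prop) (by fun_prop), hrot,
    ← Measure.map_map hz hπ, ← Measure.map_prod_map _ _ (by fun_prop) (by fun_prop)]

end Fernique

/-! ### Existence of the initial condition and of the driving Brownian motion. -/

section Noise

variable {Ω Ω' : Type*} {mΩ : MeasurableSpace Ω} {mΩ' : MeasurableSpace Ω'} {P : Measure Ω}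
  {P' : Measure Ω'}

lemma IsBrownianReal.comp_measurePreserving {B : ℝ≥0 → Ω → ℝ} (hB : IsBrownianReal B P)
    {f : Ω' → Ω} (hf : MeasurePreserving f P' P) : IsBrownianReal (fun t ω => B t (f ω)) P' where
  hasLaw I := (hB.hasLaw I).comp hf.hasLaw
  cont := hf.quasiMeasurePreserving.ae hB.cont

lemma IsBrownianMotion.comp_measurePreserving {d : ℕ} {B : ℝ≥0 → Ω → E d}
    [IsProbabilityMeasure P] [IsProbabilityMeasure P']
    (hB : IsBrownianMotion P B) {f : Ω' → Ω} (hf : MeasurePreserving f P' P) :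
    IsBrownianMotion P' fun t ω => B t (f ω) where
  measurable t := (hB.measurable t).comp hf.measurable
  isBrownianReal i := IsBrownianReal.comp_measurePreserving (hB.isBrownianReal i) hf
  iIndepFun := by
    have hm (i : Fin d) : Measurable fun ω (t : ℝ≥0) => B t ω i :=
      measurable_pi_lambda _ fun t => by have := hB.measurable t; fun_prop
    have h1 := (iIndepFun_iff_map_fun_eq_pi_map fun i => (hm i).aemeasurable).1 hB.iIndepFun
    refine (iIndepFun_iff_map_fun_eq_pi_map
      fun i => ((hm i).comp hf.measurable).aemeasurable).2 ?_
    simp_rw [← hf.map_eq] at h1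
    rw [Measure.map_map (measurable_pi_lambda _ hm) hf.measurable] at h1
    simp_rw [Measure.map_map (hm _) hf.measurable] at h1
    exact h1

/-- Existence of a Brownian motion in `ℝᵈ`, all of whose paths are continuous and start at zero. -/
theorem exists_isBrownianMotion (d : ℕ) (T : ℝ≥0) :
    ∃ (Ω : Type) (_ : MeasurableSpace Ω) (P : Measure Ω) (_ : IsProbabilityMeasure P)
      (B : ℝ≥0 → Ω → E d), IsBrownianMotion P B ∧ (∀ ω, Continuous (B · ω)) ∧ (∀ ω, B 0 ω = 0) ∧
        ∀ β : Ω → PathSpace d T, (∀ ω t, β ω t = B ⟨t, t.2.1⟩ ω) →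
          ∃ c > 0, Integrable (fun ω => Real.exp (c * ‖β ω‖ ^ 2)) P := by
  obtain ⟨Ω, _, P, _, B, hm, hc, h0, hB⟩ := exists_isBrownianReal
  let B' (t : ℝ≥0) (ω : Fin d → Ω) : E d := WithLp.toLp 2 fun i => B t (ω i)
  have hB'm (t : ℝ≥0) : Measurable (B' t) := by
    refine (WithLp.measurable_toLp 2 _).comp (measurable_pi_lambda _ fun i => ?_)
    exact (hm t).comp (measurable_pi_apply i)
  have hB'c (ω : Fin d → Ω) : Continuous (B' · ω) := by
    refine (PiLp.continuous_toLp 2 _).comp (continuous_pi fun i => hc (ω i))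
  have hBM : IsBrownianMotion (Measure.pi fun _ : Fin d => P) B' := by
    refine ⟨hB'm, fun i => ?_, ?_⟩
    · exact IsBrownianReal.comp_measurePreserving hB (measurePreserving_eval (fun _ => P) i)
    · exact iIndepFun_pi (X := fun (_ : Fin d) ω (t : ℝ≥0) => B t ω)
        fun i => (measurable_pi_lambda _ hm).aemeasurable
  refine ⟨Fin d → Ω, inferInstance, Measure.pi fun _ => P, inferInstance, B', hBM, hB'c,
    fun ω => ?_, fun β hβ => ?_⟩
  · ext i
    simp [B', h0]
  · let γ (ω : Ω) : C(Icc (0 : ℝ) T, ℝ) :=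
      ⟨fun t => B ⟨t, t.2.1⟩ ω, (hc ω).comp (by fun_prop)⟩
    obtain ⟨c, hc0, hi⟩ := exists_integrable_exp_sq_brownianReal (β := γ)
      hB.toIsPreBrownianReal hm fun ω t => rfl
    have hle (ω : Fin d → Ω) : ‖β ω‖ ^ 2 ≤ ∑ i, ‖γ (ω i)‖ ^ 2 := by
      have hs : 0 ≤ ∑ i, ‖γ (ω i)‖ ^ 2 := Finset.sum_nonneg fun _ _ => sq_nonneg _
      refine (Real.le_sqrt (norm_nonneg _) hs).1 ?_
      refine (ContinuousMap.norm_le _ (Real.sqrt_nonneg _)).2 fun t => ?_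
      rw [EuclideanSpace.norm_eq]
      refine Real.sqrt_le_sqrt (Finset.sum_le_sum fun i _ => ?_)
      have h1 := (γ (ω i)).norm_coe_le_norm t
      have h2 : β ω t i = γ (ω i) t := by rw [hβ]; rfl
      rw [h2]
      gcongr
    have : Nonempty (Icc (0 : ℝ) T) := ⟨⟨0, le_rfl, T.2⟩⟩
    have hβm : Measurable β := measurable_continuousMap_iff.2 fun t => by
      simp_rw [hβ]
      exact hB'm _
    -- By `hle` the exponential is dominated by a product of functions of the independent
    -- coordinates.
    refine ⟨c, hc0, (Integrable.fintype_prod (f := fun _ ω => Real.exp (c * ‖γ ω‖ ^ 2))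
      fun _ : Fin d => hi).mono' (by fun_prop) (ae_of_all _ fun ω => ?_)⟩
    rw [Real.norm_eq_abs, Real.abs_exp, ← Real.exp_sum, ← Finset.mul_sum]
    gcongr
    exact hle ω

/-- Existence of an initial condition with law `μ₀` and an independent Brownian motion. -/
theorem exists_noise {d : ℕ} (T : ℝ≥0) (μ₀ : Measure (E d)) [IsProbabilityMeasure μ₀] :
    ∃ (Ω : Type) (_ : MeasurableSpace Ω) (P : Measure Ω) (_ : IsProbabilityMeasure P)
      (ξ : Ω → E d) (B : ℝ≥0 → Ω → E d), Measurable ξ ∧ P.map ξ = μ₀ ∧ IsBrownianMotion P B ∧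
        IndepFun ξ (fun ω t => B t ω) P ∧ (∀ ω, Continuous (B · ω)) ∧ (∀ ω, B 0 ω = 0) ∧
        ∀ β : Ω → PathSpace d T, (∀ ω t, β ω t = B ⟨t, t.2.1⟩ ω) →
          ∃ c > 0, Integrable (fun ω => Real.exp (c * ‖β ω‖ ^ 2)) P := by
  obtain ⟨Ω, _, P, _, B, hB, hc, h0, hexp⟩ := exists_isBrownianMotion d T
  have hBm : Measurable fun ω (t : ℝ≥0) => B t ω := measurable_pi_lambda _ hB.measurable
  refine ⟨E d × Ω, inferInstance, μ₀.prod P, inferInstance, Prod.fst, fun t p => B t p.2,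
    measurable_fst, Measure.fst_prod, hB.comp_measurePreserving measurePreserving_snd, ?_,
    fun p => hc p.2, fun p => h0 p.2, fun β hβ => ?_⟩
  · exact indepFun_prod (X := id) (Y := fun ω (t : ℝ≥0) => B t ω) measurable_id hBm
  · let γ (ω : Ω) : PathSpace d T := ⟨fun t => B ⟨t, t.2.1⟩ ω, (hc ω).comp (by fun_prop)⟩
    obtain ⟨c, hc0, hi⟩ := hexp γ fun ω t => rfl
    refine ⟨c, hc0, ?_⟩
    have hβγ : ∀ p, β p = γ p.2 := fun p => by ext1 t; rw [hβ]; rfl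
    simp_rw [hβγ]
    exact hi.comp_snd μ₀

end Noise

/-! ### Paths, Grönwall's inequality, and the integral equation with a Lipschitz drift. -/

section Paths

variable {d : ℕ} {T : ℝ≥0}

instance nonempty_timeInterval (T : ℝ≥0) : Nonempty (Icc (0 : ℝ) T) := ⟨⟨0, le_rfl, T.coe_nonneg⟩⟩

lemma X_coe (t : Icc (0 : ℝ) T) (ω : PathSpace d T) : X (t : ℝ) ω = ω t :=
  congrArg ω (projIcc_val T.2 t)

lemma X_of_mem {t : ℝ} (ht : t ∈ Icc (0 : ℝ) T) (ω : PathSpace d T) : X t ω = ω ⟨t, ht⟩ :=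
  X_coe ⟨t, ht⟩ ω

lemma continuous_X_time (ω : PathSpace d T) : Continuous fun t : ℝ => X t ω :=
  ω.continuous.comp continuous_projIcc

lemma continuous_X (t : ℝ) : Continuous (X t : PathSpace d T → E d) := continuous_eval_const _

lemma X_sub (t : ℝ) (ω ω' : PathSpace d T) : X t (ω - ω') = X t ω - X t ω' := rfl

lemma X_add (t : ℝ) (ω ω' : PathSpace d T) : X t (ω + ω') = X t ω + X t ω' := rfl

lemma norm_X_le (t : ℝ) (ω : PathSpace d T) : ‖X t ω‖ ≤ ‖ω‖ := ω.norm_coe_le_norm _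

lemma norm_path_le {ω : PathSpace d T} {C : ℝ} (h : ∀ t ∈ Icc (0 : ℝ) T, ‖X t ω‖ ≤ C) : ‖ω‖ ≤ C :=
  (ContinuousMap.norm_le_of_nonempty ω).2 fun t => by
    rw [← X_coe]
    exact h t t.2

end Paths

/-- The bounding function a + L ∫ u has derivative L u, at most L times itself, so the differential
form of Grönwall's inequality applies to it. -/
lemma le_mul_exp_of_le_add_integral {u : ℝ → ℝ} (hu : Continuous u) {a L t₀ : ℝ} (hL : 0 ≤ L)
    (h : ∀ t ∈ Icc 0 t₀, u t ≤ a + L * ∫ s in (0 : ℝ)..t, u s) {t : ℝ} (ht : t ∈ Icc 0 t₀) :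
    u t ≤ a * Real.exp (L * t) := by
  have hd (s : ℝ) : HasDerivAt (fun t => a + L * ∫ s in (0 : ℝ)..t, u s) (L * u s) s :=
    ((hu.integral_hasStrictDerivAt 0 s).hasDerivAt.const_mul L).const_add a
  have := le_gronwallBound_of_liminf_deriv_right_le (f := fun t => a + L * ∫ s in (0 : ℝ)..t, u s)
    (f' := fun s => L * u s) (δ := a) (K := L) (ε := 0) (a := 0) (b := t₀)
    (fun s _ => (hd s).continuousAt.continuousWithinAt)
    (fun s _ r hr => (hd s).hasDerivWithinAt.liminf_right_slope_le hr) (by simp)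
    (fun s hs => by
      rw [add_zero]
      exact mul_le_mul_of_nonneg_left (h s ⟨hs.1, hs.2.le⟩) hL) t ht
  rw [gronwallBound_ε0, sub_zero] at this
  exact (h t ht).trans this

/-- A time-dependent vector field which is Lipschitz in space and continuous in time. -/
structure Drift (d : ℕ) (L : ℝ≥0) where
  /-- The underlying function. -/
  toFun : ℝ → E d → E d
  lipschitz : ∀ t x y, ‖toFun t x - toFun t y‖ ≤ L * ‖x - y‖
  continuous_time : ∀ z, Continuous fun t => toFun t z

namespace Drift

variable {d : ℕ} {T L : ℝ≥0} (b : Drift d L)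

lemma continuous_uncurry : Continuous fun p : ℝ × E d => b.toFun p.1 p.2 :=
  continuous_prod_of_continuous_lipschitzWith' (fun p : ℝ × E d => b.toFun p.1 p.2) L
    (fun t => LipschitzWith.of_dist_le_mul fun x y => by
      simpa [dist_eq_norm] using b.lipschitz t x y) b.continuous_time

lemma continuous_along (z : PathSpace d T) : Continuous fun s => b.toFun s (X s z) :=
  b.continuous_uncurry.comp (continuous_id.prodMk (continuous_X_time z))

lemma norm_le (t : ℝ) (x : E d) : ‖b.toFun t x‖ ≤ L * ‖x‖ + ‖b.toFun t 0‖ := by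
  have h := b.lipschitz t x 0
  rw [sub_zero] at h
  have := norm_sub_norm_le (b.toFun t x) (b.toFun t 0)
  linarith

/-- The path `t ↦ ∫₀ᵗ b(s, z_s) ds`. -/
def integralPath (z : PathSpace d T) : PathSpace d T where
  toFun t := ∫ s in (0 : ℝ)..t, b.toFun s (X s z)
  continuous_toFun := (intervalIntegral.continuous_primitive
    (fun _ _ => (b.continuous_along z).intervalIntegrable _ _) 0).comp continuous_subtype_val

/-- The noise `t ↦ z_t - ∫₀ᵗ b(s, z_s) ds` which drives the path `z`. -/
def noise (z : PathSpace d T) : PathSpace d T := z - b.integralPath z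

lemma X_integralPath {t : ℝ} (ht : t ∈ Icc (0 : ℝ) T) (z : PathSpace d T) :
    X t (b.integralPath z) = ∫ s in (0 : ℝ)..t, b.toFun s (X s z) := by
  rw [X_of_mem ht]
  rfl

lemma X_noise {t : ℝ} (ht : t ∈ Icc (0 : ℝ) T) (z : PathSpace d T) :
    X t (b.noise z) = X t z - ∫ s in (0 : ℝ)..t, b.toFun s (X s z) := by
  rw [noise, X_sub, X_integralPath b ht]

lemma X_zero_noise (z : PathSpace d T) : X 0 (b.noise z) = X 0 z := by
  rw [X_noise b ⟨le_rfl, T.coe_nonneg⟩]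
  simp

lemma norm_X_integralPath_sub_le {t : ℝ} (ht : t ∈ Icc (0 : ℝ) T) (z z' : PathSpace d T) :
    ‖X t (b.integralPath z) - X t (b.integralPath z')‖ ≤
      L * ∫ s in (0 : ℝ)..t, ‖X s z - X s z'‖ := by
  rw [X_integralPath b ht, X_integralPath b ht,
    ← intervalIntegral.integral_sub ((b.continuous_along z).intervalIntegrable _ _)
      ((b.continuous_along z').intervalIntegrable _ _), ← intervalIntegral.integral_const_mul]
  refine intervalIntegral.norm_integral_le_of_norm_le ht.1 ?_ ?_
  · exact ae_of_all _ fun s _ => b.lipschitz s _ _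
  · exact (((continuous_X_time z).sub (continuous_X_time z')).norm.const_mul _).intervalIntegrable _ _

lemma norm_integralPath_sub_le (z z' : PathSpace d T) :
    ‖b.integralPath z - b.integralPath z'‖ ≤ L * T * ‖z - z'‖ := by
  refine norm_path_le fun t ht => ?_
  rw [X_sub]
  refine (b.norm_X_integralPath_sub_le ht z z').trans ?_
  rw [mul_assoc]
  refine mul_le_mul_of_nonneg_left ?_ L.coe_nonneg
  calc ∫ s in (0 : ℝ)..t, ‖X s z - X s z'‖ ≤ ∫ s in (0 : ℝ)..t, ‖z - z'‖ := by
        refine intervalIntegral.integral_mono_on ht.1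
          (((continuous_X_time z).sub (continuous_X_time z')).norm.intervalIntegrable _ _)
          (continuous_const.intervalIntegrable _ _) fun s _ => ?_
        rw [← X_sub]
        exact norm_X_le s _
    _ = t * ‖z - z'‖ := by simp
    _ ≤ T * ‖z - z'‖ := by gcongr; exact ht.2

lemma norm_noise_sub_le (z z' : PathSpace d T) :
    ‖b.noise z - b.noise z'‖ ≤ (1 + L * T) * ‖z - z'‖ := by
  rw [noise, noise, sub_sub_sub_comm, add_mul, one_mul]
  exact (norm_sub_le _ _).trans (add_le_add le_rfl (b.norm_integralPath_sub_le z z'))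

/-- The constant depends only on L and T, so the noise maps of a sequence of such drifts are
equi-Lipschitz. -/
lemma lipschitzWith_noise : LipschitzWith (1 + L * T) (b.noise : PathSpace d T → PathSpace d T) :=
  LipschitzWith.of_dist_le_mul fun z z' => by
    simpa [dist_eq_norm] using b.norm_noise_sub_le z z'

lemma continuous_noise : Continuous (b.noise : PathSpace d T → PathSpace d T) :=
  b.lipschitzWith_noise.continuous

/-- Grönwall on [0, t₀]. The freedom in t₀ yields both the global stability of the equation and the
fact that the solution does not anticipate the noise. -/
lemma norm_X_sub_le_of_noise {t₀ a : ℝ} (ht₀ : t₀ ≤ T) {z z' : PathSpace d T}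
    (h : ∀ s ∈ Icc 0 t₀, ‖X s (b.noise z) - X s (b.noise z')‖ ≤ a) {t : ℝ} (ht : t ∈ Icc 0 t₀) :
    ‖X t z - X t z'‖ ≤ a * Real.exp (L * t) := by
  refine le_mul_exp_of_le_add_integral (u := fun t => ‖X t z - X t z'‖)
    ((continuous_X_time z).sub (continuous_X_time z')).norm L.coe_nonneg (fun s hs => ?_) ht
  have hs' : s ∈ Icc (0 : ℝ) T := ⟨hs.1, hs.2.trans ht₀⟩
  have heq (y : PathSpace d T) : X s y = X s (b.noise y) + X s (b.integralPath y) := by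
    rw [noise, X_sub, sub_add_cancel]
  have : X s z - X s z' = (X s (b.noise z) - X s (b.noise z')) +
      (X s (b.integralPath z) - X s (b.integralPath z')) := by
    rw [heq z, heq z']
    abel
  rw [this]
  exact (norm_add_le _ _).trans (add_le_add (h s hs) (b.norm_X_integralPath_sub_le hs' z z'))

lemma norm_sub_le_of_noise (z z' : PathSpace d T) :
    ‖z - z'‖ ≤ Real.exp (L * T) * ‖b.noise z - b.noise z'‖ := by
  refine norm_path_le fun t ht => ?_
  have h := b.norm_X_sub_le_of_noise (z := z) (z' := z') (a := ‖b.noise z - b.noise z'‖) le_rfl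
    (fun s _ => by rw [← X_sub]; exact norm_X_le s _) ht
  rw [X_sub, mul_comm]
  refine h.trans (mul_le_mul_of_nonneg_left (Real.exp_le_exp.2 ?_) (norm_nonneg _))
  exact mul_le_mul_of_nonneg_left ht.2 L.coe_nonneg

lemma noise_injective : Function.Injective (b.noise : PathSpace d T → PathSpace d T) := by
  intro z z' h
  have := b.norm_sub_le_of_noise z z'
  rw [h, sub_self, norm_zero, mul_zero] at this
  exact sub_eq_zero.1 (norm_le_zero_iff.1 this)

lemma norm_X_iterate_sub_le (w z z' : PathSpace d T) (n : ℕ) {t : ℝ} (ht : t ∈ Icc (0 : ℝ) T) :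
    ‖X t ((fun z => w + b.integralPath z)^[n] z) - X t ((fun z => w + b.integralPath z)^[n] z')‖ ≤
      (L * t) ^ n / n.factorial * ‖z - z'‖ := by
  induction n generalizing t with
  | zero =>
    simp only [Function.iterate_zero, id_eq, pow_zero, Nat.factorial_zero, Nat.cast_one, div_one,
      one_mul]
    rw [← X_sub]
    exact norm_X_le _ _
  | succ n ih =>
    rw [Function.iterate_succ_apply', Function.iterate_succ_apply', X_add, X_add,
      add_sub_add_left_eq_sub]
    refine (b.norm_X_integralPath_sub_le ht _ _).trans ?_
    have h1 : ∫ s in (0 : ℝ)..t, ‖X s ((fun z => w + b.integralPath z)^[n] z) -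
        X s ((fun z => w + b.integralPath z)^[n] z')‖ ≤
        ∫ s in (0 : ℝ)..t, (L * s) ^ n / n.factorial * ‖z - z'‖ := by
      refine intervalIntegral.integral_mono_on ht.1
        (((continuous_X_time _).sub (continuous_X_time _)).norm.intervalIntegrable _ _)
        (Continuous.intervalIntegrable (by fun_prop) _ _) fun s hs => ?_
      exact ih ⟨hs.1, hs.2.trans ht.2⟩
    refine (mul_le_mul_of_nonneg_left h1 L.coe_nonneg).trans_eq ?_
    simp_rw [mul_pow, div_mul_eq_mul_div, mul_right_comm _ _ ‖z - z'‖]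
    rw [intervalIntegral.integral_div, intervalIntegral.integral_const_mul, integral_pow,
      Nat.factorial_succ]
    have : (n.factorial : ℝ) ≠ 0 := by positivity
    have : (n + 1 : ℝ) ≠ 0 := by positivity
    push_cast
    field_simp
    simp
    ring

/-- Picard iteration on the whole of [0,T]: the n-th iterate has Lipschitz constant (LT)ⁿ/n!, hence
is a contraction for some n, and the fixed point of an iterate is a fixed point of the map itself.
-/
lemma noise_surjective : Function.Surjective (b.noise : PathSpace d T → PathSpace d T) := by
  intro w
  let F (z : PathSpace d T) : PathSpace d T := w + b.integralPath z
  have hlim : Tendsto (fun n : ℕ => ((L : ℝ) * T) ^ n / n.factorial) atTop (𝓝 0) :=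
    FloorSemiring.tendsto_pow_div_factorial_atTop _
  obtain ⟨n, hn⟩ := (hlim.eventually_lt_const one_pos).exists
  let K : ℝ≥0 := (L * T) ^ n / n.factorial
  have hF : ContractingWith K (F^[n]) := by
    refine ⟨?_, LipschitzWith.of_dist_le_mul fun z z' => ?_⟩
    · rw [← NNReal.coe_lt_coe]
      simpa [K] using hn
    · rw [dist_eq_norm, dist_eq_norm]
      refine norm_path_le fun t ht => ?_
      rw [X_sub]
      refine (b.norm_X_iterate_sub_le w z z' n ht).trans ?_
      simp only [K]
      push_cast
      have := ht.1
      have := ht.2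
      gcongr
  have hfix := hF.isFixedPt_fixedPoint_iterate
  refine ⟨ContractingWith.fixedPoint (F^[n]) hF, ?_⟩
  rw [noise, sub_eq_iff_eq_add]
  exact hfix.symm

/-- The solution of `z_t = w_t + ∫₀ᵗ b(s, z_s) ds`. -/
def solve (w : PathSpace d T) : PathSpace d T := Function.surjInv b.noise_surjective w

lemma noise_solve (w : PathSpace d T) : b.noise (b.solve w) = w :=
  Function.surjInv_eq b.noise_surjective w

lemma solve_noise (z : PathSpace d T) : b.solve (b.noise z) = z :=
  b.noise_injective (b.noise_solve _)

lemma continuous_solve : Continuous (b.solve : PathSpace d T → PathSpace d T) :=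
  (LipschitzWith.of_dist_le_mul (K := ⟨Real.exp (L * T), (Real.exp_pos _).le⟩) fun w w' => by
    have := b.norm_sub_le_of_noise (b.solve w) (b.solve w')
    rw [noise_solve, noise_solve] at this
    rwa [dist_eq_norm, dist_eq_norm]).continuous

/-- Causality of the solution map, from which adaptedness follows. -/
lemma X_solve_eq {t : ℝ} (ht : t ∈ Icc (0 : ℝ) T) {w w' : PathSpace d T}
    (h : ∀ s ∈ Icc 0 t, X s w = X s w') : X t (b.solve w) = X t (b.solve w') := by
  have := b.norm_X_sub_le_of_noise (z := b.solve w) (z' := b.solve w') (a := 0) ht.2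
    (fun s hs => by rw [noise_solve, noise_solve, h s hs, sub_self, norm_zero]) ⟨ht.1, le_rfl⟩
  rw [zero_mul] at this
  exact sub_eq_zero.1 (norm_le_zero_iff.1 this)

lemma norm_X_le_add_integral {t : ℝ} (ht : t ∈ Icc (0 : ℝ) T) (z : PathSpace d T) :
    ‖X t z‖ ≤ ‖b.noise z‖ + ∫ s in (0 : ℝ)..t, (L * ‖X s z‖ + ‖b.toFun s 0‖) := by
  have heq : X t z = X t (b.noise z) + ∫ s in (0 : ℝ)..t, b.toFun s (X s z) := by
    rw [X_noise b ht, sub_add_cancel]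
  rw [heq]
  refine (norm_add_le _ _).trans (add_le_add (norm_X_le _ _) ?_)
  refine intervalIntegral.norm_integral_le_of_norm_le ht.1
    (ae_of_all _ fun s _ => b.norm_le s _) (Continuous.intervalIntegrable ?_ _ _)
  exact ((continuous_X_time z).norm.const_mul _).add (b.continuous_time 0).norm

lemma norm_le_of_noise {m : ℝ} (hm : ∀ s ∈ Icc (0 : ℝ) T, ‖b.toFun s 0‖ ≤ m) (z : PathSpace d T) :
    ‖z‖ ≤ Real.exp (L * T) * (‖b.noise z‖ + m * T) := by
  have hm0 : 0 ≤ m := (norm_nonneg _).trans (hm 0 ⟨le_rfl, T.coe_nonneg⟩)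
  refine norm_path_le fun t ht => ?_
  have hcX := (continuous_X_time z).norm
  have h := le_mul_exp_of_le_add_integral (u := fun t => ‖X t z‖) (a := ‖b.noise z‖ + m * T)
    hcX L.coe_nonneg (t₀ := T) (fun s hs => ?_) ht
  · rw [mul_comm]
    refine h.trans (mul_le_mul_of_nonneg_left (Real.exp_le_exp.2 ?_) (by positivity))
    exact mul_le_mul_of_nonneg_left ht.2 L.coe_nonneg
  · refine (b.norm_X_le_add_integral hs z).trans ?_
    rw [intervalIntegral.integral_add ((hcX.const_mul _).intervalIntegrable _ _)
      ((b.continuous_time 0).norm.intervalIntegrable _ _), intervalIntegral.integral_const_mul]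
    have h2 : ∫ r in (0 : ℝ)..s, ‖b.toFun r 0‖ ≤ m * T := by
      calc ∫ r in (0 : ℝ)..s, ‖b.toFun r 0‖ ≤ ∫ r in (0 : ℝ)..s, m :=
            intervalIntegral.integral_mono_on hs.1
              ((b.continuous_time 0).norm.intervalIntegrable _ _)
              (continuous_const.intervalIntegrable _ _) fun r hr => hm r ⟨hr.1, hr.2.trans hs.2⟩
        _ = s * m := by simp
        _ ≤ m * T := by rw [mul_comm]; gcongr; exact hs.2
    beta_reduce
    rw [add_right_comm, add_assoc]
    gcongr

lemma norm_X_integralPath_sub_le_time {C : ℝ} {z : PathSpace d T}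
    (hC : ∀ s ∈ Icc (0 : ℝ) T, ‖b.toFun s (X s z)‖ ≤ C) (t t' : Icc (0 : ℝ) T) :
    dist (b.integralPath z t) (b.integralPath z t') ≤ C * dist t t' := by
  rw [dist_eq_norm, Subtype.dist_eq, Real.dist_eq, abs_sub_comm]
  change ‖(∫ s in (0 : ℝ)..t, b.toFun s (X s z)) - ∫ s in (0 : ℝ)..t', b.toFun s (X s z)‖ ≤ _
  rw [intervalIntegral.integral_interval_sub_left
    ((b.continuous_along z).intervalIntegrable _ _)
    ((b.continuous_along z).intervalIntegrable _ _), abs_sub_comm]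
  refine intervalIntegral.norm_integral_le_of_norm_le_const fun s hs => hC s ?_
  rw [uIoc, mem_Ioc] at hs
  exact ⟨(le_min t'.2.1 t.2.1).trans hs.1.le, hs.2.trans (max_le t'.2.2 t.2.2)⟩

end Drift

/-! ### Strong solutions as images of the noise. -/

section StrongSolution

variable {d : ℕ} {T : ℝ≥0}

/-- The law `R` of the noise `Z₀ + B`: the law of a strong solution is the image of `R` by the
solution map, and the part of the noise due to `B` is exponentially square integrable. -/
theorem exists_noiseLaw (T : ℝ≥0) (μ₀ : Measure (E d)) [IsProbabilityMeasure μ₀] :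
    ∃ R : Measure (PathSpace d T), IsProbabilityMeasure R ∧
      (∃ c > 0, Integrable (fun w => Real.exp (c * ‖w - ContinuousMap.const _ (X 0 w)‖ ^ 2)) R) ∧
      ∀ (L : ℝ≥0) (b : Drift d L) (Q : Measure (PathSpace d T)),
        IsLawOfStrongSolution b.toFun μ₀ Q ↔ Q = R.map b.solve := by
  obtain ⟨Ω, _, P, _, ξ, B, hξ, hξμ, hB, hind, hBc, hB0, hexp⟩ := exists_noise T μ₀
  let β (ω : Ω) : PathSpace d T := ⟨fun t => B ⟨t, t.2.1⟩ ω, (hBc ω).comp (by fun_prop)⟩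
  let w (ω : Ω) : PathSpace d T := ContinuousMap.const _ (ξ ω) + β ω
  have hwX (ω : Ω) (t : ℝ≥0) (ht : t ≤ T) : X (t : ℝ) (w ω) = ξ ω + B t ω := by
    rw [X_of_mem ⟨t.coe_nonneg, NNReal.coe_le_coe.2 ht⟩]
    rfl
  have hw0 (ω : Ω) : X 0 (w ω) = ξ ω := by
    have := hwX ω 0 zero_le
    rwa [hB0, add_zero] at this
  have hwm : Measurable w := measurable_continuousMap_iff.2 fun t => hξ.add (hB.measurable _)
  refine ⟨P.map w, Measure.isProbabilityMeasure_map hwm.aemeasurable, ?_, fun L b Q => ⟨?_, ?_⟩⟩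
  · obtain ⟨c, hc, hi⟩ := hexp β fun ω t => rfl
    refine ⟨c, hc, (integrable_map_measure ?_ hwm.aemeasurable).2 ?_⟩
    · have h1 := continuous_X (d := d) (T := T) 0
      have h2 : Continuous fun x : E d => ContinuousMap.const (Icc (0 : ℝ) T) x :=
        ContinuousMap.continuous_const'
      exact (by fun_prop : Continuous fun w : PathSpace d T =>
        Real.exp (c * ‖w - ContinuousMap.const _ (X 0 w)‖ ^ 2)).aestronglyMeasurable
    · convert! hi using 3 with ω
      simp only [Function.comp_apply, hw0]
      simp [w]
  · rintro ⟨Ω', _, P', B', Z, _, hZ, rfl⟩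
    have hNm : Measurable fun ω => b.noise (Z ω) :=
      b.continuous_noise.measurable.comp hZ.measurable
    -- The equation says that the noise of a solution is Z₀ + B' almost surely. At the dense times
    -- this is a fixed measurable function g of the pair (Z₀, B'), whose law is determined.
    have hN : P'.map (fun ω => b.noise (Z ω)) = P.map w := by
      refine continuousMap_measure_ext ?_
      let D : ℕ → Icc (0 : ℝ) T := TopologicalSpace.denseSeq _
      let g (p : E d × (ℝ≥0 → E d)) (n : ℕ) : E d := p.1 + p.2 ⟨D n, (D n).2.1⟩
      have hg : Measurable g := by fun_prop
      have hB'm : Measurable fun ω (t : ℝ≥0) => B' t ω :=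
        measurable_pi_lambda _ hZ.isBrownianMotion.measurable
      have hBm : Measurable fun ω (t : ℝ≥0) => B t ω := measurable_pi_lambda _ hB.measurable
      have hX0 : Measurable fun ω => X 0 (Z ω) := (continuous_X 0).measurable.comp hZ.measurable
      have hem := (measurableEmbedding_eval_denseSeq (Icc (0 : ℝ) T) (E d)).measurable
      have hlaw := hZ.isBrownianMotion.map_prod_eq hB hX0 hξ (hZ.law_initial.trans hξμ.symm)
        hZ.indep hind
      have h1 := congrArg (Measure.map g) hlaw
      rw [Measure.map_map hg (hX0.prodMk hB'm), Measure.map_map hg (hξ.prodMk hBm)] at h1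
      rw [Measure.map_map hem hNm, Measure.map_map hem hwm]
      refine Eq.trans (Measure.map_congr ?_) h1
      filter_upwards [hZ.equation] with ω hω
      funext n
      simp only [Function.comp_apply, g]
      have h2 := hω ⟨D n, (D n).2.1⟩ (D n).2.2
      have h3 := b.X_noise (D n).2 (Z ω)
      rw [X_coe] at h3
      refine h3.trans ?_
      refine (congrArg (· - ∫ s in (0 : ℝ)..(D n), b.toFun s (X s (Z ω))) h2).trans ?_
      exact (congrArg (· - ∫ s in (0 : ℝ)..(D n), b.toFun s (X s (Z ω)))
        (add_right_comm _ _ _)).trans (add_sub_cancel_right _ _)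
    rw [← hN, Measure.map_map b.continuous_solve.measurable hNm]
    congr 1
    funext ω
    simp [b.solve_noise]
  · rintro rfl
    have h0 : (fun ω => X 0 (b.solve (w ω))) = ξ := by
      funext ω
      rw [← b.X_zero_noise, b.noise_solve, hw0]
    refine ⟨Ω, inferInstance, P, B, fun ω => b.solve (w ω), inferInstance, ?_, ?_⟩
    · refine ⟨hB, b.continuous_solve.measurable.comp hwm, by rw [h0, hξμ], by rwa [h0],
        fun t ht => ?_, ae_of_all _ fun ω t ht => ?_⟩
      · rw [h0]
        refine Measurable.stronglyMeasurable ?_ |>.aestronglyMeasurable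
        -- The noise with B stopped at time t. It is measurable for σ(Z₀, B_s : s ≤ t), and by
        -- causality it produces the same solution up to time t.
        let v (ω : Ω) : PathSpace d T :=
          ⟨fun s => ξ ω + B (min ⟨s, s.2.1⟩ t) ω,
            continuous_const.add ((hBc ω).comp (by fun_prop))⟩
        have hv (ω : Ω) : X (t : ℝ) (b.solve (w ω)) = X (t : ℝ) (b.solve (v ω)) := by
          refine b.X_solve_eq ⟨t.coe_nonneg, NNReal.coe_le_coe.2 ht⟩ fun s hs => ?_
          have hsT : s ∈ Icc (0 : ℝ) T := ⟨hs.1, hs.2.trans (NNReal.coe_le_coe.2 ht)⟩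
          rw [X_of_mem hsT, X_of_mem hsT]
          have : min (⟨s, hs.1⟩ : ℝ≥0) t = ⟨s, hs.1⟩ := min_eq_left hs.2
          simp only [v, w, β, ContinuousMap.add_apply, ContinuousMap.const_apply,
            ContinuousMap.coe_mk]
          exact congrArg (fun r => ξ ω + B r ω) this.symm
        simp_rw [hv]
        refine (continuous_X (T := T) (t : ℝ)).measurable.comp
          (b.continuous_solve.measurable.comp ?_)
        refine measurable_continuousMap_iff.2 fun s => ?_
        refine Measurable.add ?_ ?_
        · exact (comap_measurable ξ).mono le_sup_left le_rfl
        · refine (comap_measurable (B (min ⟨s, s.2.1⟩ t))).mono ?_ le_rfl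
          exact (le_iSup (fun s : {s : ℝ≥0 // s ≤ t} =>
            MeasurableSpace.comap (B s) inferInstance) ⟨min ⟨s, s.2.1⟩ t, min_le_right _ _⟩).trans
            le_sup_right
      · have htT : (t : ℝ) ∈ Icc (0 : ℝ) T := ⟨t.coe_nonneg, NNReal.coe_le_coe.2 ht⟩
        have h1 := b.X_noise htT (b.solve (w ω))
        rw [b.noise_solve, hwX ω t ht] at h1
        rw [congrFun h0 ω, add_right_comm, h1, sub_add_cancel]
    · rw [Measure.map_map b.continuous_solve.measurable hwm]
      rfl

end StrongSolution

/-! ### Regularity of ∇W and of the mean field drift. -/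

section Gradient

variable {d : ℕ} {W : E d → ℝ}

/-- The hypothesis bounds the Hessian on the diagonal only. Symmetry of second derivatives and
polarization, 4 A(u,v) = A(u+v,u+v) - A(u-v,u-v), extend the bound to all pairs; for unit vectors
the parallelogram law preserves the constant. -/
lemma H1.norm_fderiv_fderiv_le (h : H1 W) :
    ∃ C : ℝ≥0, ∀ z, ‖fderiv ℝ (fderiv ℝ W) z‖ ≤ C := by
  obtain ⟨C, hC⟩ := h.bounded_hessian
  refine ⟨C.toNNReal, fun z => ?_⟩
  have hC' : C ≤ C.toNNReal := Real.le_coe_toNNReal C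
  set A := fderiv ℝ (fderiv ℝ W) z with hA
  have hsymm (u v : E d) : A u v = A v u := by
    have := (h.contDiff.contDiffAt (x := z)).isSymmSndFDerivAt (by simp)
    exact this.eq u v
  have hunit (v : E d) (hv : ‖v‖ = 1) : |A v v| ≤ C.toNNReal := by
    have := hC z v hv
    rw [iteratedFDeriv_two_apply] at this
    exact this.trans hC'
  have hquad (v : E d) : |A v v| ≤ C.toNNReal * ‖v‖ ^ 2 := by
    by_cases hv : v = 0
    · simp [hv]
    · have hv' : ‖v‖ ≠ 0 := norm_ne_zero_iff.2 hv
      have := hunit (‖v‖⁻¹ • v) (norm_smul_inv_norm hv)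
      simp only [map_smul, FunLike.coe_smul, Pi.smul_apply, smul_eq_mul, abs_mul, abs_inv,
        abs_norm] at this
      field_simp at this
      linarith
  have hbil (u v : E d) (hu : ‖u‖ = 1) (hv : ‖v‖ = 1) : |A u v| ≤ C.toNNReal := by
    have h1 := hquad (u + v)
    have h2 := hquad (u - v)
    have hpar := parallelogram_law_with_norm ℝ u v
    have h3 : A (u + v) (u + v) - A (u - v) (u - v) = 4 * A u v := by
      simp only [map_add, map_sub, FunLike.coe_add, FunLike.coe_sub, Pi.add_apply,
        Pi.sub_apply]
      rw [hsymm v u]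
      ring
    rw [hu, hv] at hpar
    have h4 : |4 * A u v| ≤ C.toNNReal * (‖u + v‖ ^ 2 + ‖u - v‖ ^ 2) := by
      rw [← h3, mul_add]
      exact (abs_sub _ _).trans (add_le_add h1 h2)
    rw [abs_mul, hpar] at h4
    rw [abs_of_pos (by norm_num : (0 : ℝ) < 4)] at h4
    linarith
  refine ContinuousLinearMap.opNorm_le_bound _ (NNReal.coe_nonneg _) fun u => ?_
  refine ContinuousLinearMap.opNorm_le_bound _ (by positivity) fun v => ?_
  by_cases hu : u = 0
  · simp [hu]
  by_cases hv : v = 0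
  · simp [hv]
  have hu' : ‖u‖ ≠ 0 := norm_ne_zero_iff.2 hu
  have hv' : ‖v‖ ≠ 0 := norm_ne_zero_iff.2 hv
  have := hbil (‖u‖⁻¹ • u) (‖v‖⁻¹ • v) (norm_smul_inv_norm hu) (norm_smul_inv_norm hv)
  simp only [map_smul, FunLike.coe_smul, Pi.smul_apply, smul_eq_mul, abs_mul, abs_inv,
    abs_norm] at this
  field_simp at this
  rw [Real.norm_eq_abs]
  linarith

lemma H1.exists_lipschitz_gradient (h : H1 W) :
    ∃ L : ℝ≥0, ∀ x y, ‖gradient W x - gradient W y‖ ≤ L * ‖x - y‖ := by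
  obtain ⟨C, hC⟩ := h.norm_fderiv_fderiv_le
  refine ⟨C, fun x y => ?_⟩
  have hd : Differentiable ℝ (fderiv ℝ W) :=
    (h.contDiff.fderiv_right (m := 1) (by norm_num)).differentiable (by norm_num)
  rw [gradient, gradient, ← map_sub, LinearIsometryEquiv.norm_map]
  exact Convex.norm_image_sub_le_of_norm_fderiv_le (fun z _ => hd z) (fun z _ => hC z)
    convex_univ (mem_univ y) (mem_univ x)

/-- Differentiating W(-z) = W(z) at the origin shows that the derivative there equals its opposite.
-/
lemma H1.gradient_zero (h : H1 W) : gradient W 0 = 0 := by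
  have hd : HasFDerivAt W (fderiv ℝ W 0) 0 :=
    (h.contDiff.differentiable (by norm_num) 0).hasFDerivAt
  have hd' : HasFDerivAt W (fderiv ℝ W 0) (-0) := by rwa [neg_zero]
  have h1 := hd'.comp 0 (hasFDerivAt_id (𝕜 := ℝ) (0 : E d)).neg
  rw [show W ∘ Neg.neg = W from funext h.even] at h1
  have h2 : fderiv ℝ W 0 = 0 := by
    ext v
    have := congrArg (fun A : E d →L[ℝ] ℝ => A v) (hd.unique h1)
    simp at this ⊢
    linarith
  rw [gradient, h2, map_zero]

end Gradient

section MeanField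

variable {d : ℕ} {T L : ℝ≥0} {W : E d → ℝ}

lemma continuous_of_norm_sub_le {G : E d → E d} (hL : ∀ x y, ‖G x - G y‖ ≤ L * ‖x - y‖) :
    Continuous G :=
  (LipschitzWith.of_dist_le_mul fun x y => by simpa [dist_eq_norm] using hL x y).continuous

lemma norm_gradient_sub_X_le (hL : ∀ x y, ‖gradient W x - gradient W y‖ ≤ L * ‖x - y‖)
    (h0 : gradient W 0 = 0) (t : ℝ) (z : E d) (ω : PathSpace d T) :
    ‖gradient W (z - X t ω)‖ ≤ L * (‖z‖ + ‖X t ω‖) := by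
  have h := hL (z - X t ω) 0
  rw [h0, sub_zero, sub_zero] at h
  exact h.trans (mul_le_mul_of_nonneg_left (norm_sub_le _ _) L.coe_nonneg)

lemma MemP1.integrable_norm_X {P : Measure (PathSpace d T)} (hP : MemP1 P) (t : ℝ) :
    Integrable (fun ω => ‖X t ω‖) P :=
  hP.2.mono' (continuous_X t).norm.aestronglyMeasurable
    (ae_of_all _ fun ω => by rw [norm_norm]; exact norm_X_le t ω)

lemma integrable_gradient_sub_X (hL : ∀ x y, ‖gradient W x - gradient W y‖ ≤ L * ‖x - y‖)
    (h0 : gradient W 0 = 0) {P : Measure (PathSpace d T)} (hP : MemP1 P) (t : ℝ) (z : E d) :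
    Integrable (fun ω => gradient W (z - X t ω)) P := by
  have := hP.1
  refine Integrable.mono' (g := fun ω => L * (‖z‖ + ‖X t ω‖))
    (((integrable_const _).add (hP.integrable_norm_X t)).const_mul _) ?_
    (ae_of_all _ fun ω => norm_gradient_sub_X_le hL h0 t z ω)
  exact ((continuous_of_norm_sub_le hL).comp
    (continuous_const.sub (continuous_X t))).aestronglyMeasurable

lemma drift_eq (hL : ∀ x y, ‖gradient W x - gradient W y‖ ≤ L * ‖x - y‖)
    (P : Measure (PathSpace d T)) (t : ℝ) (z : E d) :
    drift W P t z = -∫ ω, gradient W (z - X t ω) ∂P := by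
  rw [drift, marginal, integral_map (continuous_X t).aemeasurable]
  exact ((continuous_of_norm_sub_le hL).comp
    (continuous_const.sub continuous_id)).aestronglyMeasurable

/-- The drift `-(∇W ∗ P_t)(z)` as a Lipschitz vector field. -/
def meanFieldDrift (hL : ∀ x y, ‖gradient W x - gradient W y‖ ≤ L * ‖x - y‖)
    (h0 : gradient W 0 = 0) {P : Measure (PathSpace d T)} (hP : MemP1 P) : Drift d L where
  toFun := drift W P
  lipschitz t x y := by
    have := hP.1
    have hi := integrable_gradient_sub_X hL h0 hP t
    rw [drift_eq hL, drift_eq hL, neg_sub_neg, ← integral_sub (hi y) (hi x)]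
    have := norm_integral_le_of_norm_le_const (μ := P)
      (f := fun ω => gradient W (y - X t ω) - gradient W (x - X t ω)) (C := L * ‖x - y‖)
      (ae_of_all _ fun ω => by
        refine (hL _ _).trans_eq ?_
        rw [sub_sub_sub_cancel_right, norm_sub_rev])
    simpa using this
  continuous_time z := by
    have := hP.1
    simp_rw [drift_eq hL]
    -- Integrability of the supremum norm supplies a dominating function that does not depend on t.
    refine Continuous.neg (continuous_of_dominated (bound := fun ω => L * (‖z‖ + ‖ω‖))
      (fun t => (integrable_gradient_sub_X hL h0 hP t z).1) (fun t => ae_of_all _ fun ω => ?_)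
      (((integrable_const _).add hP.2).const_mul _) (ae_of_all _ fun ω => ?_))
    · exact (norm_gradient_sub_X_le hL h0 t z ω).trans (by gcongr; exact norm_X_le t ω)
    · exact (continuous_of_norm_sub_le hL).comp (continuous_const.sub (continuous_X_time ω))

lemma norm_meanFieldDrift_zero_le (hL : ∀ x y, ‖gradient W x - gradient W y‖ ≤ L * ‖x - y‖)
    (h0 : gradient W 0 = 0) {P : Measure (PathSpace d T)} (hP : MemP1 P) (t : ℝ) :
    ‖(meanFieldDrift hL h0 hP).toFun t 0‖ ≤ L * ∫ ω, ‖X t ω‖ ∂P := by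
  change ‖drift W P t 0‖ ≤ _
  rw [drift_eq hL, norm_neg, ← integral_const_mul]
  refine norm_integral_le_of_norm_le ((hP.integrable_norm_X t).const_mul _)
    (ae_of_all _ fun ω => ?_)
  simpa using norm_gradient_sub_X_le hL h0 t 0 ω

end MeanField

/-! ### Variational characterization and lower semicontinuity of the relative entropy. -/

section Entropy

variable {S : Type*} {mS : MeasurableSpace S} {μ ν : Measure S} [IsProbabilityMeasure μ]
  [IsProbabilityMeasure ν]

/-- The entropy inequality of Donsker and Varadhan. -/
lemma integral_le_add_log_integral_exp {c : ℝ} (hc : 0 ≤ c) (h : klDiv μ ν ≤ ENNReal.ofReal c)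
    {f : S → ℝ} (hf : Integrable f μ) (hexp : Integrable (fun x => Real.exp (f x)) ν) :
    ∫ x, f x ∂μ ≤ c + Real.log (∫ x, Real.exp (f x) ∂ν) := by
  obtain ⟨hac, hint⟩ := klDiv_ne_top_iff.1 (h.trans_lt ENNReal.ofReal_lt_top).ne
  have := isProbabilityMeasure_tilted hexp
  -- The inequality is the nonnegativity of the entropy of μ relative to ν tilted by f.
  have h1 := integral_llr_add_sub_measure_univ_nonneg
    (hac.trans (absolutelyContinuous_tilted hexp)) (integrable_llr_tilted_right hac hf hint hexp)
  rw [integral_llr_tilted_right hac hf hexp hint] at h1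
  have h2 := toReal_klDiv hac hint
  have h3 : (klDiv μ ν).toReal ≤ c := ENNReal.toReal_le_of_le_ofReal hc h
  simp only [probReal_univ, add_sub_cancel_right] at h1 h2
  linarith

/-- The entropy inequality for nonnegative functions. -/
lemma lintegral_le_add_log_integral_exp {c : ℝ} (hc : 0 ≤ c) (h : klDiv μ ν ≤ ENNReal.ofReal c)
    {f : S → ℝ} (hm : Measurable f) (hf0 : ∀ x, 0 ≤ f x)
    (hexp : Integrable (fun x => Real.exp (f x)) ν) :
    ∫⁻ x, ENNReal.ofReal (f x) ∂μ ≤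
      ENNReal.ofReal (c + Real.log (∫ x, Real.exp (f x) ∂ν)) := by
  -- Truncation is needed because f is not known to be integrable for μ; monotone convergence then
  -- removes it.
  have hmin (n : ℕ) : ∫⁻ x, ENNReal.ofReal (min (f x) n) ∂μ ≤
      ENNReal.ofReal (c + Real.log (∫ x, Real.exp (f x) ∂ν)) := by
    have hi : Integrable (fun x => min (f x) n) μ := by
      refine Integrable.of_bound (C := n) (by fun_prop) (ae_of_all _ fun x => ?_)
      rw [Real.norm_of_nonneg (le_min (hf0 x) n.cast_nonneg)]
      exact min_le_right _ _
    have hle (x : S) : Real.exp (min (f x) n) ≤ Real.exp (f x) := Real.exp_le_exp.2 (min_le_left _ _)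
    have hei : Integrable (fun x => Real.exp (min (f x) n)) ν :=
      hexp.mono' (by fun_prop) (ae_of_all _ fun x => by
        rw [Real.norm_eq_abs, Real.abs_exp]; exact hle x)
    rw [← ofReal_integral_eq_lintegral_ofReal hi
      (ae_of_all _ fun x => le_min (hf0 x) n.cast_nonneg)]
    refine ENNReal.ofReal_le_ofReal ((integral_le_add_log_integral_exp hc h hi hei).trans ?_)
    gcongr
    · exact integral_exp_pos hei
    · exact hle
  have hlim : Tendsto (fun n : ℕ => ∫⁻ x, ENNReal.ofReal (min (f x) n) ∂μ) atTop
      (𝓝 (∫⁻ x, ENNReal.ofReal (f x) ∂μ)) := by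
    refine lintegral_tendsto_of_tendsto_of_monotone (fun n => by fun_prop)
      (ae_of_all _ fun x m n hmn => ?_) (ae_of_all _ fun x => ?_)
    · dsimp only
      gcongr
    · refine ENNReal.tendsto_ofReal (tendsto_const_nhds.congr' ?_)
      filter_upwards [eventually_ge_atTop ⌈f x⌉₊] with n hn
      exact (min_eq_left (Nat.ceil_le.1 hn)).symm
  exact le_of_tendsto' hlim hmin

lemma abs_exp_sub_exp_le {a b M : ℝ} (ha : a ≤ M) (hb : b ≤ M) :
    |Real.exp a - Real.exp b| ≤ Real.exp M * |a - b| := by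
  wlog hab : b ≤ a generalizing a b
  · rw [abs_sub_comm, abs_sub_comm a]
    exact this hb ha (le_of_not_ge hab)
  rw [abs_of_nonneg (sub_nonneg.2 (Real.exp_le_exp.2 hab)), abs_of_nonneg (sub_nonneg.2 hab)]
  have h1 : Real.exp b = Real.exp a * Real.exp (b - a) := by rw [← Real.exp_add]; ring_nf
  have h2 := Real.add_one_le_exp (b - a)
  have h3 : Real.exp a ≤ Real.exp M := Real.exp_le_exp.2 ha
  have h4 := Real.exp_pos a
  calc Real.exp a - Real.exp b = Real.exp a * (1 - Real.exp (b - a)) := by rw [h1]; ring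
    _ ≤ Real.exp a * (a - b) := mul_le_mul_of_nonneg_left (by linarith) h4.le
    _ ≤ _ := mul_le_mul_of_nonneg_right h3 (sub_nonneg.2 hab)

lemma abs_max_min_sub_le {a b M : ℝ} (ha : |a| ≤ M) : |a - max (-M) (min M b)| ≤ |a - b| := by
  rw [abs_le] at ha
  rcases le_total M b with h | h
  · rw [min_eq_left h, max_eq_right (by linarith)]
    rw [abs_of_nonpos (by linarith), abs_of_nonpos (by linarith)]
    linarith
  · rw [min_eq_right h]
    rcases le_total (-M) b with h' | h'
    · rw [max_eq_right h']
    · rw [max_eq_left h', abs_of_nonneg (by linarith), abs_of_nonneg (by linarith)]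
      linarith

/-- Passes from continuous to measurable test functions: f is approximated by a continuous function
in L¹(μ + ν). Clamping the approximation to [-M, M] does not increase the error, and exp is
Lipschitz with constant e^M below M, so both sides converge. -/
lemma integral_le_add_log_integral_exp_of_bounded [TopologicalSpace S] [NormalSpace S]
    [BorelSpace S] [μ.WeaklyRegular] [ν.WeaklyRegular] [(μ + ν).WeaklyRegular] {c : ℝ}
    (h : ∀ g : S →ᵇ ℝ, ∫ x, g x ∂μ ≤ c + Real.log (∫ x, Real.exp (g x) ∂ν))
    {f : S → ℝ} (hm : Measurable f) {M : ℝ} (hM : ∀ x, |f x| ≤ M) :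
    ∫ x, f x ∂μ ≤ c + Real.log (∫ x, Real.exp (f x) ∂ν) := by
  have hexpi {ρ : Measure S} [IsFiniteMeasure ρ] {g : S → ℝ} (hg : Measurable g)
      (hgM : ∀ x, |g x| ≤ M) : Integrable (fun x => Real.exp (g x)) ρ := by
    refine Integrable.of_bound (C := Real.exp M) (by fun_prop) (ae_of_all _ fun x => ?_)
    rw [Real.norm_eq_abs, Real.abs_exp]
    exact Real.exp_le_exp.2 ((le_abs_self _).trans (hgM x))
  have hi {ρ : Measure S} [IsFiniteMeasure ρ] {g : S → ℝ} (hg : Measurable g)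
      (hgM : ∀ x, |g x| ≤ M) : Integrable g ρ :=
    Integrable.of_bound (C := M) (by fun_prop) (ae_of_all _ hgM)
  have hε (ε : ℝ) (hε : 0 < ε) : ∫ x, f x ∂μ - ε ≤
      c + Real.log (∫ x, Real.exp (f x) ∂ν + Real.exp M * ε) := by
    obtain ⟨g₀, hg₀, hg₀i⟩ := (hi (ρ := μ + ν) hm hM).exists_boundedContinuous_integral_sub_le hε
    let g : S → ℝ := fun x => max (-M) (min M (g₀ x))
    have hgc : Continuous g := by fun_prop
    have hM0 (x : S) : 0 ≤ M := (abs_nonneg _).trans (hM x)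
    have hgM (x : S) : |g x| ≤ M := abs_le.2 ⟨le_max_left _ _,
      max_le (by have := hM0 x; linarith) (min_le_left _ _)⟩
    let g' : S →ᵇ ℝ := BoundedContinuousFunction.ofNormedAddCommGroup g hgc M hgM
    have hsub : Measurable fun x => |f x - g x| := by fun_prop
    have hsi {ρ : Measure S} [IsFiniteMeasure ρ] : Integrable (fun x => |f x - g x|) ρ :=
      ((hi hm hM).sub (hi hgc.measurable hgM)).abs
    have hfg : ∫ x, |f x - g x| ∂μ + ∫ x, |f x - g x| ∂ν ≤ ε := by
      rw [← integral_add_measure hsi hsi]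
      refine le_trans (integral_mono hsi ((hi (ρ := μ + ν) hm hM).sub hg₀i).norm fun x => ?_) hg₀
      exact abs_max_min_sub_le (hM x)
    have h0 : 0 ≤ ∫ x, |f x - g x| ∂μ := integral_nonneg fun _ => abs_nonneg _
    have h0' : 0 ≤ ∫ x, |f x - g x| ∂ν := integral_nonneg fun _ => abs_nonneg _
    have h1 : ∫ x, f x ∂μ - ∫ x, g x ∂μ ≤ ε := by
      rw [← integral_sub (hi hm hM) (hi hgc.measurable hgM)]
      refine (integral_mono ((hi hm hM).sub (hi hgc.measurable hgM)) hsi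
        fun x => le_abs_self _).trans ?_
      linarith
    have h2 : ∫ x, Real.exp (g x) ∂ν ≤ ∫ x, Real.exp (f x) ∂ν + Real.exp M * ε := by
      have : ∫ x, Real.exp (g x) ∂ν - ∫ x, Real.exp (f x) ∂ν ≤
          Real.exp M * ∫ x, |f x - g x| ∂ν := by
        rw [← integral_sub (hexpi hgc.measurable hgM) (hexpi hm hM), ← integral_const_mul]
        refine integral_mono ((hexpi hgc.measurable hgM).sub (hexpi hm hM)) (hsi.const_mul _)
          fun x => (le_abs_self _).trans ?_
        rw [abs_sub_comm (f x)]
        exact abs_exp_sub_exp_le ((le_abs_self _).trans (hgM x)) ((le_abs_self _).trans (hM x))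
      have h4 : Real.exp M * ∫ x, |f x - g x| ∂ν ≤ Real.exp M * ε := by gcongr; linarith
      linarith
    have h3 := h g'
    have h5 : Real.log (∫ x, Real.exp (g x) ∂ν) ≤
        Real.log (∫ x, Real.exp (f x) ∂ν + Real.exp M * ε) :=
      Real.log_le_log (integral_exp_pos (hexpi hgc.measurable hgM)) h2
    have h6 : ∫ x, g x ∂μ ≤ c + Real.log (∫ x, Real.exp (g x) ∂ν) := h3
    linarith
  have hpos : 0 < ∫ x, Real.exp (f x) ∂ν := integral_exp_pos (hexpi hm hM)
  have hl : Tendsto (fun ε : ℝ => ∫ x, f x ∂μ - ε) (𝓝[>] 0) (𝓝 (∫ x, f x ∂μ - 0)) :=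
    tendsto_const_nhds.sub (tendsto_nhdsWithin_of_tendsto_nhds tendsto_id)
  have hr : Tendsto (fun ε : ℝ => c + Real.log (∫ x, Real.exp (f x) ∂ν + Real.exp M * ε)) (𝓝[>] 0)
      (𝓝 (c + Real.log (∫ x, Real.exp (f x) ∂ν + Real.exp M * 0))) := by
    refine tendsto_const_nhds.add (Tendsto.log ?_ (by simpa using hpos.ne'))
    exact tendsto_const_nhds.add
      ((tendsto_nhdsWithin_of_tendsto_nhds tendsto_id).const_mul _)
  rw [sub_zero] at hl
  rw [mul_zero, add_zero] at hr
  exact le_of_tendsto_of_tendsto hl hr (eventually_nhdsWithin_of_forall fun ε h => hε ε h)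

/-- If ν(A) = 0, testing with k · 1_A gives k μ(A) ≤ c for every k. -/
lemma absolutelyContinuous_of_integral_le {c : ℝ}
    (h : ∀ (f : S → ℝ) (M : ℝ), Measurable f → (∀ x, |f x| ≤ M) →
      ∫ x, f x ∂μ ≤ c + Real.log (∫ x, Real.exp (f x) ∂ν)) : μ ≪ ν := by
  refine Measure.AbsolutelyContinuous.mk fun A hA hνA => ?_
  have hk (k : ℕ) : k * μ.real A ≤ c := by
    have h1 := h (A.indicator fun _ => (k : ℝ)) k (measurable_const.indicator hA) fun x => by
      by_cases hx : x ∈ A <;> simp [hx]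
    have h2 : ∫ x, Real.exp (A.indicator (fun _ => (k : ℝ)) x) ∂ν = 1 := by
      have : (fun x => Real.exp (A.indicator (fun _ => (k : ℝ)) x)) =ᵐ[ν] fun _ => 1 := by
        filter_upwards [measure_eq_zero_iff_ae_notMem.1 hνA] with x hx
        simp [hx]
      rw [integral_congr_ae this]
      simp
    rw [h2, Real.log_one, add_zero, integral_indicator_const _ hA, smul_eq_mul, mul_comm] at h1
    exact h1
  by_contra hne
  have hpos : 0 < μ.real A := ENNReal.toReal_pos hne (measure_ne_top _ _)
  obtain ⟨k, hk'⟩ := exists_nat_gt (c / μ.real A)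
  rw [div_lt_iff₀ hpos] at hk'
  exact (hk k).not_gt hk'

/-- Converse of the entropy inequality: the optimal test function log dμ/dν is approached by
logarithms of the clamped density, and Fatou's lemma passes to the limit. -/
lemma klDiv_le_of_integral_le {c : ℝ}
    (h : ∀ (f : S → ℝ) (M : ℝ), Measurable f → (∀ x, |f x| ≤ M) →
      ∫ x, f x ∂μ ≤ c + Real.log (∫ x, Real.exp (f x) ∂ν)) : klDiv μ ν ≤ ENNReal.ofReal c := by
  have hac := absolutelyContinuous_of_integral_le h
  rw [klDiv_eq_lintegral_klFun_of_ac hac]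
  set p : S → ℝ := fun x => (μ.rnDeriv ν x).toReal with hp
  have hpm : Measurable p := (Measure.measurable_rnDeriv μ ν).ennreal_toReal
  have hp0 (x : S) : 0 ≤ p x := ENNReal.toReal_nonneg
  have hpi : Integrable p ν := Measure.integrable_toReal_rnDeriv
  -- Clamping the density to [e⁻ⁿ, eⁿ] bounds its logarithm by n and raises its ν-integral to at
  -- most 1 + e⁻ⁿ, so the logarithmic term of the test inequality is at most e⁻ⁿ.
  let q (n : ℕ) (x : S) : ℝ := max (Real.exp (-n)) (min (p x) (Real.exp n))
  have hqm (n : ℕ) : Measurable (q n) := by fun_prop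
  have hqpos (n : ℕ) (x : S) : 0 < q n x := (Real.exp_pos _).trans_le (le_max_left _ _)
  have hqle (n : ℕ) (x : S) : q n x ≤ Real.exp (-n) + p x :=
    max_le (by have := hp0 x; linarith) ((min_le_left _ _).trans (by
      have := Real.exp_pos (-(n : ℝ)); linarith))
  have hlogb (n : ℕ) (x : S) : |Real.log (q n x)| ≤ n := by
    rw [abs_le, ← Real.log_exp (-n), ← Real.log_exp n]
    refine ⟨?_, Real.log_le_log (hqpos n x) (max_le (by gcongr; simp) (min_le_right _ _))⟩
    rw [Real.log_exp n]
    exact Real.log_le_log (Real.exp_pos _) (le_max_left _ _)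
  have hlogi (n : ℕ) : Integrable (fun x => Real.log (q n x)) μ :=
    Integrable.of_bound (C := n) (Real.measurable_log.comp (hqm n)).aestronglyMeasurable
      (ae_of_all _ (hlogb n))
  have hbound (n : ℕ) : ∫ x, Real.log (q n x) ∂μ ≤ c + Real.exp (-n) := by
    refine (h _ n (Real.measurable_log.comp (hqm n)) (hlogb n)).trans ?_
    simp_rw [Function.comp_apply, Real.exp_log (hqpos n _)]
    gcongr
    have h1 : ∫ x, q n x ∂ν ≤ Real.exp (-n) + 1 := by
      have h2 : ∫ x, p x ∂ν = 1 := by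
        rw [Measure.integral_toReal_rnDeriv hac]
        simp
      calc ∫ x, q n x ∂ν ≤ ∫ x, (Real.exp (-n) + p x) ∂ν := by
            refine integral_mono_of_nonneg (ae_of_all _ fun x => (hqpos n x).le)
              ((integrable_const _).add hpi) (ae_of_all _ (hqle n))
        _ = _ := by rw [integral_add (integrable_const _) hpi, h2]; simp
    have hqi : Integrable (q n) ν := ((integrable_const _).add hpi).mono'
      (hqm n).aestronglyMeasurable (ae_of_all _ fun x => by
        rw [Real.norm_of_nonneg (hqpos n x).le]; exact hqle n x)
    have hq0 : 0 < ∫ x, q n x ∂ν := by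
      calc (0 : ℝ) < ∫ x, Real.exp (-n) ∂ν := by simp [Real.exp_pos]
        _ ≤ _ := integral_mono (integrable_const _) hqi fun x => le_max_left _ _
    have := Real.log_le_sub_one_of_pos hq0
    linarith
  -- The sign required by Fatou's lemma. Where p ≤ eⁿ the expression dominates `klFun (p x)`;
  -- elsewhere it is n p + 1 - p, which is nonnegative because n ≥ 1.
  have hnonneg (n : ℕ) (hn : 1 ≤ n) (x : S) : 0 ≤ p x * Real.log (q n x) + 1 - p x := by
    have hn' : (1 : ℝ) ≤ n := by exact_mod_cast hn
    by_cases h1 : p x ≤ Real.exp n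
    · have h2 : klFun (p x) ≤ p x * Real.log (q n x) + 1 - p x := by
        rw [klFun_apply]
        have : p x * Real.log (p x) ≤ p x * Real.log (q n x) := by
          rcases (hp0 x).eq_or_lt with h3 | h3
          · rw [← h3]; simp
          · refine mul_le_mul_of_nonneg_left (Real.log_le_log h3 ?_) h3.le
            simp only [q, min_eq_left h1]
            exact le_max_right _ _
        linarith
      exact (klFun_nonneg (hp0 x)).trans h2
    · have h3 : q n x = Real.exp n := by
        simp only [q, min_eq_right (le_of_not_ge h1)]
        exact max_eq_right (by gcongr; linarith)
      rw [h3, Real.log_exp]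
      nlinarith [hp0 x]
  have hlim (x : S) : Tendsto (fun n : ℕ => ENNReal.ofReal (p x * Real.log (q n x) + 1 - p x)) atTop
      (𝓝 (ENNReal.ofReal (klFun (p x)))) := by
    refine ENNReal.tendsto_ofReal ?_
    rcases (hp0 x).eq_or_lt with h3 | h3
    · simp [← h3, klFun_apply]
    · refine tendsto_const_nhds.congr' ?_
      filter_upwards [eventually_ge_atTop ⌈|Real.log (p x)|⌉₊] with n hn
      have h4 := abs_le.1 (Nat.ceil_le.1 hn)
      have h5 : q n x = p x := by
        have h6 : p x ≤ Real.exp n := (Real.log_le_iff_le_exp h3).1 h4.2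
        have h7 : Real.exp (-n) ≤ p x := (Real.le_log_iff_exp_le h3).1 h4.1
        simp only [q, min_eq_left h6, max_eq_right h7]
      rw [h5, klFun_apply]
  have hint (n : ℕ) (hn : 1 ≤ n) :
      ∫⁻ x, ENNReal.ofReal (p x * Real.log (q n x) + 1 - p x) ∂ν ≤
        ENNReal.ofReal (c + Real.exp (-n)) := by
    have h1 : Integrable (fun x => p x * Real.log (q n x)) ν := by
      have := (integrable_rnDeriv_smul_iff hac).2 (hlogi n)
      simpa [hp] using this
    have h4 : Integrable (fun x => p x * Real.log (q n x) + 1) ν := h1.add (integrable_const 1)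
    have h5 : Integrable (fun x => p x * Real.log (q n x) + 1 - p x) ν := h4.sub hpi
    rw [← ofReal_integral_eq_lintegral_ofReal h5
      (ae_of_all _ (hnonneg n hn))]
    refine ENNReal.ofReal_le_ofReal ((hbound n).trans' (le_of_eq ?_))
    have h2 : ∫ x, p x ∂ν = 1 := by
      rw [Measure.integral_toReal_rnDeriv hac]
      simp
    have h3 : ∫ x, p x * Real.log (q n x) ∂ν = ∫ x, Real.log (q n x) ∂μ := by
      have := integral_rnDeriv_smul (f := fun x => Real.log (q n x)) hac
      simpa [hp] using this
    rw [integral_sub h4 hpi, integral_add h1 (integrable_const 1), h2, h3]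
    simp
  calc ∫⁻ x, ENNReal.ofReal (klFun (p x)) ∂ν
      = ∫⁻ x, liminf (fun n : ℕ => ENNReal.ofReal (p x * Real.log (q n x) + 1 - p x)) atTop ∂ν :=
        lintegral_congr fun x => (hlim x).liminf_eq.symm
    _ ≤ liminf (fun n : ℕ => ∫⁻ x, ENNReal.ofReal (p x * Real.log (q n x) + 1 - p x) ∂ν) atTop :=
        lintegral_liminf_le fun n => by
          have := Real.measurable_log.comp (hqm n)
          simp only [Function.comp_def] at this
          fun_prop
    _ ≤ liminf (fun n : ℕ => ENNReal.ofReal (c + Real.exp (-n))) atTop := by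
        refine liminf_le_liminf ?_
        filter_upwards [eventually_ge_atTop 1] with n hn using hint n hn
    _ = ENNReal.ofReal c := by
        refine Tendsto.liminf_eq (ENNReal.tendsto_ofReal ?_)
        have : Tendsto (fun n : ℕ => Real.exp (-(n : ℝ))) atTop (𝓝 0) :=
          Real.tendsto_exp_neg_atTop_nhds_zero.comp tendsto_natCast_atTop_atTop
        simpa using this.const_add c

end Entropy

/-- Lower semicontinuity of the relative entropy for the weak convergence of its first argument. -/
theorem klDiv_le_of_tendsto {S : Type*} [MetricSpace S] [MeasurableSpace S] [BorelSpace S]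
    {ν : Measure S} [IsProbabilityMeasure ν] {μ : ℕ → ProbabilityMeasure S}
    {μ' : ProbabilityMeasure S} (h : Tendsto μ atTop (𝓝 μ')) {c : ℕ → ℝ} {c' : ℝ}
    (hc0 : ∀ n, 0 ≤ c n) (hc : ∀ n, klDiv (μ n : Measure S) ν ≤ ENNReal.ofReal (c n))
    (hlim : Tendsto c atTop (𝓝 c')) : klDiv (μ' : Measure S) ν ≤ ENNReal.ofReal c' := by
  -- The entropy inequality is taken to the limit for bounded continuous functions, where weak
  -- convergence suffices, and only then extended to measurable ones.
  refine klDiv_le_of_integral_le fun f M hm hM =>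
    integral_le_add_log_integral_exp_of_bounded (fun g => ?_) hm hM
  have h1 := ProbabilityMeasure.tendsto_iff_forall_integral_tendsto.1 h g
  refine le_of_tendsto_of_tendsto' h1 (hlim.add_const _) fun n => ?_
  refine integral_le_add_log_integral_exp (hc0 n) (hc n) (g.integrable _) ?_
  refine Integrable.of_bound (C := Real.exp ‖g‖) ?_ (ae_of_all _ fun x => ?_)
  · exact (Real.continuous_exp.comp g.continuous).aestronglyMeasurable
  · rw [Real.norm_eq_abs, Real.abs_exp]
    exact Real.exp_le_exp.2 ((le_abs_self _).trans (g.norm_coe_le_norm x))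

/-- Measures with bounded entropy with respect to a fixed measure are uniformly absolutely
continuous. -/
lemma exists_measure_le_of_klDiv_le {S : Type*} {mS : MeasurableSpace S} (ν : Measure S)
    [IsProbabilityMeasure ν] {c : ℝ} (hc : 0 ≤ c) {ε : ℝ} (hε : 0 < ε) :
    ∃ δ > 0, ∀ μ : Measure S, IsProbabilityMeasure μ → klDiv μ ν ≤ ENNReal.ofReal c →
      ∀ A, MeasurableSet A → ν.real A ≤ δ → μ.real A ≤ ε := by
  -- Testing with k · 1_A gives k μ(A) ≤ c + log(1 + eᵏ ν(A)), which is at most c + 1 once ν(A) ≤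
  -- e⁻ᵏ.
  set k : ℝ := (c + 1) / ε with hk
  have hk0 : 0 < k := by positivity
  refine ⟨Real.exp (-k), Real.exp_pos _, fun μ _ h A hA hνA => ?_⟩
  have hb (x : S) : |A.indicator (fun _ => k) x| ≤ k := by
    by_cases hx : x ∈ A <;> simp [hx, abs_of_pos hk0, hk0.le]
  have hAm : Measurable (A.indicator fun _ => k) := measurable_const.indicator hA
  have hei : Integrable (fun x => Real.exp (A.indicator (fun _ => k) x)) ν := by
    refine Integrable.of_bound (C := Real.exp k) (by fun_prop) (ae_of_all _ fun x => ?_)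
    rw [Real.norm_eq_abs, Real.abs_exp]
    exact Real.exp_le_exp.2 ((le_abs_self _).trans (hb x))
  have h1 := integral_le_add_log_integral_exp hc h
    (Integrable.of_bound (C := k) hAm.aestronglyMeasurable (ae_of_all _ hb)) hei
  rw [integral_indicator_const _ hA, smul_eq_mul] at h1
  have h2 : ∫ x, Real.exp (A.indicator (fun _ => k) x) ∂ν ≤ 1 + Real.exp k * ν.real A := by
    calc ∫ x, Real.exp (A.indicator (fun _ => k) x) ∂ν
        ≤ ∫ x, (1 + A.indicator (fun _ => Real.exp k) x) ∂ν := by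
          refine integral_mono hei ((integrable_const _).add
            ((integrable_const _).indicator hA)) fun x => ?_
          by_cases hx : x ∈ A <;> simp [hx]
      _ = _ := by
          rw [integral_add (integrable_const _) ((integrable_const _).indicator hA),
            integral_indicator_const _ hA]
          simp [mul_comm]
  have h3 : Real.exp k * ν.real A ≤ 1 := by
    calc _ ≤ Real.exp k * Real.exp (-k) := by gcongr
      _ = 1 := by rw [← Real.exp_add]; simp
  have h4 := Real.log_le_sub_one_of_pos (integral_exp_pos hei)
  have h5 : μ.real A * k ≤ c + 1 := by linarith
  rw [hk, mul_div_assoc', div_le_iff₀ hε] at h5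
  nlinarith

/-! ### Weak convergence with unbounded or varying integrands. -/

section WeakConvergence

lemma integrable_sq_and_integral_le {S : Type*} {mS : MeasurableSpace S} {μ : Measure S}
    [IsProbabilityMeasure μ] {f : S → ℝ} (hf : Measurable f) {M : ℝ} (hM : 0 ≤ M)
    (h : ∫⁻ x, ENNReal.ofReal (f x ^ 2) ∂μ ≤ ENNReal.ofReal M) :
    Integrable (fun x => f x ^ 2) μ ∧ ∫ x, f x ^ 2 ∂μ ≤ M := by
  have hi : Integrable (fun x => f x ^ 2) μ := by
    refine (lintegral_ofReal_ne_top_iff_integrable (by fun_prop)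
      (ae_of_all _ fun x => sq_nonneg _)).1 (h.trans_lt ENNReal.ofReal_lt_top).ne
  refine ⟨hi, ?_⟩
  rw [← ofReal_integral_eq_lintegral_ofReal hi (ae_of_all _ fun x => sq_nonneg _)] at h
  exact (ENNReal.ofReal_le_ofReal_iff hM).1 h

lemma integrable_of_integrable_sq {S : Type*} {mS : MeasurableSpace S} {μ : Measure S}
    [IsProbabilityMeasure μ] {f : S → ℝ} (hf : Measurable f) (h : Integrable (fun x => f x ^ 2) μ) :
    Integrable f μ :=
  ((integrable_const 1).add h).mono' hf.aestronglyMeasurable (ae_of_all _ fun x => by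
    rw [Real.norm_eq_abs]
    change |f x| ≤ 1 + f x ^ 2
    rw [← sq_abs]
    nlinarith [sq_nonneg (|f x| - 1), abs_nonneg (f x)])

lemma abs_sub_max_min_le (a : ℝ) {k : ℝ} (hk : 0 < k) :
    |a - max (-k) (min k a)| ≤ a ^ 2 / k := by
  rw [le_div_iff₀ hk]
  rcases le_total k a with h | h
  · rw [min_eq_left h, max_eq_right (by linarith), abs_of_nonneg (by linarith)]
    nlinarith
  · rw [min_eq_right h]
    rcases le_total (-k) a with h' | h'
    · rw [max_eq_right h']
      simp [sq_nonneg]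
    · rw [max_eq_left h', abs_of_nonpos (by linarith)]
      nlinarith

variable {S : Type*} [TopologicalSpace S] [MeasurableSpace S] [OpensMeasurableSpace S]
  {μ : ℕ → ProbabilityMeasure S} {μ' : ProbabilityMeasure S}

/-- Each truncation of f at height k is a bounded continuous test function; monotone convergence in
k gives the rest. -/
lemma lintegral_le_of_tendsto (h : Tendsto μ atTop (𝓝 μ')) {f : S → ℝ} (hf : Continuous f)
    (hf0 : ∀ x, 0 ≤ f x) {M : ℝ≥0∞}
    (hM : ∀ n, ∫⁻ x, ENNReal.ofReal (f x) ∂(μ n : Measure S) ≤ M) :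
    ∫⁻ x, ENNReal.ofReal (f x) ∂(μ' : Measure S) ≤ M := by
  have hk (k : ℕ) : ∫⁻ x, ENNReal.ofReal (min (f x) k) ∂(μ' : Measure S) ≤ M := by
    let g : S →ᵇ ℝ≥0 := BoundedContinuousFunction.mkOfBound
      ⟨fun x => (min (f x) k).toNNReal, by fun_prop⟩ k fun x y => by
        have hx (x : S) : (((min (f x) k).toNNReal : ℝ≥0) : ℝ) ∈ Icc (0 : ℝ) k := by
          rw [Real.coe_toNNReal _ (le_min (hf0 x) k.cast_nonneg)]
          exact ⟨le_min (hf0 x) k.cast_nonneg, min_le_right _ _⟩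
        rw [NNReal.dist_eq]
        exact (Real.dist_le_of_mem_Icc (hx x) (hx y)).trans_eq (sub_zero _)
    have h1 := ProbabilityMeasure.tendsto_iff_forall_lintegral_tendsto.1 h g
    refine le_of_tendsto' h1 fun n => (lintegral_mono fun x => ?_).trans (hM n)
    exact ENNReal.ofReal_le_ofReal (min_le_left _ _)
  have hlim : Tendsto (fun n : ℕ => ∫⁻ x, ENNReal.ofReal (min (f x) n) ∂(μ' : Measure S)) atTop
      (𝓝 (∫⁻ x, ENNReal.ofReal (f x) ∂(μ' : Measure S))) := by
    refine lintegral_tendsto_of_tendsto_of_monotone (fun n => by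
        have := hf.measurable
        fun_prop)
      (ae_of_all _ fun x m n hmn => ?_) (ae_of_all _ fun x => ?_)
    · dsimp only
      gcongr
    · refine ENNReal.tendsto_ofReal (tendsto_const_nhds.congr' ?_)
      filter_upwards [eventually_ge_atTop ⌈f x⌉₊] with n hn
      exact (min_eq_left (Nat.ceil_le.1 hn)).symm
  exact le_of_tendsto' hlim hk

/-- Weak convergence with bounded second moments of `f` implies the convergence of the integrals
of `f`. -/
lemma tendsto_integral_of_sq_le (h : Tendsto μ atTop (𝓝 μ')) {f : S → ℝ} (hf : Continuous f)
    {M : ℝ} (hM0 : 0 ≤ M)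
    (hM : ∀ n, ∫⁻ x, ENNReal.ofReal (f x ^ 2) ∂(μ n : Measure S) ≤ ENNReal.ofReal M) :
    Tendsto (fun n => ∫ x, f x ∂(μ n : Measure S)) atTop (𝓝 (∫ x, f x ∂(μ' : Measure S))) := by
  have hM' := lintegral_le_of_tendsto h (hf.pow 2) (fun x => sq_nonneg _) hM
  have key (ν : ProbabilityMeasure S)
      (hν : ∫⁻ x, ENNReal.ofReal (f x ^ 2) ∂(ν : Measure S) ≤ ENNReal.ofReal M) {k : ℝ}
      (hk : 0 < k) : dist (∫ x, f x ∂(ν : Measure S))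
        (∫ x, max (-k) (min k (f x)) ∂(ν : Measure S)) ≤ M / k := by
    obtain ⟨h1, h2⟩ := integrable_sq_and_integral_le hf.measurable hM0 hν
    have h3 := integrable_of_integrable_sq hf.measurable h1
    have h4 : Integrable (fun x => max (-k) (min k (f x))) (ν : Measure S) :=
      (integrable_const (-k)).sup ((integrable_const k).inf h3)
    rw [Real.dist_eq, ← integral_sub h3 h4]
    refine (abs_integral_le_integral_abs).trans ?_
    calc ∫ x, |f x - max (-k) (min k (f x))| ∂(ν : Measure S) ≤ ∫ x, f x ^ 2 / k ∂(ν : Measure S) :=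
          integral_mono (h3.sub h4).abs (h1.div_const _) fun x => abs_sub_max_min_le _ hk
      _ ≤ M / k := by rw [integral_div]; gcongr
  rw [Metric.tendsto_atTop]
  intro ε hε
  -- Truncating at level k costs at most M/k < ε/3 under each measure; M + 1 keeps k positive when M
  -- = 0.
  have hk : 0 < 3 * (M + 1) / ε := by positivity
  set k : ℝ := 3 * (M + 1) / ε with hkdef
  have hMk : M / k < ε / 3 := by
    rw [hkdef, div_div_eq_mul_div, div_lt_div_iff₀ (by positivity) (by norm_num)]
    nlinarith
  let g : S →ᵇ ℝ := BoundedContinuousFunction.ofNormedAddCommGroup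
    (fun x => max (-k) (min k (f x))) (by fun_prop) k fun x =>
      abs_le.2 ⟨le_max_left _ _, max_le (by linarith) (min_le_left _ _)⟩
  have h1 := ProbabilityMeasure.tendsto_iff_forall_integral_tendsto.1 h g
  obtain ⟨N, hN⟩ := Metric.tendsto_atTop.1 h1 (ε / 3) (by positivity)
  refine ⟨N, fun n hn => ?_⟩
  have h2 := hN n hn
  have h3 := key (μ n) (hM n) hk
  have h4 := key μ' hM' hk
  rw [dist_comm] at h4
  have h5 := dist_triangle4 (∫ x, f x ∂(μ n : Measure S)) (∫ x, g x ∂(μ n : Measure S))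
    (∫ x, g x ∂(μ' : Measure S)) (∫ x, f x ∂(μ' : Measure S))
  change dist _ (∫ x, g x ∂(μ n : Measure S)) ≤ _ at h3
  change dist (∫ x, g x ∂(μ' : Measure S)) _ ≤ _ at h4
  linarith

end WeakConvergence

section EquiLipschitz

variable {S S' : Type*} [PseudoMetricSpace S] [MeasurableSpace S] [BorelSpace S]
  [PseudoMetricSpace S'] [MeasurableSpace S'] [BorelSpace S']
  {μ : ℕ → ProbabilityMeasure S} {μ' : ProbabilityMeasure S}

/-- The tail suprema H k of |F n - F'| are bounded, Lipschitz with constant 2K, and tend to zero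
pointwise. For fixed k, H k is one continuous test function that dominates |F n - F'| for all n ≥ k,
and its limit integral is small by dominated convergence. -/
lemma tendsto_integral_of_lipschitz (h : Tendsto μ atTop (𝓝 μ')) {F : ℕ → S → ℝ} {F' : S → ℝ}
    {K : ℝ≥0} {C : ℝ} (hF : ∀ n, LipschitzWith K (F n)) (hF' : LipschitzWith K F')
    (hC : ∀ n x, |F n x| ≤ C) (hC' : ∀ x, |F' x| ≤ C)
    (hlim : ∀ x, Tendsto (fun n => F n x) atTop (𝓝 (F' x))) :
    Tendsto (fun n => ∫ x, F n x ∂(μ n : Measure S)) atTop (𝓝 (∫ x, F' x ∂(μ' : Measure S))) := by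
  have hi (ν : ProbabilityMeasure S) {g : S → ℝ} (hg : Continuous g) {C : ℝ} (hg' : ∀ x, |g x| ≤ C) :
      Integrable g (ν : Measure S) :=
    Integrable.of_bound hg.aestronglyMeasurable C (ae_of_all _ hg')
  have hweak {g : S → ℝ} (hg : Continuous g) {C : ℝ} (hg' : ∀ x, |g x| ≤ C) :
      Tendsto (fun n => ∫ x, g x ∂(μ n : Measure S)) atTop (𝓝 (∫ x, g x ∂(μ' : Measure S))) :=
    ProbabilityMeasure.tendsto_iff_forall_integral_tendsto.1 h
      (BoundedContinuousFunction.ofNormedAddCommGroup g hg C hg')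
  have hd (n : ℕ) (x : S) : |F n x - F' x| ≤ 2 * C := by
    have := abs_sub (F n x) (F' x)
    linarith [hC n x, hC' x]
  let H (k : ℕ) (x : S) : ℝ := ⨆ m, |F (k + m) x - F' x|
  have hbdd (k : ℕ) (x : S) : BddAbove (range fun m => |F (k + m) x - F' x|) :=
    ⟨2 * C, by rintro _ ⟨m, rfl⟩; exact hd _ x⟩
  have hH0 (k : ℕ) (x : S) : 0 ≤ H k x := Real.iSup_nonneg fun _ => abs_nonneg _
  have hHC (k : ℕ) (x : S) : |H k x| ≤ 2 * C := by
    rw [abs_of_nonneg (hH0 k x)]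
    exact ciSup_le fun m => hd _ x
  have hHlip (k : ℕ) : LipschitzWith (2 * K) (H k) := by
    refine LipschitzWith.of_le_add_mul _ fun x y => ciSup_le fun m => ?_
    have h1 := (hF (k + m)).dist_le_mul x y
    have h2 := hF'.dist_le_mul x y
    have h3 : |F (k + m) y - F' y| ≤ H k y := le_ciSup (hbdd k y) m
    rw [Real.dist_eq] at h1 h2
    have h4 : |F (k + m) x - F' x| ≤
        |F (k + m) x - F (k + m) y| + |F (k + m) y - F' y| + |F' x - F' y| := by
      have h5 := abs_sub_le (F (k + m) x) (F (k + m) y) (F' x)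
      have h6 := abs_sub_le (F (k + m) y) (F' y) (F' x)
      rw [abs_sub_comm (F' y) (F' x)] at h6
      linarith
    push_cast
    linarith
  have hHlim (x : S) : Tendsto (fun k => H k x) atTop (𝓝 0) := by
    rw [Metric.tendsto_atTop]
    intro ε hε
    obtain ⟨N, hN⟩ := Metric.tendsto_atTop.1 (hlim x) (ε / 2) (by positivity)
    refine ⟨N, fun k hk => ?_⟩
    rw [Real.dist_eq, sub_zero, abs_of_nonneg (hH0 k x)]
    refine (ciSup_le fun m => ?_ : H k x ≤ ε / 2).trans_lt (by linarith)
    have := hN (k + m) (by omega)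
    rw [Real.dist_eq] at this
    exact this.le
  have hHint : Tendsto (fun k => ∫ x, H k x ∂(μ' : Measure S)) atTop (𝓝 0) := by
    have := tendsto_integral_of_dominated_convergence (μ := (μ' : Measure S)) (F := H)
      (f := fun _ => 0) (fun _ => 2 * C) (fun k => (hHlip k).continuous.aestronglyMeasurable)
      (integrable_const _) (fun k => ae_of_all _ (hHC k)) (ae_of_all _ hHlim)
    simpa using this
  have hdiff : Tendsto (fun n => ∫ x, F n x ∂(μ n : Measure S) - ∫ x, F' x ∂(μ n : Measure S)) atTop
      (𝓝 0) := by
    rw [Metric.tendsto_atTop]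
    intro ε hε
    obtain ⟨k, hk⟩ := (hHint.eventually_lt_const hε).exists
    obtain ⟨N, hN⟩ := eventually_atTop.1
      ((hweak (hHlip k).continuous (hHC k)).eventually_lt_const hk)
    refine ⟨max k N, fun n hn => ?_⟩
    have hFi := hi (μ n) (hF n).continuous (hC n)
    have hFi' := hi (μ n) hF'.continuous hC'
    rw [Real.dist_eq, sub_zero, ← integral_sub hFi hFi']
    refine ((abs_integral_le_integral_abs).trans ?_).trans_lt (hN n (le_of_max_le_right hn))
    refine integral_mono (hFi.sub hFi').abs (hi (μ n) (hHlip k).continuous (hHC k)) fun x => ?_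
    have := le_ciSup (hbdd k x) (n - k)
    simpa [Nat.add_sub_cancel' (le_of_max_le_left hn)] using this
  simpa using hdiff.add (hweak hF'.continuous hC')

/-- Pushforwards under uniformly Lipschitz maps converging pointwise. -/
lemma tendsto_map_of_lipschitz (h : Tendsto μ atTop (𝓝 μ')) {g : ℕ → S → S'} {g' : S → S'}
    {K : ℝ≥0} (hg : ∀ n, LipschitzWith K (g n)) (hg' : LipschitzWith K g')
    (hlim : ∀ x, Tendsto (fun n => g n x) atTop (𝓝 (g' x))) :
    Tendsto (fun n => (μ n).map (hg n).continuous.aemeasurable) atTop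
      (𝓝 (μ'.map hg'.continuous.aemeasurable)) := by
  refine tendsto_iff_forall_lipschitz_integral_tendsto.2 ?_
  rintro f ⟨C, hC⟩ ⟨K', hf⟩
  obtain ⟨x₀⟩ : Nonempty S := (μ' : Measure S).nonempty_of_neZero
  have hfb (y : S') : |f y| ≤ |f (g' x₀)| + C := by
    have := hC y (g' x₀)
    rw [Real.dist_eq] at this
    have h2 := abs_sub_abs_le_abs_sub (f y) (f (g' x₀))
    linarith
  have := tendsto_integral_of_lipschitz h (F := fun n x => f (g n x)) (F' := fun x => f (g' x))
    (fun n => hf.comp (hg n)) (hf.comp hg') (fun n x => hfb _) (fun x => hfb _)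
    fun x => (hf.continuous.tendsto _).comp (hlim x)
  simp only [ProbabilityMeasure.toMeasure_map]
  rw [integral_map hg'.continuous.aemeasurable hf.continuous.aestronglyMeasurable]
  refine this.congr fun n => ?_
  rw [integral_map (hg n).continuous.aemeasurable hf.continuous.aestronglyMeasurable]

end EquiLipschitz

/-! ### Moment bounds from the entropy. -/

section Moments

variable {d : ℕ} {T L : ℝ≥0} {W : E d → ℝ}

/-- Path laws with bounded entropy with respect to the law of the noise have bounded second
moments. -/
lemma exists_lintegral_sq_le {Q₀ : Measure (PathSpace d T)} [IsProbabilityMeasure Q₀]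
    {κ : ℝ} (hκ : 0 < κ)
    (hexp : Integrable (fun w => Real.exp (κ * ‖w - ContinuousMap.const _ (X 0 w)‖ ^ 2)) Q₀)
    {μ₀ : Measure (E d)} (hμ₀ : MemP2 μ₀) {c : ℝ} (hc : 0 ≤ c) :
    ∃ M : ℝ, 0 ≤ M ∧ ∀ Q : Measure (PathSpace d T), IsProbabilityMeasure Q →
      klDiv Q Q₀ ≤ ENNReal.ofReal c → Q.map (X 0) = μ₀ →
        ∫⁻ w, ENNReal.ofReal (‖w‖ ^ 2) ∂Q ≤ ENNReal.ofReal M := by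
  set A : ℝ := ∫ x, ‖x‖ ^ 2 ∂μ₀ with hA
  have hA0 : 0 ≤ A := integral_nonneg fun _ => by positivity
  set D : ℝ := c + Real.log
    (∫ w, Real.exp (κ * ‖w - ContinuousMap.const _ (X 0 w)‖ ^ 2) ∂Q₀) with hD
  have h1 := continuous_X (d := d) (T := T) 0
  have h2 : Continuous fun x : E d => ContinuousMap.const (Icc (0 : ℝ) T) x :=
    ContinuousMap.continuous_const'
  have hcont : Continuous fun w : PathSpace d T =>
    κ * ‖w - ContinuousMap.const _ (X 0 w)‖ ^ 2 := by fun_prop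
  refine ⟨2 * A + 2 / κ * max D 0, by positivity, fun Q _ hQ hQ0 => ?_⟩
  -- The initial value is controlled by the second moment of μ₀, and the displacement from it by the
  -- entropy inequality applied to κ times its squared norm.
  have hle (w : PathSpace d T) : ‖w‖ ^ 2 ≤ 2 * ‖X 0 w‖ ^ 2 +
      2 / κ * (κ * ‖w - ContinuousMap.const _ (X 0 w)‖ ^ 2) := by
    have h3 : ‖w‖ ≤ ‖X 0 w‖ + ‖w - ContinuousMap.const _ (X 0 w)‖ := by
      have h4 : ‖ContinuousMap.const (Icc (0 : ℝ) T) (X 0 w)‖ ≤ ‖X 0 w‖ :=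
        (ContinuousMap.norm_le_of_nonempty _).2 fun t => le_rfl
      have h5 := norm_add_le (ContinuousMap.const (Icc (0 : ℝ) T) (X 0 w))
        (w - ContinuousMap.const _ (X 0 w))
      rw [add_sub_cancel] at h5
      linarith
    have h6 : 2 / κ * (κ * ‖w - ContinuousMap.const _ (X 0 w)‖ ^ 2) =
      2 * ‖w - ContinuousMap.const _ (X 0 w)‖ ^ 2 := by field_simp
    rw [h6]
    nlinarith [norm_nonneg w, sq_nonneg (‖X 0 w‖ - ‖w - ContinuousMap.const _ (X 0 w)‖)]
  have hfirst : ∫⁻ w, ENNReal.ofReal (‖X 0 w‖ ^ 2) ∂Q = ENNReal.ofReal A := by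
    rw [hA, ofReal_integral_eq_lintegral_ofReal hμ₀.2 (ae_of_all _ fun _ => by positivity), ← hQ0,
      lintegral_map (by fun_prop) h1.measurable]
  have hsecond := lintegral_le_add_log_integral_exp hc hQ hcont.measurable
    (fun w => by positivity) hexp
  calc ∫⁻ w, ENNReal.ofReal (‖w‖ ^ 2) ∂Q
      ≤ ∫⁻ w, (ENNReal.ofReal 2 * ENNReal.ofReal (‖X 0 w‖ ^ 2) + ENNReal.ofReal (2 / κ) *
          ENNReal.ofReal (κ * ‖w - ContinuousMap.const _ (X 0 w)‖ ^ 2)) ∂Q := by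
        refine lintegral_mono fun w => ?_
        rw [← ENNReal.ofReal_mul (by positivity), ← ENNReal.ofReal_mul (by positivity),
          ← ENNReal.ofReal_add (by positivity) (by positivity)]
        exact ENNReal.ofReal_le_ofReal (hle w)
    _ = ENNReal.ofReal 2 * ∫⁻ w, ENNReal.ofReal (‖X 0 w‖ ^ 2) ∂Q + ENNReal.ofReal (2 / κ) *
          ∫⁻ w, ENNReal.ofReal (κ * ‖w - ContinuousMap.const _ (X 0 w)‖ ^ 2) ∂Q := by
        rw [lintegral_add_left, lintegral_const_mul, lintegral_const_mul]
        · exact hcont.measurable.ennreal_ofReal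
        · exact (h1.norm.pow 2).measurable.ennreal_ofReal
        · exact (h1.norm.pow 2).measurable.ennreal_ofReal.const_mul _
    _ ≤ ENNReal.ofReal 2 * ENNReal.ofReal A + ENNReal.ofReal (2 / κ) * ENNReal.ofReal (max D 0) := by
        rw [hfirst]
        gcongr
        exact hsecond.trans (ENNReal.ofReal_le_ofReal (le_max_left _ _))
    _ = _ := by
        rw [← ENNReal.ofReal_mul (by positivity), ← ENNReal.ofReal_mul (by positivity),
          ← ENNReal.ofReal_add (by positivity) (by positivity)]

lemma Drift.integrable_norm_noise (b : Drift d L) {P : Measure (PathSpace d T)} (hP : MemP1 P) :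
    Integrable (fun ω => ‖b.noise ω‖) P := by
  have := hP.1
  refine ((integrable_const ‖b.noise (0 : PathSpace d T)‖).add
    (hP.2.const_mul (1 + L * T : ℝ))).mono' b.continuous_noise.norm.aestronglyMeasurable
    (ae_of_all _ fun ω => ?_)
  have h1 := b.norm_noise_sub_le ω 0
  have h2 := norm_le_norm_add_norm_sub' (b.noise ω) (b.noise 0)
  rw [sub_zero] at h1
  rw [norm_norm]
  change _ ≤ ‖b.noise (0 : PathSpace d T)‖ + (1 + L * T : ℝ) * ‖ω‖
  linarith

lemma continuous_integral_norm_X {P : Measure (PathSpace d T)} (hP : MemP1 P) :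
    Continuous fun t => ∫ ω, ‖X t ω‖ ∂P :=
  continuous_of_dominated (fun t => (continuous_X t).norm.aestronglyMeasurable)
    (fun t => ae_of_all _ fun ω => by rw [norm_norm]; exact norm_X_le t ω) hP.2
    (ae_of_all _ fun ω => (continuous_X_time ω).norm)

lemma continuous_X_uncurry : Continuous fun p : ℝ × PathSpace d T => X p.1 p.2 := by
  have h : Continuous fun p : ℝ × PathSpace d T => (projIcc (0 : ℝ) T T.2 p.1, p.2) :=
    (continuous_projIcc.comp continuous_fst).prodMk continuous_snd
  exact (continuous_eval (F := PathSpace d T)).comp (h.snd.prodMk h.fst)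

lemma intervalIntegral_integral_norm_X {P : Measure (PathSpace d T)} (hP : MemP1 P) {t : ℝ} :
    ∫ ω, (∫ s in (0 : ℝ)..t, ‖X s ω‖) ∂P = ∫ s in (0 : ℝ)..t, ∫ ω, ‖X s ω‖ ∂P := by
  have := hP.1
  have : IsFiniteMeasure ((volume : Measure ℝ).restrict (uIoc 0 t)) := ⟨by simp [uIoc]⟩
  refine (intervalIntegral_integral_swap ?_).symm
  refine (hP.2.comp_snd (volume.restrict (uIoc 0 t))).mono'
    continuous_X_uncurry.norm.aestronglyMeasurable (ae_of_all _ fun p => ?_)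
  simpa [Function.uncurry] using norm_X_le p.1 p.2

/-- The drift depends on P itself, but at the origin it is at most L E|X_t|. Taking expectations
therefore closes the estimate, and Grönwall applies with 2L: one L from the state variable, one from
the averaged law. -/
lemma integral_norm_X_le (hL : ∀ x y, ‖gradient W x - gradient W y‖ ≤ L * ‖x - y‖)
    (h0 : gradient W 0 = 0) {P : Measure (PathSpace d T)} (hP : MemP1 P) {t : ℝ}
    (ht : t ∈ Icc (0 : ℝ) T) :
    ∫ ω, ‖X t ω‖ ∂P ≤
      (∫ ω, ‖(meanFieldDrift hL h0 hP).noise ω‖ ∂P) * Real.exp (2 * L * T) := by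
  have := hP.1
  set b := meanFieldDrift hL h0 hP
  have hm := continuous_integral_norm_X hP
  have hn := b.integrable_norm_noise hP
  have hgron := le_mul_exp_of_le_add_integral hm (a := ∫ ω, ‖b.noise ω‖ ∂P) (L := 2 * L)
    (t₀ := T) (by positivity) (fun t ht => ?_) ht
  · refine hgron.trans (mul_le_mul_of_nonneg_left (Real.exp_le_exp.2 ?_)
      (integral_nonneg fun _ => norm_nonneg _))
    exact mul_le_mul_of_nonneg_left ht.2 (by positivity)
  have hi : Integrable (fun ω => ∫ s in (0 : ℝ)..t, ‖X s ω‖) P := by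
    refine (hP.2.const_mul t).mono' ?_ (ae_of_all _ fun ω => ?_)
    · refine Continuous.aestronglyMeasurable ?_
      exact intervalIntegral.continuous_parametric_intervalIntegral_of_continuous'
        (f := fun ω s => ‖X s ω‖) (continuous_X_uncurry.comp continuous_swap).norm 0 t
    · have := intervalIntegral.norm_integral_le_of_norm_le_const (a := 0) (b := t) (C := ‖ω‖)
        (f := fun s => ‖X s ω‖) fun s _ => by rw [norm_norm]; exact norm_X_le s ω
      rw [sub_zero, abs_of_nonneg ht.1] at this
      linarith
  have hpt (ω : PathSpace d T) : ‖X t ω‖ ≤ ‖b.noise ω‖ + L * (∫ s in (0 : ℝ)..t, ‖X s ω‖) +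
      L * ∫ s in (0 : ℝ)..t, ∫ ω, ‖X s ω‖ ∂P := by
    refine (b.norm_X_le_add_integral ht ω).trans ?_
    have hc1 : Continuous fun s => ‖X s ω‖ := (continuous_X_time ω).norm
    rw [add_assoc, ← mul_add, ← intervalIntegral.integral_add (hc1.intervalIntegrable _ _)
      (hm.intervalIntegrable _ _), ← intervalIntegral.integral_const_mul]
    gcongr
    refine intervalIntegral.integral_mono_on ht.1
      (((hc1.const_mul _).add (b.continuous_time 0).norm).intervalIntegrable _ _)
      (((hc1.add hm).const_mul _).intervalIntegrable _ _) fun s _ => ?_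
    have := norm_meanFieldDrift_zero_le hL h0 hP s
    rw [mul_add]
    exact add_le_add le_rfl this
  calc ∫ ω, ‖X t ω‖ ∂P ≤ ∫ ω, (‖b.noise ω‖ + L * (∫ s in (0 : ℝ)..t, ‖X s ω‖) +
        L * ∫ s in (0 : ℝ)..t, ∫ ω, ‖X s ω‖ ∂P) ∂P :=
        integral_mono (hP.integrable_norm_X t)
          ((hn.add (hi.const_mul _)).add (integrable_const _)) hpt
    _ = _ := by
        have h1 : Integrable (fun ω => ‖b.noise ω‖ + L * ∫ s in (0 : ℝ)..t, ‖X s ω‖) P :=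
          hn.add (hi.const_mul _)
        rw [integral_add h1 (integrable_const _), integral_add hn (hi.const_mul _),
          integral_const_mul, intervalIntegral_integral_norm_X hP]
        simp
        ring

end Moments

/-! ### Uniform bounds and tightness under a bounded cost. -/

section Compactness

variable {d : ℕ} {T L : ℝ≥0}

/-- Arzelà–Ascoli: as a set of functions it is the intersection of a compact product of balls with a
pointwise closed equicontinuous set. -/
lemma isCompact_setOf_lipschitz (d : ℕ) (T K : ℝ≥0) (C : ℝ) :
    IsCompact {w : PathSpace d T | LipschitzWith K w ∧ ∀ t, w t ∈ Metric.closedBall (0 : E d) C} := by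
  refine ArzelaAscoli.isCompact_of_equicontinuous _ ?_ ?_
  · have himage : ContinuousMap.toFun '' {w : PathSpace d T | LipschitzWith K w ∧
        ∀ t, w t ∈ Metric.closedBall (0 : E d) C} =
        (univ.pi fun _ => Metric.closedBall (0 : E d) C) ∩ {f | LipschitzWith K f} := by
      ext f
      constructor
      · rintro ⟨w, ⟨h1, h2⟩, rfl⟩
        exact ⟨fun t _ => h2 t, h1⟩
      · rintro ⟨h1, h2⟩
        exact ⟨⟨f, h2.continuous⟩, ⟨h2, fun t => h1 t (mem_univ t)⟩, rfl⟩
    rw [himage]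
    exact (isCompact_univ_pi fun _ => isCompact_closedBall _ _).inter_right
      (isClosed_setOfPred_lipschitzWith K)
  · exact (LipschitzWith.uniformEquicontinuous _ K fun w => w.2.1).equicontinuous

end Compactness

section UniformBounds

lemma lintegral_sq_le_of_abs_le {S : Type*} {mS : MeasurableSpace S} {μ : Measure S}
    [IsProbabilityMeasure μ] {f g : S → ℝ} (hg : Measurable g) {M a k : ℝ} (hM : 0 ≤ M)
    (h : ∫⁻ x, ENNReal.ofReal (g x ^ 2) ∂μ ≤ ENNReal.ofReal M) (hf : ∀ x, |f x| ≤ a * (k + g x)) :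
    ∫⁻ x, ENNReal.ofReal (f x ^ 2) ∂μ ≤ ENNReal.ofReal (2 * a ^ 2 * (k ^ 2 + M)) := by
  obtain ⟨hi, hle⟩ := integrable_sq_and_integral_le hg hM h
  have hi' : Integrable (fun x => 2 * a ^ 2 * (k ^ 2 + g x ^ 2)) μ :=
    ((integrable_const _).add hi).const_mul _
  calc ∫⁻ x, ENNReal.ofReal (f x ^ 2) ∂μ
      ≤ ∫⁻ x, ENNReal.ofReal (2 * a ^ 2 * (k ^ 2 + g x ^ 2)) ∂μ := by
        refine lintegral_mono fun x => ENNReal.ofReal_le_ofReal ?_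
        have h1 : f x ^ 2 ≤ (a * (k + g x)) ^ 2 := by
          rw [← sq_abs]
          exact pow_le_pow_left₀ (abs_nonneg _) (hf x) 2
        nlinarith [mul_nonneg (sq_nonneg a) (sq_nonneg (k - g x))]
    _ = ENNReal.ofReal (∫ x, 2 * a ^ 2 * (k ^ 2 + g x ^ 2) ∂μ) :=
        (ofReal_integral_eq_lintegral_ofReal hi' (ae_of_all _ fun x => by positivity)).symm
    _ ≤ _ := by
        refine ENNReal.ofReal_le_ofReal ?_
        rw [integral_const_mul, integral_add (integrable_const _) hi]
        simp only [integral_const, probReal_univ, one_smul]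
        gcongr

variable {d : ℕ} {T L : ℝ≥0} {W : E d → ℝ}

/-- Path laws with a given initial law and bounded cost have bounded second moments, and their
drifts are bounded at the origin. -/
lemma exists_uniform_bounds (hL : ∀ x y, ‖gradient W x - gradient W y‖ ≤ L * ‖x - y‖)
    (h0 : gradient W 0 = 0) {Q₀ : Measure (PathSpace d T)} [IsProbabilityMeasure Q₀]
    {κ : ℝ} (hκ : 0 < κ)
    (hexp : Integrable (fun w => Real.exp (κ * ‖w - ContinuousMap.const _ (X 0 w)‖ ^ 2)) Q₀)
    {μ₀ : Measure (E d)} (hμ₀ : MemP2 μ₀) {c : ℝ} (hc : 0 ≤ c) :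
    ∃ m M : ℝ, 0 ≤ M ∧ ∀ (P : Measure (PathSpace d T)) (hP : MemP1 P), P.map (X 0) = μ₀ →
      klDiv (P.map (meanFieldDrift hL h0 hP).noise) Q₀ ≤ ENNReal.ofReal c →
        (∀ t ∈ Icc (0 : ℝ) T, ‖(meanFieldDrift hL h0 hP).toFun t 0‖ ≤ m) ∧
          ∫⁻ ω, ENNReal.ofReal (‖ω‖ ^ 2) ∂P ≤ ENNReal.ofReal M := by
  obtain ⟨M, hM0, hM⟩ := exists_lintegral_sq_le hκ hexp hμ₀ hc
  -- 1 + M bounds the first moment of the noise through x ≤ 1 + x², and the exponential comes from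
  -- the mean field Grönwall estimate.
  set m : ℝ := L * ((1 + M) * Real.exp (2 * L * T)) with hm
  refine ⟨m, 2 * (Real.exp (L * T)) ^ 2 * ((m * T) ^ 2 + M), by positivity,
    fun P hP hP0 hPc => ?_⟩
  have := hP.1
  set b := meanFieldDrift hL h0 hP with hb
  have hnm : Measurable (b.noise : PathSpace d T → PathSpace d T) := b.continuous_noise.measurable
  have hMP := hM (P.map b.noise) (Measure.isProbabilityMeasure_map hnm.aemeasurable) hPc (by
    rw [Measure.map_map (continuous_X 0).measurable hnm, ← hP0]
    exact congrArg (fun g => P.map g) (funext b.X_zero_noise))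
  rw [lintegral_map (by fun_prop) hnm] at hMP
  obtain ⟨hi, hle⟩ := integrable_sq_and_integral_le hnm.norm hM0 hMP
  have hn : ∫ ω, ‖b.noise ω‖ ∂P ≤ 1 + M := by
    calc ∫ ω, ‖b.noise ω‖ ∂P ≤ ∫ ω, (1 + ‖b.noise ω‖ ^ 2) ∂P :=
          integral_mono (b.integrable_norm_noise hP) ((integrable_const _).add hi) fun ω => by
            nlinarith [sq_nonneg (‖b.noise ω‖ - 1), norm_nonneg (b.noise ω)]
      _ ≤ 1 + M := by
          rw [integral_add (integrable_const _) hi]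
          simpa using hle
  have hzero (t : ℝ) (ht : t ∈ Icc (0 : ℝ) T) : ‖b.toFun t 0‖ ≤ m := by
    refine (norm_meanFieldDrift_zero_le hL h0 hP t).trans ?_
    have := integral_norm_X_le hL h0 hP ht
    rw [hm]
    gcongr
    exact this.trans (by gcongr)
  refine ⟨hzero, lintegral_sq_le_of_abs_le (g := fun ω => ‖b.noise ω‖) hnm.norm hM0 hMP fun ω => ?_⟩
  rw [abs_norm, add_comm]
  exact b.norm_le_of_noise hzero ω

end UniformBounds

section Tightness

variable {d : ℕ} {T L : ℝ≥0} {W : E d → ℝ}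

open scoped Pointwise in
/-- The paths with noise in a given compact set form a relatively compact set, uniformly in the
drift. -/
lemma exists_isCompact_noise_preimage_subset (L : ℝ≥0) {K : Set (PathSpace d T)} (hK : IsCompact K)
    (m : ℝ) :
    ∃ K' : Set (PathSpace d T), IsCompact K' ∧ ∀ b : Drift d L,
      (∀ s ∈ Icc (0 : ℝ) T, ‖b.toFun s 0‖ ≤ m) → b.noise ⁻¹' K ⊆ K' := by
  obtain ⟨r, hr⟩ := hK.isBounded.exists_norm_le
  set C : ℝ≥0 := (L * (Real.exp (L * T) * (r + m * T)) + m).toNNReal with hC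
  -- A path is its noise plus the integral of the drift along it; the latter starts at zero and is
  -- Lipschitz in time with constant C.
  refine ⟨K + {w : PathSpace d T | LipschitzWith C w ∧ ∀ t, w t ∈ Metric.closedBall (0 : E d) (C * T)},
    hK.add (isCompact_setOf_lipschitz d T C _), fun b hb z hz => ?_⟩
  have hbound (s : ℝ) (hs : s ∈ Icc (0 : ℝ) T) : ‖b.toFun s (X s z)‖ ≤ C := by
    refine (b.norm_le s _).trans (le_trans ?_ (Real.le_coe_toNNReal _))
    gcongr
    · refine (norm_X_le s z).trans ((b.norm_le_of_noise hb z).trans ?_)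
      gcongr
      exact hr _ hz
    · exact hb s hs
  have hlip := b.norm_X_integralPath_sub_le_time hbound
  refine ⟨b.noise z, hz, b.integralPath z, ⟨LipschitzWith.of_dist_le_mul hlip, fun t => ?_⟩, ?_⟩
  · have h1 := hlip t ⟨0, le_rfl, T.coe_nonneg⟩
    have h2 : b.integralPath z ⟨0, le_rfl, T.coe_nonneg⟩ = 0 := intervalIntegral.integral_same
    rw [h2] at h1
    refine h1.trans ?_
    rw [Subtype.dist_eq, Real.dist_eq, sub_zero, abs_of_nonneg t.2.1]
    gcongr
    exact t.2.2
  · simp [Drift.noise]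

/-- Q₀ is tight, and bounded entropy transfers a compact set with small complement from Q₀ to all
the noise laws at once. The preimages of this set lie in one compact set although the drift varies
with P. -/
lemma isTightMeasureSet_of_klDiv_noise_le {Q₀ : Measure (PathSpace d T)} [IsProbabilityMeasure Q₀]
    {c : ℝ} (hc : 0 ≤ c) (m : ℝ) {A : Set (Measure (PathSpace d T))}
    (hA : ∀ P ∈ A, IsProbabilityMeasure P ∧ ∃ b : Drift d L,
      (∀ s ∈ Icc (0 : ℝ) T, ‖b.toFun s 0‖ ≤ m) ∧ klDiv (P.map b.noise) Q₀ ≤ ENNReal.ofReal c) :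
    IsTightMeasureSet A := by
  rw [isTightMeasureSet_iff_exists_isCompact_measure_compl_le]
  intro ε hε
  obtain ⟨r, hr0, hr⟩ := ENNReal.lt_iff_exists_nnreal_btwn.1 hε
  obtain ⟨δ, hδ, h⟩ := exists_measure_le_of_klDiv_le Q₀ hc (ε := r) (by exact_mod_cast hr0)
  obtain ⟨K, hK, hKδ⟩ := isTightMeasureSet_iff_exists_isCompact_measure_compl_le.1
    (isTightMeasureSet_singleton (μ := Q₀)) (ENNReal.ofReal δ) (by simpa using hδ)
  obtain ⟨K', hK', hsub⟩ := exists_isCompact_noise_preimage_subset L hK m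
  refine ⟨K', hK', fun P hP => ?_⟩
  obtain ⟨_, b, hb, hbc⟩ := hA P hP
  have hnm : Measurable (b.noise : PathSpace d T → PathSpace d T) := b.continuous_noise.measurable
  have hprob : IsProbabilityMeasure (P.map b.noise) :=
    Measure.isProbabilityMeasure_map hnm.aemeasurable
  have h1 := h (P.map b.noise) hprob hbc Kᶜ hK.isClosed.measurableSet.compl
    (ENNReal.toReal_le_of_le_ofReal hδ.le (hKδ Q₀ rfl))
  calc P K'ᶜ ≤ P (b.noise ⁻¹' Kᶜ) := measure_mono fun z hz hz' => hz (hsub b hb (by simpa using hz'))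
    _ = P.map b.noise Kᶜ := (Measure.map_apply hnm hK.isClosed.measurableSet.compl).symm
    _ ≤ r := by
        rw [← ENNReal.ofReal_coe_nnreal, ← ofReal_measureReal]
        exact ENNReal.ofReal_le_ofReal h1
    _ ≤ ε := hr.le

end Tightness

/-! ### Convergence of the drifts and of the noise maps. -/

section Limit

variable {d : ℕ} {T L : ℝ≥0} {W : E d → ℝ} {P : ℕ → ProbabilityMeasure (PathSpace d T)}
  {P' : ProbabilityMeasure (PathSpace d T)}

lemma memP1_of_lintegral_sq_le {P : Measure (PathSpace d T)} [IsProbabilityMeasure P] {M : ℝ}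
    (hM0 : 0 ≤ M) (hM : ∫⁻ ω, ENNReal.ofReal (‖ω‖ ^ 2) ∂P ≤ ENNReal.ofReal M) : MemP1 P :=
  ⟨inferInstance, integrable_of_integrable_sq continuous_norm.measurable
    (integrable_sq_and_integral_le continuous_norm.measurable hM0 hM).1⟩

/-- ∇W may grow linearly, so weak convergence alone does not suffice; the uniform second moments
make up for it. -/
lemma tendsto_drift (hL : ∀ x y, ‖gradient W x - gradient W y‖ ≤ L * ‖x - y‖)
    (h0 : gradient W 0 = 0) (h : Tendsto P atTop (𝓝 P')) {M : ℝ} (hM0 : 0 ≤ M)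
    (hM : ∀ n, ∫⁻ ω, ENNReal.ofReal (‖ω‖ ^ 2) ∂(P n : Measure (PathSpace d T)) ≤ ENNReal.ofReal M)
    (t : ℝ) (z : E d) :
    Tendsto (fun n => drift W (P n : Measure (PathSpace d T)) t z) atTop
      (𝓝 (drift W (P' : Measure (PathSpace d T)) t z)) := by
  have hcont : Continuous fun ω : PathSpace d T => gradient W (z - X t ω) :=
    (continuous_of_norm_sub_le hL).comp (continuous_const.sub (continuous_X t))
  have hM' := lintegral_le_of_tendsto h (by fun_prop) (fun ω => by positivity) hM
  simp_rw [drift_eq hL]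
  refine Tendsto.neg ?_
  rw [(EuclideanSpace.equiv (Fin d) ℝ).toHomeomorph.isInducing.tendsto_nhds_iff, tendsto_pi_nhds]
  intro i
  have hi (Q : ProbabilityMeasure (PathSpace d T))
      (hQ : ∫⁻ ω, ENNReal.ofReal (‖ω‖ ^ 2) ∂(Q : Measure (PathSpace d T)) ≤ ENNReal.ofReal M) :
      (∫ ω, gradient W (z - X t ω) ∂(Q : Measure (PathSpace d T))) i =
        ∫ ω, gradient W (z - X t ω) i ∂(Q : Measure (PathSpace d T)) :=
    ((EuclideanSpace.proj (𝕜 := ℝ) i).integral_comp_comm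
      (integrable_gradient_sub_X hL h0 (memP1_of_lintegral_sq_le hM0 hQ) t z)).symm
  have key : Tendsto (fun n => ∫ ω, gradient W (z - X t ω) i ∂(P n : Measure (PathSpace d T))) atTop
      (𝓝 (∫ ω, gradient W (z - X t ω) i ∂(P' : Measure (PathSpace d T)))) := by
    refine tendsto_integral_of_sq_le h (by fun_prop) (M := 2 * (L : ℝ) ^ 2 * (‖z‖ ^ 2 + M))
      (by positivity) fun n => lintegral_sq_le_of_abs_le continuous_norm.measurable hM0 (hM n)
        fun ω => ?_
    refine (PiLp.norm_apply_le (gradient W (z - X t ω)) i).trans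
      ((norm_gradient_sub_X_le hL h0 t z ω).trans ?_)
    gcongr
    exact norm_X_le t ω
  rw [← hi P' hM'] at key
  exact key.congr fun n => (hi (P n) (hM n)).symm

lemma Drift.norm_noise_sub_noise_le (b b' : Drift d L) (z : PathSpace d T) :
    ‖b.noise z - b'.noise z‖ ≤
      ∫ s in (0 : ℝ)..T, ‖b.toFun s (X s z) - b'.toFun s (X s z)‖ := by
  refine norm_path_le fun t ht => ?_
  rw [X_sub, b.X_noise ht, b'.X_noise ht, sub_sub_sub_cancel_left, norm_sub_rev,
    ← intervalIntegral.integral_sub ((b.continuous_along z).intervalIntegrable _ _)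
      ((b'.continuous_along z).intervalIntegrable _ _)]
  refine (intervalIntegral.norm_integral_le_integral_norm ht.1).trans ?_
  exact intervalIntegral.integral_mono_interval le_rfl ht.1 ht.2
    (ae_of_all _ fun s => norm_nonneg _)
    (((b.continuous_along z).sub (b'.continuous_along z)).norm.intervalIntegrable _ _)

/-- Dominated convergence along the fixed path z; the bound on the drifts at the origin together
with the common L gives the domination. -/
lemma Drift.tendsto_noise {b : ℕ → Drift d L} {b' : Drift d L} {m : ℝ}
    (hm : ∀ n, ∀ s ∈ Icc (0 : ℝ) T, ‖(b n).toFun s 0‖ ≤ m)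
    (h : ∀ s z, Tendsto (fun n => (b n).toFun s z) atTop (𝓝 (b'.toFun s z))) (z : PathSpace d T) :
    Tendsto (fun n => (b n).noise z) atTop (𝓝 (b'.noise z)) := by
  rw [tendsto_iff_norm_sub_tendsto_zero]
  refine squeeze_zero (fun _ => norm_nonneg _) (fun n => (b n).norm_noise_sub_noise_le b' z) ?_
  have hm' (s : ℝ) (hs : s ∈ Icc (0 : ℝ) T) : ‖b'.toFun s 0‖ ≤ m :=
    le_of_tendsto' (h s 0).norm fun n => hm n s hs
  have hlim := intervalIntegral.tendsto_integral_filter_of_dominated_convergence (μ := volume)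
    (a := (0 : ℝ)) (b := T) (l := atTop)
    (F := fun n s => ‖(b n).toFun s (X s z) - b'.toFun s (X s z)‖) (f := fun _ => (0 : ℝ))
    (fun _ => 2 * (L * ‖z‖ + m))
    (Eventually.of_forall fun n =>
      (((b n).continuous_along z).sub (b'.continuous_along z)).norm.aestronglyMeasurable)
    (Eventually.of_forall fun n => ae_of_all _ fun s hs => ?_) intervalIntegrable_const
    (ae_of_all _ fun s _ => ?_)
  · simpa using hlim
  · rw [uIoc_of_le T.coe_nonneg] at hs
    have hs' : s ∈ Icc (0 : ℝ) T := ⟨hs.1.le, hs.2⟩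
    have hX : L * ‖X s z‖ ≤ L * ‖z‖ := by gcongr; exact norm_X_le s z
    rw [norm_norm]
    refine (norm_sub_le _ _).trans ?_
    linarith [(b n).norm_le s (X s z), b'.norm_le s (X s z), hm n s hs', hm' s hs']
  · exact tendsto_iff_norm_sub_tendsto_zero.1 (h s (X s z))

end Limit

/-! ### The admissible set: nonemptiness and closedness of the marginal constraints. -/

section Admissible

variable {d : ℕ} {T : ℝ≥0}

/-- The linear interpolation between two points. -/
def segmentPath (T : ℝ≥0) : C(E d × E d, PathSpace d T) :=
  ContinuousMap.curry ⟨fun q : (E d × E d) × Icc (0 : ℝ) T =>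
    q.1.1 + ((q.2 : ℝ) / T) • (q.1.2 - q.1.1), by fun_prop⟩

lemma segmentPath_apply (p : E d × E d) (t : Icc (0 : ℝ) T) :
    segmentPath T p t = p.1 + ((t : ℝ) / T) • (p.2 - p.1) := rfl

lemma X_zero_segmentPath (p : E d × E d) : X 0 (segmentPath T p) = p.1 := by
  rw [X_of_mem ⟨le_rfl, T.coe_nonneg⟩, segmentPath_apply]
  simp

lemma X_end_segmentPath (hT : 0 < T) (p : E d × E d) : X T (segmentPath T p) = p.2 := by
  rw [X_of_mem ⟨T.coe_nonneg, le_rfl⟩, segmentPath_apply]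
  simp [hT.ne']

lemma norm_segmentPath_le (p : E d × E d) : ‖segmentPath T p‖ ≤ ‖p.1‖ + ‖p.2 - p.1‖ := by
  refine (ContinuousMap.norm_le_of_nonempty _).2 fun t => ?_
  rw [segmentPath_apply]
  refine (norm_add_le _ _).trans (add_le_add le_rfl ?_)
  rw [norm_smul, Real.norm_of_nonneg (div_nonneg t.2.1 T.coe_nonneg)]
  exact mul_le_of_le_one_left (norm_nonneg _) (div_le_one_of_le₀ t.2.2 T.coe_nonneg)

lemma MemP2.integrable_norm {μ : Measure (E d)} (hμ : MemP2 μ) : Integrable (fun x => ‖x‖) μ := by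
  have := hμ.1
  exact integrable_of_integrable_sq measurable_norm hμ.2

/-- The endpoints are drawn independently and joined by a segment. -/
lemma admissible_nonempty (hT : 0 < T) {μin μfin : Measure (E d)} (hin : MemP2 μin)
    (hfin : MemP2 μfin) : (admissible T μin μfin).Nonempty := by
  have := hin.1
  have := hfin.1
  have hm : Measurable (segmentPath T : E d × E d → PathSpace d T) :=
    (segmentPath T).continuous.measurable
  refine ⟨(μin.prod μfin).map (segmentPath T),
    ⟨Measure.isProbabilityMeasure_map hm.aemeasurable, ?_⟩, ?_, ?_⟩
  · rw [integrable_map_measure continuous_norm.aestronglyMeasurable hm.aemeasurable]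
    have h1 : Integrable (fun p : E d × E d => ‖p.1‖) (μin.prod μfin) :=
      hin.integrable_norm.comp_fst μfin
    have h2 : Integrable (fun p : E d × E d => ‖p.2‖) (μin.prod μfin) :=
      hfin.integrable_norm.comp_snd μin
    refine ((h1.add h1).add h2).mono' (segmentPath T).continuous.norm.aestronglyMeasurable
      (ae_of_all _ fun p => ?_)
    have h3 := norm_segmentPath_le (T := T) p
    have h4 := norm_sub_le p.2 p.1
    simp only [Function.comp_apply, norm_norm, Pi.add_apply]
    linarith
  · rw [marginal, Measure.map_map (continuous_X 0).measurable hm]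
    have : X 0 ∘ segmentPath T = (Prod.fst : E d × E d → E d) := funext X_zero_segmentPath
    rw [this]
    simp
  · rw [marginal, Measure.map_map (continuous_X _).measurable hm]
    have : X T ∘ segmentPath T = (Prod.snd : E d × E d → E d) := funext (X_end_segmentPath hT)
    rw [this]
    simp

lemma marginal_eq_of_tendsto {P : ℕ → ProbabilityMeasure (PathSpace d T)}
    {P' : ProbabilityMeasure (PathSpace d T)} (h : Tendsto P atTop (𝓝 P')) {t : ℝ}
    {μ : Measure (E d)} (hP : ∀ n, marginal (P n : Measure (PathSpace d T)) t = μ) :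
    marginal (P' : Measure (PathSpace d T)) t = μ := by
  have h1 := ProbabilityMeasure.tendsto_map_of_tendsto_of_continuous P P' h (continuous_X t)
  have h2 (n : ℕ) : (P n).map (continuous_X t).aemeasurable = (P 0).map (continuous_X t).aemeasurable :=
    Subtype.ext ((hP n).trans (hP 0).symm)
  simp_rw [h2] at h1
  have h3 := tendsto_nhds_unique h1 tendsto_const_nhds
  rw [← hP 0]
  exact congrArg Subtype.val h3

end Admissible

/-! ### The cost with a fixed reference measure, and the direct method. -/

section Cost

variable {d : ℕ} {T L : ℝ≥0} {W : E d → ℝ}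

/-- The data processing inequality applied to a map and to its inverse. -/
lemma Drift.klDiv_map_solve (b : Drift d L) (P Q₀ : Measure (PathSpace d T)) [IsProbabilityMeasure P]
    [IsProbabilityMeasure Q₀] : klDiv P (Q₀.map b.solve) = klDiv (P.map b.noise) Q₀ := by
  have hn : Measurable (b.noise : PathSpace d T → PathSpace d T) := b.continuous_noise.measurable
  have hs : Measurable (b.solve : PathSpace d T → PathSpace d T) := b.continuous_solve.measurable
  have := Measure.isProbabilityMeasure_map (μ := P) hn.aemeasurable
  have := Measure.isProbabilityMeasure_map (μ := Q₀) hs.aemeasurable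
  have h1 : (P.map b.noise).map b.solve = P := by
    rw [Measure.map_map hs hn, show b.solve ∘ b.noise = id from funext b.solve_noise,
      Measure.map_id]
  have h2 : (Q₀.map b.solve).map b.noise = Q₀ := by
    rw [Measure.map_map hn hs, show b.noise ∘ b.solve = id from funext b.noise_solve,
      Measure.map_id]
  refine le_antisymm ?_ ?_
  · have := klDiv_map_le (P.map b.noise) Q₀ hs
    rwa [h1] at this
  · have := klDiv_map_le P (Q₀.map b.solve) hn
    rwa [h2] at this

lemma cost_eq (hL : ∀ x y, ‖gradient W x - gradient W y‖ ≤ L * ‖x - y‖) (h0 : gradient W 0 = 0)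
    {μ₀ : Measure (E d)} {Q₀ : Measure (PathSpace d T)} [IsProbabilityMeasure Q₀]
    (hQ₀ : ∀ (L : ℝ≥0) (b : Drift d L) (Q : Measure (PathSpace d T)),
      IsLawOfStrongSolution b.toFun μ₀ Q ↔ Q = Q₀.map b.solve)
    {P : Measure (PathSpace d T)} (hP : MemP1 P) :
    cost W μ₀ P = klDiv (P.map (meanFieldDrift hL h0 hP).noise) Q₀ := by
  have := hP.1
  -- `Gamma` is a choice, so existence of a solution law is needed to know that it is one;
  -- uniqueness then identifies it.
  have h1 : IsLawOfStrongSolution (drift W P) μ₀ (Gamma W μ₀ P) :=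
    Classical.epsilon_spec (p := fun Q => IsLawOfStrongSolution (drift W P) μ₀ Q)
      ⟨_, (hQ₀ L (meanFieldDrift hL h0 hP) _).2 rfl⟩
  rw [cost, (hQ₀ L (meanFieldDrift hL h0 hP) _).1 h1, Drift.klDiv_map_solve]

/-- The infimum of the cost along a sequence of admissible laws of bounded cost is attained in the
limit. -/
lemma exists_cost_le_of_tendsto (hL : ∀ x y, ‖gradient W x - gradient W y‖ ≤ L * ‖x - y‖)
    (h0 : gradient W 0 = 0) {μin μfin : Measure (E d)} (hin : MemP2 μin)
    {Q₀ : Measure (PathSpace d T)} [IsProbabilityMeasure Q₀] {κ : ℝ} (hκ : 0 < κ)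
    (hexp : Integrable (fun w => Real.exp (κ * ‖w - ContinuousMap.const _ (X 0 w)‖ ^ 2)) Q₀)
    (hQ₀ : ∀ (L : ℝ≥0) (b : Drift d L) (Q : Measure (PathSpace d T)),
      IsLawOfStrongSolution b.toFun μin Q ↔ Q = Q₀.map b.solve)
    {P : ℕ → Measure (PathSpace d T)} (hP : ∀ n, P n ∈ admissible T μin μfin)
    {c : ℕ → ℝ} {c' : ℝ} (hc0 : ∀ n, 0 ≤ c n) (hPc : ∀ n, cost W μin (P n) ≤ ENNReal.ofReal (c n))
    (hc : Tendsto c atTop (𝓝 c')) :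
    ∃ P' ∈ admissible T μin μfin, cost W μin P' ≤ ENNReal.ofReal c' := by
  have hprob (n : ℕ) : IsProbabilityMeasure (P n) := (hP n).1.1
  obtain ⟨C, hC⟩ := hc.bddAbove_range
  have hcC (n : ℕ) : c n ≤ C := hC ⟨n, rfl⟩
  have hC0 : 0 ≤ C := (hc0 0).trans (hcC 0)
  let b (n : ℕ) : Drift d L := meanFieldDrift hL h0 (hP n).1
  have hkl (n : ℕ) : klDiv ((P n).map (b n).noise) Q₀ ≤ ENNReal.ofReal (c n) := by
    rw [← cost_eq hL h0 hQ₀ (hP n).1]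
    exact hPc n
  obtain ⟨m, M, hM0, hbounds⟩ := exists_uniform_bounds hL h0 hκ hexp hin hC0
  have hb (n : ℕ) := hbounds (P n) (hP n).1 (hP n).2.1
    ((hkl n).trans (ENNReal.ofReal_le_ofReal (hcC n)))
  let Pn (n : ℕ) : ProbabilityMeasure (PathSpace d T) := ⟨P n, hprob n⟩
  have htight : IsTightMeasureSet {((μ : ProbabilityMeasure (PathSpace d T)) : Measure (PathSpace d T)) |
      μ ∈ range Pn} := by
    refine isTightMeasureSet_of_klDiv_noise_le (L := L) (Q₀ := Q₀) hC0 m ?_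
    rintro _ ⟨_, ⟨n, rfl⟩, rfl⟩
    exact ⟨hprob n, b n, (hb n).1, (hkl n).trans (ENNReal.ofReal_le_ofReal (hcC n))⟩
  obtain ⟨P', -, φ, hφ, hlim⟩ := (isCompact_closure_of_isTightMeasureSet htight).tendsto_subseq
    (x := Pn) fun n => subset_closure ⟨n, rfl⟩
  have hM (n : ℕ) : ∫⁻ ω, ENNReal.ofReal (‖ω‖ ^ 2) ∂((Pn ∘ φ) n : Measure (PathSpace d T)) ≤
    ENNReal.ofReal M := (hb (φ n)).2
  have hM' := lintegral_le_of_tendsto hlim (by fun_prop) (fun ω => by positivity) hM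
  have hP' := memP1_of_lintegral_sq_le hM0 hM'
  refine ⟨P', ⟨hP', marginal_eq_of_tendsto hlim fun n => (hP _).2.1,
    marginal_eq_of_tendsto hlim fun n => (hP _).2.2⟩, ?_⟩
  rw [cost_eq hL h0 hQ₀ hP']
  -- The path laws and the noise maps vary together along the subsequence; pointwise convergence of
  -- the equi-Lipschitz maps is enough for the image laws to converge.
  have hnoise := Drift.tendsto_noise (b := fun n => b (φ n)) (b' := meanFieldDrift hL h0 hP')
    (m := m) (fun n => (hb (φ n)).1) fun s z => tendsto_drift hL h0 hlim hM0 hM s z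
  exact klDiv_le_of_tendsto (tendsto_map_of_lipschitz hlim (fun n => (b (φ n)).lipschitzWith_noise)
    (meanFieldDrift hL h0 hP').lipschitzWith_noise hnoise) (fun n => hc0 (φ n))
    (fun n => hkl (φ n)) (hc.comp hφ.tendsto_atTop)

lemma exists_forall_cost_le (hT : 0 < T)
    (hL : ∀ x y, ‖gradient W x - gradient W y‖ ≤ L * ‖x - y‖)
    (h0 : gradient W 0 = 0) {μin μfin : Measure (E d)} (hin : MemP2 μin) (hfin : MemP2 μfin)
    {Q₀ : Measure (PathSpace d T)} [IsProbabilityMeasure Q₀] {κ : ℝ} (hκ : 0 < κ)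
    (hexp : Integrable (fun w => Real.exp (κ * ‖w - ContinuousMap.const _ (X 0 w)‖ ^ 2)) Q₀)
    (hQ₀ : ∀ (L : ℝ≥0) (b : Drift d L) (Q : Measure (PathSpace d T)),
      IsLawOfStrongSolution b.toFun μin Q ↔ Q = Q₀.map b.solve) :
    ∃ P ∈ admissible T μin μfin, ∀ P' ∈ admissible T μin μfin, cost W μin P ≤ cost W μin P' := by
  set I : ℝ≥0∞ := ⨅ P ∈ admissible T μin μfin, cost W μin P with hI
  have hIle (P' : Measure (PathSpace d T)) (hP' : P' ∈ admissible T μin μfin) :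
      I ≤ cost W μin P' := iInf₂_le P' hP'
  -- When every admissible cost is infinite, any admissible law is optimal.
  by_cases htop : I = ⊤
  · obtain ⟨P, hP⟩ := admissible_nonempty hT hin hfin
    exact ⟨P, hP, fun P' hP' => le_top.trans (htop ▸ hIle P' hP')⟩
  have hex (n : ℕ) : ∃ P ∈ admissible T μin μfin,
      cost W μin P ≤ ENNReal.ofReal (I.toReal + 1 / ((n : ℝ) + 1)) := by
    have hlt : I < ENNReal.ofReal (I.toReal + 1 / ((n : ℝ) + 1)) := by
      rw [ENNReal.lt_ofReal_iff_toReal_lt htop]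
      have : 0 < 1 / ((n : ℝ) + 1) := by positivity
      linarith
    by_contra! hcon
    exact hlt.not_ge (le_iInf₂ fun P hP => (hcon P hP).le)
  choose P hP hPc using hex
  have hlim : Tendsto (fun n : ℕ => I.toReal + 1 / ((n : ℝ) + 1)) atTop (𝓝 (I.toReal + 0)) :=
    tendsto_one_div_add_atTop_nhds_zero_nat.const_add _
  obtain ⟨P', hP', hle⟩ := exists_cost_le_of_tendsto hL h0 hin hκ hexp hQ₀ hP
    (fun n => by positivity) hPc hlim
  rw [add_zero, ENNReal.ofReal_toReal htop] at hle
  exact ⟨P', hP', fun P'' hP'' => hle.trans (hIle P'' hP'')⟩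

end Cost

end MeanFieldSchrodinger

end

theorem mainTheorem10 (d : ℕ) (T : ℝ≥0) (hT : 0 < T)
    (W : MeanFieldSchrodinger.E d → ℝ) (μin μfin : Measure (MeanFieldSchrodinger.E d))
    (h1 : MeanFieldSchrodinger.H1 W) (h2 : MeanFieldSchrodinger.H2 W μin μfin) :
    (∀ P : Measure (MeanFieldSchrodinger.PathSpace d T), MeanFieldSchrodinger.MemP1 P →
      ∃! Q : Measure (MeanFieldSchrodinger.PathSpace d T),
        MeanFieldSchrodinger.IsLawOfStrongSolution (MeanFieldSchrodinger.drift W P) μin Q) ∧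
    ∃ P ∈ MeanFieldSchrodinger.admissible T μin μfin,
      ∀ P' ∈ MeanFieldSchrodinger.admissible T μin μfin,
        MeanFieldSchrodinger.cost W μin P ≤ MeanFieldSchrodinger.cost W μin P' := by
  have := h2.memP2_in.1
  obtain ⟨L, hL⟩ := h1.exists_lipschitz_gradient
  obtain ⟨Q₀, _, ⟨κ, hκ, hexp⟩, hQ₀⟩ := MeanFieldSchrodinger.exists_noiseLaw T μin
  refine ⟨fun P hP => ?_, MeanFieldSchrodinger.exists_forall_cost_le hT hL h1.gradient_zero
    h2.memP2_in h2.memP2_fin hκ hexp hQ₀⟩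
  have h := hQ₀ L (MeanFieldSchrodinger.meanFieldDrift hL h1.gradient_zero hP)
  exact ⟨_, (h _).2 rfl, fun Q hQ => (h Q).1 hQ⟩
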